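/- Let $b\ge 2$ be an integer. Radix Selection with $b$ buckets selects the datum of rank $\ell$ (the $\ell$-th smallest) among $n$ data in $[0,1]$ as follows. The current bucket is initially $[0,1]$. As long as the current bucket contains at least two data, it is decomposed into $b$ buckets of equal length (half-open on the right, except that the right endpoint $1$ belongs to the last bucket), each of its data is assigned to one of these buckets at the cost of one bucket operation per datum, and the bucket that contains the datum of rank $\ell$ becomes the current bucket. The algorithm stops once the current bucket contains no datum other than the one to be selected. For $1\le \ell\le n$ let $Y_n(\ell)$ be the total number of bucket operations when the data are $n$ independent random variables, uniformly distributed on $[0,1]$; set $Y_n(n+1):=Y_n(n)$. For $n\ge 1$ and $t\in[0,1]$ let $$X_n(t):=\frac{Y_n(\lfloor tn\rfloor+1)-\frac{b}{b-1}n}{\sqrt n}.$$ For $s,t\in[0,1]$ let $s=\sum_{i\ge1}s_ib^{-i}$ and $t=\sum_{i\ge1}t_ib^{-i}$ be their $b$-ary expansions with digits in $\{0,\dots,b-1\}$, where for a number in $[0,1)$ the expansion with infinitely many digits different from $b-1$ is taken, and for the number $1$ the one with all digits equal to $b-1$. Let $$j(s,t):=\sup\{k\ge 0: (s_1,\dots,s_k)=(t_1,\dots,t_k)\}\in\{0,1,2,\dots\}\cup\{\infty\}.$$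 Then there is a centered Gaussian process $G=(G(t))_{t\in[0,1]}$ with càdlàg paths, depending only on $b$, with covariance function $$\mathbb E[G(s)G(t)]=\frac{b}{(b-1)^2}-\frac{b+1}{(b-1)^2}\,b^{-j(s,t)},\qquad s,t\in[0,1],\qquad b^{-\infty}:=0,$$ such that, as $n\to\infty$, the processes $X_n=(X_n(t))_{t\in[0,1]}$ converge in distribution to $G$ in the space $D[0,1]$ of càdlàg functions on $[0,1]$, endowed with the Skorokhod metric $$d(x,y)=\inf_{\lambda}\max\Big\{\sup_{t\in[0,1]}|\lambda(t)-t|,\ \sup_{t\in[0,1]}|x(t)-y(\lambda(t))|\Big\},$$ where $\lambda$ ranges over the increasing bijections of $[0,1]$. -/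

import Mathlib

open MeasureTheory ProbabilityTheory Filter Topology
open scoped unitInterval

noncomputable section

namespace RadixSelection

/-! ### The space `D[0,1]` with the Skorokhod metric -/

/-- The space `D[0,1]` of càdlàg functions `[0,1] → ℝ`: right-continuous with left limits.
(At `t = 1` the first condition and at `t = 0` the second one are void.) -/
@[ext]
structure Cadlag where
  toFun : I → ℝ
  right_cont : ∀ t, ContinuousWithinAt toFun (Set.Ici t) t
  left_lim : ∀ t, ∃ l, Tendsto toFun (𝓝[<] t) (𝓝 l)

instance : CoeFun Cadlag (fun _ => I → ℝ) := ⟨Cadlag.toFun⟩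

/-- There is an increasing bijection `φ` of `[0,1]` onto itself such that
`sup |φ(t) - t| ≤ ε` and `sup |x(t) - y(φ(t))| ≤ ε`. -/
def SkorokhodClose (x y : Cadlag) (ε : ℝ) : Prop :=
  ∃ φ : I ≃o I, ∀ t, |(φ t : ℝ) - t| ≤ ε ∧ |x t - y (φ t)| ≤ ε

/-- The Skorokhod distance `d(x, y)`. -/
def skorokhodDist (x y : Cadlag) : ℝ := sInf {ε : ℝ | SkorokhodClose x y ε}

lemma SkorokhodClose.nonneg {x y : Cadlag} {ε : ℝ} (h : SkorokhodClose x y ε) : 0 ≤ ε := by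
  obtain ⟨φ, h⟩ := h
  exact (abs_nonneg _).trans (h 0).1

lemma SkorokhodClose.symm {x y : Cadlag} {ε : ℝ} (h : SkorokhodClose x y ε) :
    SkorokhodClose y x ε := by
  obtain ⟨φ, h⟩ := h
  refine ⟨φ.symm, fun t => ?_⟩
  have := h (φ.symm t)
  rw [OrderIso.apply_symm_apply] at this
  rw [abs_sub_comm, abs_sub_comm (y t)]
  exact this

lemma SkorokhodClose.trans {x y z : Cadlag} {ε δ : ℝ} (h : SkorokhodClose x y ε)
    (h' : SkorokhodClose y z δ) : SkorokhodClose x z (ε + δ) := by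
  obtain ⟨φ, h⟩ := h
  obtain ⟨ψ, h'⟩ := h'
  refine ⟨φ.trans ψ, fun t => ?_⟩
  have h1 := h t
  have h2 := h' (φ t)
  simp only [OrderIso.trans_apply]
  constructor
  · have := abs_sub_le (ψ (φ t) : ℝ) (φ t) t
    linarith [h1.1, h2.1]
  · have := abs_sub_le (x t) (y (φ t)) (z (ψ (φ t)))
    linarith [h1.2, h2.2]

lemma Cadlag.exists_bound (x : Cadlag) : ∃ C : ℝ, ∀ t, |x t| ≤ C := by
  have key : ∃ C : ℝ, ∀ t ∈ (Set.univ : Set I), |x t| ≤ C := by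
    refine isCompact_univ.induction_on (p := fun s => ∃ C : ℝ, ∀ t ∈ s, |x t| ≤ C) ?_ ?_ ?_ ?_
    · exact ⟨0, by simp⟩
    · rintro s u hsu ⟨C, hC⟩
      exact ⟨C, fun t ht => hC t (hsu ht)⟩
    · rintro s u ⟨C, hC⟩ ⟨C', hC'⟩
      refine ⟨max C C', fun t ht => ?_⟩
      rcases ht with ht | ht
      · exact (hC t ht).trans (le_max_left _ _)
      · exact (hC' t ht).trans (le_max_right _ _)
    · intro t _
      obtain ⟨l, hl⟩ := x.left_lim t
      have e1 : ∀ᶠ s in 𝓝[<] t, |x s| ≤ |l| + 1 :=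
        (hl.abs.eventually_lt_const (lt_add_one _)).mono fun _ h => h.le
      have e2 : ∀ᶠ s in 𝓝[≥] t, |x s| ≤ |x t| + 1 :=
        ((x.right_cont t).abs.eventually_lt_const (lt_add_one _)).mono fun _ h => h.le
      refine ⟨{s | |x s| ≤ max (|l| + 1) (|x t| + 1)}, ?_, _, fun s hs => hs⟩
      rw [nhdsWithin_univ, ← nhdsLT_sup_nhdsGE]
      exact ⟨e1.mono fun _ h => h.trans (le_max_left _ _),
        e2.mono fun _ h => h.trans (le_max_right _ _)⟩
  obtain ⟨C, hC⟩ := key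
  exact ⟨C, fun t => hC t trivial⟩

lemma exists_skorokhodClose (x y : Cadlag) : ∃ ε, SkorokhodClose x y ε := by
  obtain ⟨C, hC⟩ := x.exists_bound
  obtain ⟨C', hC'⟩ := y.exists_bound
  refine ⟨C + C', OrderIso.refl I, fun t => ⟨?_, ?_⟩⟩
  · simpa using add_nonneg ((abs_nonneg _).trans (hC 0)) ((abs_nonneg _).trans (hC' 0))
  · exact (abs_sub _ _).trans (add_le_add (hC _) (hC' _))

lemma bddBelow_skorokhodClose (x y : Cadlag) : BddBelow {ε : ℝ | SkorokhodClose x y ε} :=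
  ⟨0, fun _ h => SkorokhodClose.nonneg h⟩

lemma exists_skorokhodClose_lt {x y : Cadlag} {ε : ℝ} (h : skorokhodDist x y < ε) :
    ∃ δ < ε, SkorokhodClose x y δ := by
  obtain ⟨δ, hδ, hlt⟩ := exists_lt_of_csInf_lt (exists_skorokhodClose x y) h
  exact ⟨δ, hlt, hδ⟩

lemma eq_of_skorokhodDist_eq_zero {x y : Cadlag} (h : skorokhodDist x y = 0) : x = y := by
  have hclose : ∀ ε > 0, ∃ φ : I ≃o I, ∀ t, |(φ t : ℝ) - t| < ε ∧ |x t - y (φ t)| < ε := by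
    intro ε hε
    obtain ⟨δ, hδ, φ, hφ⟩ := exists_skorokhodClose_lt (h.trans_lt hε)
    exact ⟨φ, fun t => ⟨(hφ t).1.trans_lt hδ, (hφ t).2.trans_lt hδ⟩⟩
  ext t
  refine eq_of_abs_sub_le_all fun ε hε => ?_
  rcases eq_or_ne t 1 with rfl | ht
  · obtain ⟨φ, hφ⟩ := hclose ε hε
    have := (hφ 1).2
    have h1 : φ 1 = 1 := φ.map_top
    rw [h1] at this
    exact this.le
  · have ht1 : t < 1 := lt_of_le_of_ne unitInterval.le_one' ht
    have hx := Metric.continuousWithinAt_iff.1 (x.right_cont t) (ε / 3) (by positivity)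
    have hy := Metric.continuousWithinAt_iff.1 (y.right_cont t) (ε / 3) (by positivity)
    obtain ⟨δ, hδ, hx⟩ := hx
    obtain ⟨δ', hδ', hy⟩ := hy
    have ht1' : (t : ℝ) < 1 := ht1
    set r : ℝ := min (min (δ / 2) (δ' / 2)) (1 - t) with hr
    have hr0 : 0 < r := by
      simp only [hr, lt_min_iff]
      exact ⟨⟨by positivity, by positivity⟩, by linarith⟩
    have hr1 : r ≤ δ / 2 := (min_le_left _ _).trans (min_le_left _ _)
    have hr2 : r ≤ δ' / 2 := (min_le_left _ _).trans (min_le_right _ _)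
    have hr3 : r ≤ 1 - t := min_le_right _ _
    have ht0 : (0 : ℝ) ≤ t := t.2.1
    let s : I := ⟨t + r / 2, by constructor <;> linarith⟩
    have hs : (s : ℝ) = t + r / 2 := rfl
    obtain ⟨φ, hφ⟩ := hclose (min (ε / 3) (r / 2)) (by positivity)
    obtain ⟨h1, h2⟩ := hφ s
    have h1 := h1.trans_le (min_le_right _ _)
    have h2 := h2.trans_le (min_le_left _ _)
    rw [abs_lt] at h1
    have hxs : |x s - x t| < ε / 3 := by
      refine hx (x := s) (show (t : ℝ) ≤ s by rw [hs]; linarith) ?_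
      rw [Subtype.dist_eq, Real.dist_eq, hs, abs_lt]
      constructor <;> linarith
    have hys : |y (φ s) - y t| < ε / 3 := by
      refine hy (x := φ s) (show (t : ℝ) ≤ φ s by linarith) ?_
      rw [Subtype.dist_eq, Real.dist_eq, abs_lt]
      constructor <;> linarith
    rw [abs_lt] at hxs hys h2
    show |x t - y t| ≤ ε
    rw [abs_le]
    constructor <;> linarith

instance : MetricSpace Cadlag where
  dist := skorokhodDist
  dist_self x := by
    refine le_antisymm (csInf_le (bddBelow_skorokhodClose x x) ⟨OrderIso.refl I, by simp⟩) ?_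
    exact Real.sInf_nonneg fun _ h => SkorokhodClose.nonneg h
  dist_comm x y := by
    have : {ε : ℝ | SkorokhodClose x y ε} = {ε : ℝ | SkorokhodClose y x ε} :=
      Set.ext fun _ => ⟨fun h => h.symm, fun h => h.symm⟩
    simp only [skorokhodDist, this]
  dist_triangle x y z := by
    refine le_of_forall_pos_lt_add fun η hη => ?_
    obtain ⟨ε, hε, h⟩ := exists_skorokhodClose_lt
      (show skorokhodDist x y < skorokhodDist x y + η / 2 by linarith)
    obtain ⟨δ, hδ, h'⟩ := exists_skorokhodClose_lt
      (show skorokhodDist y z < skorokhodDist y z + η / 2 by linarith)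
    have := csInf_le (bddBelow_skorokhodClose x z) (h.trans h')
    change skorokhodDist x z ≤ _ at this
    linarith
  eq_of_dist_eq_zero := eq_of_skorokhodDist_eq_zero

instance : MeasurableSpace Cadlag := borel Cadlag

instance : BorelSpace Cadlag := ⟨rfl⟩

/-! ### The algorithm and its number of bucket operations -/

/-- The bucket `[lo, lo + w)` (or `[lo, lo + w]`) is decomposed into `b` buckets of length `w / b`,
numbered `0, …, b - 1`; this is the number of the one that contains `x`. It is the `r` with
`lo + r * w / b ≤ x < lo + (r + 1) * w / b`; the right endpoint of the last bucket belongs to the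
last bucket. -/
def bucketOf (b : ℕ) (lo w x : ℝ) : ℕ := min ⌊(x - lo) / (w / b)⌋₊ (b - 1)

/-- The number of bucket operations made in the first `m` rounds when rank `ℓ` (counted from `1`)
is selected among the data `x i`, `i ∈ S`, which lie in the bucket that starts at `lo` and has
length `w`. If there is at most one datum, the algorithm has stopped. Otherwise each of the data
is assigned to one of `b` smaller buckets, at the cost of one operation per datum, and the
algorithm goes on in the bucket `r` that contains the datum of rank `ℓ`: the one with `F r < ℓ` and
`ℓ ≤ F (r + 1)`, where `F r` is the number of data in the buckets `0, …, r - 1`. -/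
def bucketOps {n : ℕ} (b : ℕ) (x : Fin n → ℝ) :
    (m : ℕ) → (lo w : ℝ) → (S : Finset (Fin n)) → (ℓ : ℕ) → ℕ
  | 0, _, _, _, _ => 0
  | m + 1, lo, w, S, ℓ =>
    if S.card ≤ 1 then 0
    else
      let F : ℕ → ℕ := fun r => (S.filter fun i => bucketOf b lo w (x i) < r).card
      S.card + ∑ r ∈ Finset.range b,
        if F r < ℓ ∧ ℓ ≤ F (r + 1) then
          bucketOps b x m (lo + r * (w / b)) (w / b)
            (S.filter fun i => bucketOf b lo w (x i) = r) (ℓ - F r)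
        else 0

/-- The total number `Y_n(ℓ)` of bucket operations needed to select rank `ℓ` among the data
`x 0, …, x (n - 1)` in `[0,1]`. It is infinite if the algorithm does not stop, which can only happen
if two of the data are equal. -/
def Y {n : ℕ} (b : ℕ) (x : Fin n → ℝ) (ℓ : ℕ) : ℕ∞ :=
  ⨆ m : ℕ, (bucketOps b x m 0 1 Finset.univ ℓ : ℕ∞)

/-- The value at `t` of the normalized process. The convention `Y_n(n + 1) := Y_n(n)` is the
minimum with `n`. Infinite values of `Y_n`, which have probability zero, are read as `0`. -/
def normalized {n : ℕ} (b : ℕ) (x : Fin n → ℝ) (t : I) : ℝ :=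
  (((Y b x (min (⌊(t : ℝ) * n⌋₊ + 1) n)).toNat : ℝ) - (b : ℝ) / ((b : ℝ) - 1) * n) / √n

lemma floor_right (n : ℕ) (t : I) :
    ∀ᶠ s : I in 𝓝[≥] t, ⌊(s : ℝ) * n⌋₊ = ⌊(t : ℝ) * n⌋₊ := by
  have hc : Tendsto (fun s : I => (s : ℝ) * n) (𝓝[≥] t) (𝓝[≥] ((t : ℝ) * n)) := by
    refine tendsto_nhdsWithin_iff.2 ⟨?_, ?_⟩
    · exact (Continuous.tendsto (by fun_prop) t).mono_left nhdsWithin_le_nhds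
    · filter_upwards [self_mem_nhdsWithin] with s hs
      exact mul_le_mul_of_nonneg_right (show (t : ℝ) ≤ s from hs) (Nat.cast_nonneg n)
  have := hc.eventually ((tendsto_floor_right_pure_floor ((t : ℝ) * n)).eventually
    (eventually_pure.2 rfl : ∀ᶠ z in pure ⌊(t : ℝ) * n⌋, z = ⌊(t : ℝ) * n⌋))
  filter_upwards [this] with s hs
  rw [← Int.floor_toNat, ← Int.floor_toNat, hs]

lemma floor_left (n : ℕ) (t : I) :
    ∃ k : ℕ, ∀ᶠ s : I in 𝓝[<] t, ⌊(s : ℝ) * n⌋₊ = k := by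
  rcases Nat.eq_zero_or_pos n with rfl | hn
  · exact ⟨0, by simp⟩
  have hc : Tendsto (fun s : I => (s : ℝ) * n) (𝓝[<] t) (𝓝[<] ((t : ℝ) * n)) := by
    refine tendsto_nhdsWithin_iff.2 ⟨?_, ?_⟩
    · exact (Continuous.tendsto (by fun_prop) t).mono_left nhdsWithin_le_nhds
    · filter_upwards [self_mem_nhdsWithin] with s hs
      exact mul_lt_mul_of_pos_right (show (s : ℝ) < t from hs) (Nat.cast_pos.2 hn)
  have := hc.eventually ((tendsto_floor_left_pure_ceil_sub_one ((t : ℝ) * n)).eventually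
    (eventually_pure.2 rfl : ∀ᶠ z in pure (⌈(t : ℝ) * n⌉ - 1), z = ⌈(t : ℝ) * n⌉ - 1))
  refine ⟨(⌈(t : ℝ) * n⌉ - 1).toNat, ?_⟩
  filter_upwards [this] with s hs
  rw [← Int.floor_toNat, hs]

/-- The path `X_n = (X_n(t))_{0 ≤ t ≤ 1}` for given data, as an element of `D[0,1]`. -/
def X {n : ℕ} (b : ℕ) (x : Fin n → ℝ) : Cadlag where
  toFun := normalized b x
  right_cont t := by
    refine tendsto_const_nhds.congr' ?_
    filter_upwards [floor_right n t] with s hs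
    simp only [normalized, hs]
  left_lim t := by
    obtain ⟨k, hk⟩ := floor_left n t
    refine ⟨(((Y b x (min (k + 1) n)).toNat : ℝ) - (b : ℝ) / ((b : ℝ) - 1) * n) / √n,
      tendsto_const_nhds.congr' ?_⟩
    filter_upwards [hk] with s hs
    simp only [normalized, hs]

/-! ### Common prefixes of `b`-ary expansions -/

/-- The digit `t_i`, `i ≥ 1`, of the `b`-ary expansion of `t ∈ [0,1]`. For `t < 1` it is the
expansion with infinitely many digits below `b - 1`; for `t = 1` all digits are `b - 1`. -/
def digit (b : ℕ) (t : I) (i : ℕ) : ℕ :=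
  if t = 1 then b - 1 else ⌊(t : ℝ) * (b : ℝ) ^ i⌋₊ % b

/-- The length `j(s,t)` of the longest common prefix of the `b`-ary expansions of `s` and `t`. -/
def prefixLength (b : ℕ) (s t : I) : ℕ∞ :=
  ⨆ (k : ℕ) (_ : ∀ i, 1 ≤ i → i ≤ k → digit b s i = digit b t i), (k : ℕ∞)

/-- `b ^ (-j)` for `j ∈ {0, 1, …, ∞}`, with `b ^ (-∞) = 0`. -/
def negPow (b : ℕ) (j : ℕ∞) : ℝ := if j = ⊤ then 0 else ((b : ℝ) ^ j.toNat)⁻¹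

end RadixSelection

end

open MeasureTheory ProbabilityTheory Filter Topology
open scoped unitInterval

noncomputable section

namespace RadixSelection

section

/-! ### Cells of the `b`-ary subdivisions -/

/-! The bucket visited at level `l` on the way to a datum `x j` is the `b`-adic cell of level `l`
that contains it. Hence the cost of selecting `x j` is the sum over `l` of the occupation numbers `c
l` of these cells, except that a cell with a single datum costs nothing (`Y_rank`). A cell of level
`K` with `c K` data is expected to cost `c K / (b - 1)` further operations below level `K`. So the
cost is predicted after `K` levels by `∑ l ≤ K, c l + c K / (b - 1)`, and the prediction minus `b /
(b - 1) * n` telescopes into the innovations `b / (b - 1) * (c (m + 1) - c m / b)`, `m < K`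
(`sum_innov_eq`).

Each innovation is a sum over the data of i.i.d. centered bounded terms. Innovations of different
levels are uncorrelated, because given the cell of level `m` a datum is uniform among the `b`
children. Within a level only siblings are correlated. The same covariances `innovCov` arise from
independent standard normal variables attached to the cells, once the average over siblings is
subtracted and the result is scaled by `b / (b - 1) * b ^ (-m / 2)`. For fixed `K` the central limit
theorem therefore gives convergence of the step functions `dataApprox` to `limitApprox`
(`tendstoInDistribution_dataApprox`). Summing `innovCov` along two paths that separate after `j`
levels yields the stated covariance (`tendsto_pathCov`).

It remains to let `K` grow (`tendstoInDistribution_of_approx`). The `b ^ m` quantities of level `m`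
have fourth moments of order `b ^ (-2 * m)`, so their maximum has geometrically small expectation
(`integral_levelBound_le`). This serves both for the Gaussian series, which thus converges uniformly
to a càdlàg path, and for the deviations of the occupation numbers down to level `L = Nat.clog b n`,
where the mean occupation is at most one. Levels from `L` to `3 * L` are estimated by level `L`, and
after `3 * L` levels all data are separated with probability at least `1 - 1 / n`.

The process is indexed by ranks, the approximation by values. The Skorokhod metric absorbs the
difference: a piecewise linear time change carries the cells of level `K` to intervals whose lengths
are their empirical frequencies (`exists_timeChange_rank`), and `dist_X_dataApprox_le` combines this
with the error bounds. -/

/-- The number of the cell of the `k`-th `b`-ary subdivision of `[0,1]` that contains `u`; the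
right endpoint `1` belongs to the last cell. -/
def cell (b k : ℕ) (u : ℝ) : ℕ := min ⌊u * (b : ℝ) ^ k⌋₊ (b ^ k - 1)

lemma cell_lt {b : ℕ} (hb : 2 ≤ b) (k : ℕ) (u : ℝ) : cell b k u < b ^ k := by
  have : 0 < b ^ k := by positivity
  exact (min_le_right _ _).trans_lt (by omega)

@[simp]
lemma cell_zero (b : ℕ) (u : ℝ) : cell b 0 u = 0 := by simp [cell]

lemma pow_succ_sub_one_div {b : ℕ} (hb : 2 ≤ b) (k : ℕ) : (b ^ (k + 1) - 1) / b = b ^ k - 1 := by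
  have h : 0 < b ^ k := by positivity
  obtain ⟨a, ha⟩ : ∃ a, b ^ k = a + 1 := ⟨b ^ k - 1, by omega⟩
  rw [pow_succ, ha]
  have : (a + 1) * b - 1 = (b - 1) + b * a := by
    have : (a + 1) * b = b * a + b := by ring
    omega
  rw [this, Nat.add_mul_div_left _ _ (by omega), Nat.div_eq_of_lt (by omega)]
  simp

/-- Division by `b` deletes the last digit of the cell number; it commutes with the truncation at
the right endpoint because division is monotone. -/
lemma cell_succ_div {b : ℕ} (hb : 2 ≤ b) (k : ℕ) (u : ℝ) : cell b (k + 1) u / b = cell b k u := by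
  have hmono : Monotone fun a : ℕ => a / b := fun _ _ h => Nat.div_le_div_right h
  have hb0 : (b : ℝ) ≠ 0 := by positivity
  unfold cell
  rw [hmono.map_min, pow_succ_sub_one_div hb]
  congr 1
  rw [← Nat.floor_div_natCast, pow_succ, ← mul_assoc, mul_div_cancel_right₀ _ hb0]

lemma cell_div_pow {b : ℕ} (hb : 2 ≤ b) (k l : ℕ) (u : ℝ) :
    cell b (k + l) u / b ^ l = cell b k u := by
  induction l with
  | zero => simp
  | succ l ih => rw [pow_succ', ← Nat.div_div_eq_div_mul, ← add_assoc, cell_succ_div hb, ih]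

lemma cell_eq_of_le {b : ℕ} (hb : 2 ≤ b) {k l : ℕ} (hkl : k ≤ l) {u v : ℝ}
    (h : cell b l u = cell b l v) : cell b k u = cell b k v := by
  obtain ⟨d, rfl⟩ := Nat.exists_eq_add_of_le hkl
  rw [← cell_div_pow hb k d, ← cell_div_pow hb k d, h]

lemma cell_mono (b k : ℕ) : Monotone (cell b k) := fun u v h => by
  unfold cell
  gcongr

/-- The bucket inside the current cell is the last digit of the cell at the next level. -/
lemma bucketOf_cell {b : ℕ} (hb : 2 ≤ b) (k : ℕ) (u : ℝ) :
    b * cell b k u + bucketOf b (cell b k u / (b : ℝ) ^ k) ((b : ℝ) ^ k)⁻¹ u =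
      cell b (k + 1) u := by
  have hb0 : (b : ℝ) ≠ 0 := by positivity
  have hk : 0 < b ^ k := by positivity
  have e : (u - cell b k u / (b : ℝ) ^ k) / (((b : ℝ) ^ k)⁻¹ / b) =
      u * (b : ℝ) ^ (k + 1) - ((cell b k u * b : ℕ) : ℝ) := by
    push_cast
    field_simp
    ring
  have hdiv : ⌊u * (b : ℝ) ^ (k + 1)⌋₊ / b = ⌊u * (b : ℝ) ^ k⌋₊ := by
    rw [← Nat.floor_div_natCast, pow_succ, ← mul_assoc, mul_div_cancel_right₀ _ hb0]
  unfold bucketOf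
  rw [e, Nat.floor_sub_natCast]
  unfold cell
  rw [← hdiv]
  set f := ⌊u * (b : ℝ) ^ (k + 1)⌋₊
  have hmod := Nat.div_add_mod f b
  have hlt := Nat.mod_lt f (show 0 < b by omega)
  have hp : b ^ (k + 1) = b * (b ^ k - 1) + b := by
    rw [pow_succ', ← Nat.mul_succ]; congr 1; omega
  -- In the second case `u` lies at or beyond the right end of the last cell, and both truncations
  -- select the last child.
  rcases le_or_gt (f / b) (b ^ k - 1) with h | h
  · rw [min_eq_left h, mul_comm (f / b)]
    have : b * (f / b) ≤ b * (b ^ k - 1) := Nat.mul_le_mul_left _ h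
    omega
  · rw [min_eq_right h.le, mul_comm (b ^ k - 1)]
    have : b * (b ^ k - 1 + 1) ≤ b * (f / b) := Nat.mul_le_mul_left _ h
    rw [Nat.mul_add, mul_one] at this
    omega

/-! ### The costs in terms of the occupation numbers of the cells -/

/-- The number of data in cell `i` of level `k`. -/
def count {n : ℕ} (b : ℕ) (x : Fin n → ℝ) (k i : ℕ) : ℕ :=
  (Finset.univ.filter fun j => cell b k (x j) = i).card

/-- The number of data in the cells of level `k` to the left of cell `i`. -/
def below {n : ℕ} (b : ℕ) (x : Fin n → ℝ) (k i : ℕ) : ℕ :=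
  (Finset.univ.filter fun j => cell b k (x j) < i).card

/-- The rank of a datum. -/
def rank {n : ℕ} (x : Fin n → ℝ) (j : Fin n) : ℕ :=
  (Finset.univ.filter fun i => x i < x j).card + 1

/-- The cost of splitting a bucket that contains `N` data. -/
def splitCost (N : ℕ) : ℕ := if N ≤ 1 then 0 else N

variable {n : ℕ} {b : ℕ}

lemma below_mono (x : Fin n → ℝ) (k : ℕ) : Monotone (below b x k) := fun i i' h =>
  Finset.card_le_card fun j hj => by
    simp only [Finset.mem_filter, Finset.mem_univ, true_and] at hj ⊢
    omega

lemma below_succ (x : Fin n → ℝ) (k i : ℕ) : below b x k (i + 1) = below b x k i + count b x k i := by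
  unfold below count
  rw [← Finset.card_union_of_disjoint]
  · congr 1
    ext j
    simp only [Finset.mem_filter, Finset.mem_univ, true_and, Finset.mem_union]
    omega
  · refine Finset.disjoint_filter.2 fun j _ h => ?_
    omega

lemma below_eq_sum (x : Fin n → ℝ) (k i : ℕ) :
    below b x k i = ∑ l ∈ Finset.range i, count b x k l := by
  induction i with
  | zero => simp [below]
  | succ i ih => rw [below_succ, Finset.sum_range_succ, ih]

lemma below_pow (hb : 2 ≤ b) (x : Fin n → ℝ) (k : ℕ) : below b x k (b ^ k) = n := by
  simp [below, cell_lt hb]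

lemma below_cell_lt_rank (x : Fin n → ℝ) (k : ℕ) (j : Fin n) :
    below b x k (cell b k (x j)) < rank x j := by
  refine Nat.lt_succ_of_le (Finset.card_le_card fun i hi => ?_)
  simp only [Finset.mem_filter, Finset.mem_univ, true_and] at hi ⊢
  exact (cell_mono b k).reflect_lt hi

lemma rank_le_below_cell (x : Fin n → ℝ) (k : ℕ) (j : Fin n) :
    rank x j ≤ below b x k (cell b k (x j) + 1) := by
  unfold rank below
  rw [← Finset.card_insert_of_notMem (a := j) (by simp)]
  refine Finset.card_le_card fun i hi => ?_
  simp only [Finset.mem_filter, Finset.mem_univ, true_and, Finset.mem_insert] at hi ⊢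
  rcases hi with rfl | hi
  · omega
  · exact Nat.lt_succ_of_le (cell_mono b k hi.le)

/-- Cells are ordered intervals, so the ranks of the data in cell `i` lie in the half-open range
from `below i` to `below (i + 1)`. These ranges are disjoint for different `i`, hence the rank
determines the cell. -/
lemma cell_eq_of_rank {x : Fin n → ℝ} {k i : ℕ} {j : Fin n} (h : below b x k i < rank x j)
    (h' : rank x j ≤ below b x k (i + 1)) : cell b k (x j) = i := by
  by_contra hne
  rcases lt_or_gt_of_ne hne with hlt | hlt
  · have := below_mono (b := b) x k (show cell b k (x j) + 1 ≤ i from hlt)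
    have := rank_le_below_cell (b := b) x k j
    omega
  · have := below_mono (b := b) x k (show i + 1 ≤ cell b k (x j) from hlt)
    have := below_cell_lt_rank (b := b) x k j
    omega

/-- For distinct data the rank is an injective map from `n` data to `n` values, hence surjective. -/
lemma exists_rank_eq {x : Fin n → ℝ} (hx : Function.Injective x) {r : ℕ} (h1 : 1 ≤ r)
    (hn : r ≤ n) : ∃ j, rank x j = r := by
  have hlt (j : Fin n) : (Finset.univ.filter fun i => x i < x j).card < n := by
    have : (Finset.univ.filter fun i => x i < x j) ⊂ Finset.univ :=
      Finset.filter_ssubset.2 ⟨j, Finset.mem_univ _, lt_irrefl _⟩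
    simpa using Finset.card_lt_card this
  let f : Fin n → Fin n := fun j => ⟨_, hlt j⟩
  have hmono {j j' : Fin n} (h : x j < x j') : f j < f j' := by
    change (Finset.univ.filter fun i => x i < x j).card < (Finset.univ.filter fun i => x i < x j').card
    refine Finset.card_lt_card ⟨fun i hi => ?_, fun hs => ?_⟩
    · simp only [Finset.mem_filter, Finset.mem_univ, true_and] at hi ⊢
      exact hi.trans h
    · have := @hs j (by simpa using h)
      simp at this
  have hinj : Function.Injective f := by
    intro j j' h
    by_contra hne
    rcases lt_or_gt_of_ne (fun e => hne (hx e)) with h' | h'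
    · exact (hmono h').ne h
    · exact (hmono h').ne' h
  obtain ⟨j, hj⟩ := Finite.surjective_of_injective hinj ⟨r - 1, by omega⟩
  refine ⟨j, ?_⟩
  have : (Finset.univ.filter fun i => x i < x j).card = r - 1 := congrArg Fin.val hj
  unfold rank
  omega

lemma count_cell_anti (hb : 2 ≤ b) (x : Fin n → ℝ) {k l : ℕ} (h : k ≤ l) (u : ℝ) :
    count b x l (cell b l u) ≤ count b x k (cell b k u) :=
  Finset.card_le_card fun i hi => by
    simp only [Finset.mem_filter, Finset.mem_univ, true_and] at hi ⊢
    exact cell_eq_of_le hb h hi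

/-- The cost of the first `m` rounds, started in the cell of level `k` that contains the datum
`x j` which is to be selected. -/
lemma bucketOps_cell (hb : 2 ≤ b) (x : Fin n → ℝ) (j : Fin n) (m k : ℕ) :
    bucketOps b x m (cell b k (x j) / (b : ℝ) ^ k) ((b : ℝ) ^ k)⁻¹
        (Finset.univ.filter fun i => cell b k (x i) = cell b k (x j))
        (rank x j - below b x k (cell b k (x j))) =
      ∑ l ∈ Finset.range m, splitCost (count b x (k + l) (cell b (k + l) (x j))) := by
  induction m generalizing k with
  | zero => simp [bucketOps]
  | succ m ih =>
    have hb0 : (b : ℝ) ≠ 0 := by positivity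
    set c := cell b k (x j) with hc
    set S := Finset.univ.filter fun i => cell b k (x i) = c with hS
    have hcard : S.card = count b x k c := rfl
    unfold bucketOps
    split_ifs with hle
    -- The algorithm has stopped, and all later cells on the path are contained in this one, so none
    -- of them has a positive split cost.
    · symm
      refine Finset.sum_eq_zero fun l _ => ?_
      have := count_cell_anti hb x (Nat.le_add_right k l) (x j)
      rw [← hc] at this
      rw [splitCost, if_pos (by omega)]
    · have hbucket (i : Fin n) (hi : i ∈ S) :
          b * c + bucketOf b (c / (b : ℝ) ^ k) ((b : ℝ) ^ k)⁻¹ (x i) = cell b (k + 1) (x i) := by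
        have : cell b k (x i) = c := by simpa [hS] using hi
        rw [← this]
        exact bucketOf_cell hb k (x i)
      set F : ℕ → ℕ := fun r =>
        (S.filter fun i => bucketOf b (c / (b : ℝ) ^ k) ((b : ℝ) ^ k)⁻¹ (x i) < r).card with hF
      have hdivc (i : Fin n) : cell b (k + 1) (x i) / b = cell b k (x i) := cell_succ_div hb k (x i)
      -- Data to the left of child `r` are either left of the parent cell or in one of its first `r`
      -- children. This converts the algorithm's relative ranks into absolute ones.
      have hFb (r : ℕ) (hr : r ≤ b) :
          below b x (k + 1) (b * c + r) = below b x k c + F r := by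
        unfold below
        rw [hF, ← Finset.card_union_of_disjoint]
        · congr 1
          ext i
          simp only [Finset.mem_filter, Finset.mem_univ, true_and, Finset.mem_union]
          have h1 := Nat.div_add_mod (cell b (k + 1) (x i)) b
          have h2 := Nat.mod_lt (cell b (k + 1) (x i)) (show 0 < b by omega)
          rw [hdivc] at h1
          rcases lt_trichotomy (cell b k (x i)) c with h | h | h
          · have : b * (cell b k (x i) + 1) ≤ b * c := Nat.mul_le_mul_left _ h
            rw [Nat.mul_add, mul_one] at this
            constructor
            · intro _; exact Or.inl h
            · intro _; omega
          · have hi : i ∈ S := by simpa [hS] using h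
            have := hbucket i hi
            constructor
            · intro _; exact Or.inr ⟨hi, by omega⟩
            · rintro (h' | h') <;> omega
          · have : b * (c + 1) ≤ b * cell b k (x i) := Nat.mul_le_mul_left _ h
            rw [Nat.mul_add, mul_one] at this
            constructor
            · intro _; omega
            · rintro (h' | h')
              · omega
              · have : cell b k (x i) = c := by simpa [hS] using h'.1
                omega
        · refine Finset.disjoint_left.2 fun i hi hi' => ?_
          simp only [hS, Finset.mem_filter, Finset.mem_univ, true_and] at hi hi'
          omega
      -- The last digit `r₀` of the next cell is the only summand of the loop over the buckets whose
      -- rank condition holds.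
      set c' := cell b (k + 1) (x j) with hc'
      obtain ⟨r₀, hr₀, hcr⟩ : ∃ r₀ < b, b * c + r₀ = c' := by
        refine ⟨c' % b, Nat.mod_lt _ (by omega), ?_⟩
        have := Nat.div_add_mod c' b
        rwa [hc', hdivc, ← hc'] at this
      have hk1 := below_cell_lt_rank (b := b) x k j
      have h1 := below_cell_lt_rank (b := b) x (k + 1) j
      have h2 := rank_le_below_cell (b := b) x (k + 1) j
      rw [← hc', ← hcr] at h1 h2
      rw [← hc] at hk1
      rw [Finset.sum_range_succ']
      dsimp only
      rw [Finset.sum_eq_single (s := Finset.range b) r₀]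
      · have e0 := hFb r₀ hr₀.le
        have e1 := hFb (r₀ + 1) hr₀
        rw [← add_assoc] at e1
        have hlo : (c : ℝ) / (b : ℝ) ^ k + r₀ * (((b : ℝ) ^ k)⁻¹ / b) = c' / (b : ℝ) ^ (k + 1) := by
          rw [← hcr]
          push_cast
          field_simp
          ring
        have hw : ((b : ℝ) ^ k)⁻¹ / b = ((b : ℝ) ^ (k + 1))⁻¹ := by
          rw [pow_succ, mul_inv, div_eq_mul_inv]
        have hset : (S.filter fun i =>
            bucketOf b (c / (b : ℝ) ^ k) ((b : ℝ) ^ k)⁻¹ (x i) = r₀) =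
            Finset.univ.filter fun i => cell b (k + 1) (x i) = c' := by
          ext i
          constructor
          · intro hi
            obtain ⟨hi, hr⟩ := Finset.mem_filter.1 hi
            have := hbucket i hi
            simp only [Finset.mem_filter, Finset.mem_univ, true_and]
            omega
          · intro hi
            simp only [Finset.mem_filter, Finset.mem_univ, true_and] at hi
            have hi' : i ∈ S := by
              simp only [hS, Finset.mem_filter, Finset.mem_univ, true_and]
              rw [← hdivc, hi, hc', hdivc]
            have := hbucket i hi'
            exact Finset.mem_filter.2 ⟨hi', by omega⟩
        have hrank : rank x j - below b x k c - F r₀ = rank x j - below b x (k + 1) c' := by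
          rw [← hcr, e0]; omega
        rw [if_pos ⟨by omega, by omega⟩, hlo, hset, hrank, hw, ih (k + 1), add_comm]
        congr 1
        · refine Finset.sum_congr rfl fun l _ => ?_
          rw [show k + 1 + l = k + (l + 1) by ring]
        · rw [splitCost, add_zero, ← hc, if_neg (by omega), hcard]
      · intro r hr hne
        rw [if_neg]
        rintro ⟨hA, hB⟩
        have hrb := Finset.mem_range.1 hr
        have e0 := hFb r hrb.le
        have e1 := hFb (r + 1) hrb
        rcases lt_or_gt_of_ne hne with hlt | hlt
        · have := below_mono (b := b) x (k + 1) (show b * c + (r + 1) ≤ b * c + r₀ by omega)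
          omega
        · have := below_mono (b := b) x (k + 1) (show b * c + r₀ + 1 ≤ b * c + r by omega)
          omega
      · intro h
        exact absurd (Finset.mem_range.2 hr₀) h

/-- Once a level separates the data, all further split costs are zero, so the supremum over the
number of rounds is attained at `m`. -/
lemma Y_rank (hb : 2 ≤ b) (x : Fin n → ℝ) (j : Fin n) {m : ℕ}
    (hm : ∀ i, count b x m i ≤ 1) :
    (Y b x (rank x j)).toNat =
      ∑ l ∈ Finset.range m, splitCost (count b x l (cell b l (x j))) := by
  have hops (m : ℕ) : bucketOps b x m 0 1 Finset.univ (rank x j) =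
      ∑ l ∈ Finset.range m, splitCost (count b x l (cell b l (x j))) := by
    have := bucketOps_cell hb x j m 0
    simpa [below] using this
  have hY : Y b x (rank x j) =
      ((∑ l ∈ Finset.range m, splitCost (count b x l (cell b l (x j))) : ℕ) : ℕ∞) := by
    unfold Y
    simp_rw [hops]
    refine le_antisymm (iSup_le fun m' => ?_) (le_iSup (fun m' : ℕ =>
      ((∑ l ∈ Finset.range m', splitCost (count b x l (cell b l (x j))) : ℕ) : ℕ∞)) m)
    rw [Nat.cast_le]
    rcases le_total m' m with h | h
    · exact Finset.sum_le_sum_of_subset (Finset.range_mono h)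
    · refine (Finset.sum_subset (Finset.range_mono h) fun l _ hl => ?_).ge
      have := count_cell_anti hb x (not_lt.1 fun h => hl (Finset.mem_range.2 h)) (x j)
      rw [splitCost, if_pos (this.trans (hm _))]
  rw [hY, ENat.toNat_natCast]

lemma injective_of_count_le_one {x : Fin n → ℝ} {m : ℕ} (hm : ∀ i, count b x m i ≤ 1) :
    Function.Injective x := by
  intro i j hij
  refine Finset.card_le_one.1 (hm (cell b m (x j))) i ?_ j ?_ <;> simp [hij]

end

section

/-! ### Measurability of the normalized process -/

lemma measurable_of_countable_cases {α β γ : Type*} [MeasurableSpace α] [MeasurableSpace γ]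
    [Countable β] {h : α → β} (hh : ∀ c, MeasurableSet (h ⁻¹' {c})) {g : β → α → γ}
    (hg : ∀ c, Measurable (g c)) : Measurable fun a => g (h a) a := by
  intro s hs
  have : (fun a => g (h a) a) ⁻¹' s = ⋃ c, h ⁻¹' {c} ∩ g c ⁻¹' s := by
    ext a
    simp
  rw [this]
  exact MeasurableSet.iUnion fun c => (hh c).inter (hg c hs)

lemma measurable_bucketOf (b : ℕ) (lo w : ℝ) : Measurable (bucketOf b lo w) := by
  unfold bucketOf
  exact (Nat.measurable_floor.comp (by fun_prop)).min measurable_const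

/-- All branching depends on the data only through the vector of bucket numbers, which takes
countably many values; with this vector fixed, the recursion is a finite sum of measurable
functions. -/
lemma measurable_bucketOps (b : ℕ) {n : ℕ} (m : ℕ) (lo w : ℝ) (S : Finset (Fin n)) (ℓ : ℕ) :
    Measurable fun x : Fin n → ℝ => bucketOps b x m lo w S ℓ := by
  induction m generalizing lo w S ℓ with
  | zero => simp [bucketOps]
  | succ m ih =>
    unfold bucketOps
    split_ifs with hS
    · exact measurable_const
    · refine measurable_of_countable_cases (h := fun x i => bucketOf b lo w (x i))
        (g := fun (c : Fin n → ℕ) x =>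
          S.card + ∑ r ∈ Finset.range b,
            if (S.filter fun i => c i < r).card < ℓ ∧ ℓ ≤ (S.filter fun i => c i < r + 1).card then
              bucketOps b x m (lo + r * (w / b)) (w / b)
                (S.filter fun i => c i = r) (ℓ - (S.filter fun i => c i < r).card)
            else 0) (fun c => ?_) (fun c => ?_)
      · refine (measurable_pi_lambda _ fun i => ?_) (measurableSet_singleton c)
        exact (measurable_bucketOf b lo w).comp (measurable_pi_apply i)
      · refine measurable_const.add (Finset.measurable_fun_sum _ fun r _ => ?_)
        split_ifs
        · exact ih _ _ _ _
        · exact measurable_const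

lemma measurable_Y_toNat (b : ℕ) {n : ℕ} (ℓ : ℕ) :
    Measurable fun x : Fin n → ℝ => (Y b x ℓ).toNat := by
  have hle (c : ℕ∞) : MeasurableSet {x : Fin n → ℝ | Y b x ℓ ≤ c} := by
    have : {x : Fin n → ℝ | Y b x ℓ ≤ c} =
        ⋂ m, (fun x => bucketOps b x m 0 1 Finset.univ ℓ) ⁻¹' {a : ℕ | (a : ℕ∞) ≤ c} := by
      ext x
      simp [Y]
    rw [this]
    exact MeasurableSet.iInter fun m => measurable_bucketOps b m 0 1 _ ℓ .of_discrete
  refine measurable_of_countable_cases (h := fun x : Fin n → ℝ => Y b x ℓ)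
    (g := fun c _ => c.toNat) (fun c => ?_) fun _ => measurable_const
  have : (fun x : Fin n → ℝ => Y b x ℓ) ⁻¹' {c} =
      {x | Y b x ℓ ≤ c} \ ⋃ c' : Set.Iio c, {x | Y b x ℓ ≤ c'} := by
    ext x
    simp only [Set.mem_preimage, Set.mem_singleton_iff, Set.mem_sdiff, Set.mem_ofPred_eq,
      Set.mem_iUnion, not_exists, not_le, Subtype.forall, Set.mem_Iio]
    constructor
    · rintro rfl
      exact ⟨le_rfl, fun _ h => h⟩
    · rintro ⟨h1, h2⟩
      by_contra hne
      exact lt_irrefl _ (h2 _ (lt_of_le_of_ne h1 hne))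
  rw [this]
  exact (hle c).diff (MeasurableSet.iUnion fun c' => hle c')

/-- The path is a function of the finite vector of the natural numbers `Y`. This vector lives in a
countable discrete space, so the preimage of any set of paths is measurable and nothing about the
Borel sets of `D[0,1]` is needed. -/
lemma measurable_X (b : ℕ) {n : ℕ} : Measurable (X b : (Fin n → ℝ) → Cadlag) := by
  let h : (Fin n → ℝ) → Fin (n + 1) → ℕ := fun x ℓ => (Y b x ℓ).toNat
  have hX {x x' : Fin n → ℝ} (hxx : h x = h x') : X b x = X b x' := by
    ext t
    have := congrFun hxx ⟨min (⌊(t : ℝ) * n⌋₊ + 1) n, by omega⟩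
    change normalized b x t = normalized b x' t
    simp only [h] at this
    simp only [normalized, this]
  intro s hs
  have : (X b : (Fin n → ℝ) → Cadlag) ⁻¹' s = h ⁻¹' (h '' (X b ⁻¹' s)) := by
    refine (Set.subset_preimage_image _ _).antisymm ?_
    rintro x ⟨x', hx', hxx⟩
    change X b x ∈ s
    rw [← hX hxx]
    exact hx'
  rw [this]
  exact measurable_pi_lambda h (fun ℓ => measurable_Y_toNat b ℓ) .of_discrete

end

section

/-! ### Convergence in distribution by approximation -/

section Approximation

variable {E : Type*} [PseudoMetricSpace E] [MeasurableSpace E] [OpensMeasurableSpace E]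

/-- Boundedness is expressed by the oscillation, the form in which
`tendsto_iff_forall_lipschitz_integral_tendsto` supplies its test functions. -/
lemma integrable_comp_of_osc_le {Ω : Type*} [MeasurableSpace Ω] {P : Measure Ω}
    [IsProbabilityMeasure P] {A : Ω → E} (hA : AEMeasurable A P) {f : E → ℝ} {C : ℝ}
    (hC : ∀ x y, dist (f x) (f y) ≤ C) (hf : Continuous f) :
    Integrable (fun ω => f (A ω)) P := by
  obtain ⟨ω₀⟩ : Nonempty Ω := nonempty_of_isProbabilityMeasure P
  refine Integrable.of_bound (hf.measurable.comp_aemeasurable hA).aestronglyMeasurable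
    (‖f (A ω₀)‖ + C) (.of_forall fun ω => ?_)
  have := hC (A ω) (A ω₀)
  rw [dist_eq_norm] at this
  have := norm_sub_norm_le (f (A ω)) (f (A ω₀))
  linarith

/-- If two random variables are close with high probability, then so are the expectations of a
bounded Lipschitz function. -/
lemma abs_integral_sub_le_of_dist_le {Ω : Type*} [MeasurableSpace Ω] {P : Measure Ω}
    [IsProbabilityMeasure P] {A B : Ω → E} (hA : AEMeasurable A P) (hB : AEMeasurable B P)
    {f : E → ℝ} {C : ℝ} (hC : ∀ x y, dist (f x) (f y) ≤ C) {L : NNReal} (hL : LipschitzWith L f)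
    {ε : ℝ} (hε : 0 ≤ ε) {s : Set Ω} (hs : P s ≤ ENNReal.ofReal ε)
    (hd : ∀ ω ∉ s, dist (A ω) (B ω) ≤ ε) :
    |∫ ω, f (A ω) ∂P - ∫ ω, f (B ω) ∂P| ≤ (L + C) * ε := by
  have iA := integrable_comp_of_osc_le hA hC hL.continuous
  have iB := integrable_comp_of_osc_le hB hC hL.continuous
  obtain ⟨ω₀⟩ : Nonempty Ω := nonempty_of_isProbabilityMeasure P
  have hC0 : 0 ≤ C := dist_nonneg.trans (hC (A ω₀) (A ω₀))
  set s' := toMeasurable P s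
  have hs' : MeasurableSet s' := measurableSet_toMeasurable P s
  have hPs : P.real s' ≤ ε := by
    refine ENNReal.toReal_le_of_le_ofReal hε ?_
    rwa [measure_toMeasurable]
  have iI : Integrable (fun ω => L * ε + s'.indicator (fun _ => C) ω) P :=
    (integrable_const _).add ((integrable_const C).indicator hs')
  rw [← integral_sub iA iB]
  calc |∫ ω, (f (A ω) - f (B ω)) ∂P| ≤ ∫ ω, |f (A ω) - f (B ω)| ∂P := abs_integral_le_integral_abs
    _ ≤ ∫ ω, (L * ε + s'.indicator (fun _ => C) ω) ∂P := by
      refine integral_mono (iA.sub iB).abs iI fun ω => ?_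
      by_cases hω : ω ∈ s'
      · have := hC (A ω) (B ω)
        rw [Real.dist_eq] at this
        simp only [Set.indicator_of_mem hω]
        have : 0 ≤ L * ε := by positivity
        linarith
      · have h1 := hL.dist_le_mul (A ω) (B ω)
        have h2 := hd ω fun h => hω (subset_toMeasurable P s h)
        rw [Real.dist_eq] at h1
        simp only [Set.indicator_of_notMem hω, add_zero]
        exact h1.trans (mul_le_mul_of_nonneg_left h2 L.2)
    _ = L * ε + P.real s' * C := by
      rw [integral_add (integrable_const _) ((integrable_const C).indicator hs'),
        integral_indicator_const _ hs']
      simp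
    _ ≤ (L + C) * ε := by nlinarith

/-- Convergence in distribution follows from convergence of approximations that are uniformly
close in probability. -/
theorem tendstoInDistribution_of_approx {Ω : ℕ → Type*} {mΩ : ∀ n, MeasurableSpace (Ω n)}
    {P : ∀ n, Measure (Ω n)} [∀ n, IsProbabilityMeasure (P n)] {Ω' : Type*}
    {mΩ' : MeasurableSpace Ω'} {P' : Measure Ω'} [IsProbabilityMeasure P']
    {A : ∀ n, Ω n → E} {T : ℕ → ∀ n, Ω n → E} {G : Ω' → E} {H : ℕ → Ω' → E}
    (hA : ∀ n, AEMeasurable (A n) (P n)) (hG : AEMeasurable G P')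
    (hT : ∀ K, TendstoInDistribution (T K) atTop (H K) P P')
    (happ : ∀ ε > 0, ∃ K,
      (∀ᶠ n in atTop, ∃ s, P n s ≤ ENNReal.ofReal ε ∧ ∀ ω ∉ s, dist (A n ω) (T K n ω) ≤ ε) ∧
      ∃ s, P' s ≤ ENNReal.ofReal ε ∧ ∀ ω ∉ s, dist (H K ω) (G ω) ≤ ε) :
    TendstoInDistribution A atTop G P P' where
  forall_aemeasurable := hA
  aemeasurable_limit := hG
  tendsto := by
    refine tendsto_iff_forall_lipschitz_integral_tendsto.2 fun f ⟨C, hC⟩ ⟨L, hL⟩ => ?_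
    have hfm {μ : Measure E} : AEStronglyMeasurable f μ :=
      hL.continuous.measurable.aestronglyMeasurable
    simp only [ProbabilityMeasure.coe_mk]
    rw [integral_map hG hfm]
    simp_rw [fun n => integral_map (hA n) (hfm (μ := (P n).map (A n)))]
    obtain ⟨ω₀⟩ : Nonempty Ω' := nonempty_of_isProbabilityMeasure P'
    have hC0 : 0 ≤ C := dist_nonneg.trans (hC (G ω₀) (G ω₀))
    refine Metric.tendsto_nhds.2 fun δ hδ => ?_
    have hLC : 0 < (L : ℝ) + C + 1 := by positivity
    -- Each of the two approximations then costs at most `δ / 4`; the summand `1` keeps the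
    -- denominator positive.
    set ε := δ / (4 * (L + C + 1)) with hε
    have hε0 : 0 < ε := by positivity
    have hεδ : (L + C) * ε ≤ δ / 4 := by
      have : (L + C + 1) * ε = δ / 4 := by rw [hε]; field_simp
      nlinarith
    obtain ⟨K, hn, s', hs', hd'⟩ := happ ε hε0
    have hTK := tendsto_iff_forall_lipschitz_integral_tendsto.1 (hT K).tendsto f ⟨C, hC⟩ ⟨L, hL⟩
    have hTm := (hT K).forall_aemeasurable
    simp only [ProbabilityMeasure.coe_mk] at hTK
    rw [integral_map (hT K).aemeasurable_limit hfm] at hTK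
    simp_rw [fun n => integral_map (hTm n) (hfm (μ := (P n).map (T K n)))] at hTK
    filter_upwards [hn, Metric.tendsto_nhds.1 hTK (δ / 4) (by positivity)] with n ⟨s, hs, hd⟩ h2
    have h1 := abs_integral_sub_le_of_dist_le (hA n) (hTm n) hC hL hε0.le hs hd
    have h3 := abs_integral_sub_le_of_dist_le (hT K).aemeasurable_limit hG hC hL hε0.le hs' hd'
    rw [Real.dist_eq] at h2 ⊢
    rw [abs_lt] at h2 ⊢
    rw [abs_le] at h1 h3
    constructor <;> linarith

end Approximation

/-! ### Step functions -/

lemma SkorokhodClose.dist_le {x y : Cadlag} {ε : ℝ} (h : SkorokhodClose x y ε) : dist x y ≤ ε :=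
  csInf_le (bddBelow_skorokhodClose x y) h

lemma dist_le_of_forall_abs_sub_le {x y : Cadlag} {ε : ℝ} (h : ∀ t, |x t - y t| ≤ ε) :
    dist x y ≤ ε :=
  SkorokhodClose.dist_le ⟨OrderIso.refl I, fun t =>
    ⟨by simpa using (abs_nonneg _).trans (h 0), h t⟩⟩

lemma cell_right (b k : ℕ) (t : I) :
    ∀ᶠ s : I in 𝓝[≥] t, cell b k s = cell b k t := by
  filter_upwards [floor_right (b ^ k) t] with s hs
  push_cast at hs
  simp only [cell, hs]

lemma cell_left (b k : ℕ) (t : I) : ∃ i : ℕ, ∀ᶠ s : I in 𝓝[<] t, cell b k s = i := by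
  obtain ⟨i, hi⟩ := floor_left (b ^ k) t
  refine ⟨min i (b ^ k - 1), ?_⟩
  filter_upwards [hi] with s hs
  push_cast at hs
  simp only [cell, hs]

/-- The càdlàg function that has the value `z i` on cell `i` of level `k`. -/
def stepFun {b : ℕ} (hb : 2 ≤ b) (k : ℕ) (z : Fin (b ^ k) → ℝ) : Cadlag where
  toFun t := z ⟨cell b k t, cell_lt hb k t⟩
  right_cont t := by
    refine tendsto_const_nhds.congr' ?_
    filter_upwards [cell_right b k t] with s hs
    simp only [hs]
  left_lim t := by
    obtain ⟨i, hi⟩ := cell_left b k t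
    refine ⟨if h : i < b ^ k then z ⟨i, h⟩ else 0, tendsto_const_nhds.congr' ?_⟩
    filter_upwards [hi] with s hs
    have : i < b ^ k := hs ▸ cell_lt hb k s
    simp only [hs, this, dif_pos]

/-- With the identity as time change, the Skorokhod distance of two step functions is at most the
sup distance of their values. Continuity makes the mapping theorem applicable to finite-dimensional
convergence. -/
lemma continuous_stepFun {b : ℕ} (hb : 2 ≤ b) (k : ℕ) : Continuous (stepFun hb k) := by
  refine LipschitzWith.continuous (K := 1) (LipschitzWith.of_dist_le_mul fun z z' => ?_)
  rw [NNReal.coe_one, one_mul]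
  refine dist_le_of_forall_abs_sub_le fun t => ?_
  exact dist_le_pi_dist z z' _

end

section

/-! ### Covariances along paths in the tree of cells -/

/-- The covariance of the innovations in the cells `i` and `j` of level `m`. -/
def innovCov (b m i j : ℕ) : ℝ :=
  ((b : ℝ) / ((b : ℝ) - 1)) ^ 2 * ((b : ℝ) ^ m)⁻¹ *
    if i / b = j / b then (if i = j then 1 else 0) - (b : ℝ)⁻¹ else 0

/-- The covariance of the sums of the innovations along the first `K` levels of two paths. -/
def pathCov (b K : ℕ) (i j : ℕ → ℕ) : ℝ :=
  ∑ m ∈ Finset.range K, innovCov b (m + 1) (i (m + 1)) (j (m + 1))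

/-- Stated for an arbitrary family `ξ` so that it applies both to the Gaussian innovations and to
the contributions of a single datum: second moments of linear combinations depend only on the common
covariance `innovCov`. Covariances are required only for numbers of actual cells, as the data
satisfy them only there. -/
lemma integral_sq_sum_path {Ω ι : Type*} [MeasurableSpace Ω] {P : Measure Ω} {b : ℕ}
    {ξ : ℕ → ℕ → Ω → ℝ} (hL : ∀ m i, MemLp (ξ m i) 2 P)
    (hcov : ∀ m l i j, i < b ^ (m + 1) → j < b ^ (l + 1) →
      ∫ ω, ξ (m + 1) i ω * ξ (l + 1) j ω ∂P = if m = l then innovCov b (m + 1) i j else 0)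
    (K : ℕ) (s : Finset ι) (c : ι → ℝ) {i : ι → ℕ → ℕ}
    (hi : ∀ v, ∀ m < K, i v (m + 1) < b ^ (m + 1)) :
    ∫ ω, (∑ v ∈ s, c v * ∑ m ∈ Finset.range K, ξ (m + 1) (i v (m + 1)) ω) ^ 2 ∂P =
      ∑ v ∈ s, ∑ w ∈ s, c v * c w * pathCov b K (i v) (i w) := by
  have e (ω : Ω) : (∑ v ∈ s, c v * ∑ m ∈ Finset.range K, ξ (m + 1) (i v (m + 1)) ω) ^ 2 =
      ∑ v ∈ s, ∑ w ∈ s, ∑ m ∈ Finset.range K, ∑ l ∈ Finset.range K,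
        c v * c w * (ξ (m + 1) (i v (m + 1)) ω * ξ (l + 1) (i w (l + 1)) ω) := by
    rw [sq, Finset.sum_mul_sum]
    refine Finset.sum_congr rfl fun v _ => Finset.sum_congr rfl fun w _ => ?_
    rw [mul_mul_mul_comm, Finset.sum_mul_sum, Finset.mul_sum]
    exact Finset.sum_congr rfl fun m _ => Finset.mul_sum _ _ _
  have hint (v w : ι) (m l : ℕ) :
      Integrable (fun ω => c v * c w * (ξ (m + 1) (i v (m + 1)) ω * ξ (l + 1) (i w (l + 1)) ω)) P :=
    ((hL _ _).integrable_mul (hL _ _)).const_mul _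
  simp_rw [e]
  rw [integral_finsetSum _ fun v _ => integrable_finsetSum _ fun w _ =>
    integrable_finsetSum _ fun m _ => integrable_finsetSum _ fun l _ => hint v w m l]
  refine Finset.sum_congr rfl fun v _ => ?_
  rw [integral_finsetSum _ fun w _ =>
    integrable_finsetSum _ fun m _ => integrable_finsetSum _ fun l _ => hint v w m l]
  refine Finset.sum_congr rfl fun w _ => ?_
  rw [integral_finsetSum _ fun m _ => integrable_finsetSum _ fun l _ => hint v w m l,
    pathCov, Finset.mul_sum]
  refine Finset.sum_congr rfl fun m hm => ?_
  have hm' := Finset.mem_range.1 hm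
  rw [integral_finsetSum _ fun l _ => hint v w m l, Finset.sum_eq_single m]
  · rw [integral_const_mul, hcov _ _ _ _ (hi v m hm') (hi w m hm'), if_pos rfl]
  · intro l hl hne
    rw [integral_const_mul, hcov _ _ _ _ (hi v m hm') (hi w l (Finset.mem_range.1 hl)),
      if_neg hne.symm, mul_zero]
  · exact fun h => absurd hm h

/-! ### Gaussian innovations -/

/-- The law of a family of independent standard Gaussian random variables, indexed by level and
number of the cell. -/
def noise : Measure (ℕ × ℕ → ℝ) := Measure.infinitePi fun _ => gaussianReal 0 1

instance : IsProbabilityMeasure noise := by unfold noise; infer_instance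

lemma noise_map_eval (p : ℕ × ℕ) : noise.map (fun ω => ω p) = gaussianReal 0 1 :=
  Measure.infinitePi_map_eval _ p

lemma iIndepFun_noise : iIndepFun (fun (p : ℕ × ℕ) (ω : ℕ × ℕ → ℝ) => ω p) noise :=
  iIndepFun_infinitePi (X := fun _ x => x) fun _ => measurable_id

lemma hasGaussianLaw_eval (p : ℕ × ℕ) : HasGaussianLaw (fun ω : ℕ × ℕ → ℝ => ω p) noise :=
  ⟨by rw [noise_map_eval]; infer_instance⟩

lemma memLp_eval (p : ℕ × ℕ) : MemLp (fun ω : ℕ × ℕ → ℝ => ω p) 2 noise :=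
  (hasGaussianLaw_eval p).memLp (by simp)

lemma integral_eval (p : ℕ × ℕ) : ∫ ω, ω p ∂noise = 0 := by
  have := integral_map (μ := noise) (φ := fun ω => ω p) (measurable_pi_apply p).aemeasurable (f := fun x : ℝ => x)
    (by fun_prop)
  rw [← this, noise_map_eval, integral_id_gaussianReal]

lemma integral_eval_mul_eval (p q : ℕ × ℕ) :
    ∫ ω, ω p * ω q ∂noise = if p = q then 1 else 0 := by
  split_ifs with h
  · subst h
    have := integral_map (μ := noise) (φ := fun ω => ω p) (measurable_pi_apply p).aemeasurable (f := fun x : ℝ => x * x)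
      (by fun_prop)
    rw [← this, noise_map_eval]
    have h2 := variance_fun_id_gaussianReal (μ := 0) (v := 1)
    rw [variance_eq_integral measurable_id'.aemeasurable] at h2
    simpa [integral_id_gaussianReal, sq] using h2
  · rw [(iIndepFun_noise.indepFun h).integral_fun_mul_eq_mul_integral
      (memLp_eval p).aestronglyMeasurable (memLp_eval q).aestronglyMeasurable, integral_eval,
      zero_mul]

/-- The linear combinations of the coordinates. -/
def linComb : Submodule ℝ ((ℕ × ℕ → ℝ) → ℝ) := Submodule.span ℝ (Set.range fun p ω => ω p)

lemma eval_mem_linComb (p : ℕ × ℕ) : (fun ω : ℕ × ℕ → ℝ => ω p) ∈ linComb :=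
  Submodule.subset_span ⟨p, rfl⟩

/-- Only finitely many coordinates enter; they are jointly Gaussian by independence, and a linear
map preserves this. -/
lemma hasGaussianLaw_of_mem_linComb {f : (ℕ × ℕ → ℝ) → ℝ} (hf : f ∈ linComb) :
    HasGaussianLaw f noise := by
  obtain ⟨a, rfl⟩ := Finsupp.mem_span_range_iff_exists_finsupp.1 hf
  have h := iIndepFun.hasGaussianLaw (X := fun (p : a.support) (ω : ℕ × ℕ → ℝ) => ω p)
    (fun p => hasGaussianLaw_eval p) (iIndepFun_noise.precomp Subtype.val_injective)
  convert! h.map (∑ p : a.support, a p • ContinuousLinearMap.proj p) using 1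
  ext ω
  simp [Finsupp.sum, ← Finset.sum_coe_sort a.support]

lemma measurable_of_mem_linComb {f : (ℕ × ℕ → ℝ) → ℝ} (hf : f ∈ linComb) : Measurable f := by
  induction hf using Submodule.span_induction with
  | mem f h => obtain ⟨p, rfl⟩ := h; exact measurable_pi_apply p
  | zero => exact measurable_const
  | add f g _ _ hf hg => exact hf.add hg
  | smul c f _ hf => exact hf.const_smul c

lemma memLp_of_mem_linComb {f : (ℕ × ℕ → ℝ) → ℝ} (hf : f ∈ linComb) : MemLp f 2 noise :=
  (hasGaussianLaw_of_mem_linComb hf).memLp (by simp)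

lemma integral_of_mem_linComb {f : (ℕ × ℕ → ℝ) → ℝ} (hf : f ∈ linComb) :
    ∫ ω, f ω ∂noise = 0 := by
  induction hf using Submodule.span_induction with
  | mem f h => obtain ⟨p, rfl⟩ := h; exact integral_eval p
  | zero => simp
  | add f g hf hg h1 h2 =>
    have := integral_add ((memLp_of_mem_linComb hf).integrable (by norm_num))
      ((memLp_of_mem_linComb hg).integrable (by norm_num))
    simp only [Pi.add_apply]
    rw [this, h1, h2, add_zero]
  | smul c f _ h => simp [integral_const_mul, h]

lemma map_of_mem_linComb {f : (ℕ × ℕ → ℝ) → ℝ} (hf : f ∈ linComb) :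
    noise.map f = gaussianReal 0 (∫ ω, f ω ^ 2 ∂noise).toNNReal := by
  rw [(hasGaussianLaw_of_mem_linComb hf).map_eq_gaussianReal, integral_of_mem_linComb hf,
    variance_of_integral_eq_zero (measurable_of_mem_linComb hf).aemeasurable
      (integral_of_mem_linComb hf)]

/-- The average of the noise over the children of cell `q`, which have level `m`. -/
def noiseAvg (b m q : ℕ) (ω : ℕ × ℕ → ℝ) : ℝ :=
  (b : ℝ)⁻¹ * ∑ r ∈ Finset.range b, ω (m, b * q + r)

/-- The innovation of the limiting process in cell `i` of level `m`. -/
def innov (b m i : ℕ) (ω : ℕ × ℕ → ℝ) : ℝ :=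
  (b : ℝ) / ((b : ℝ) - 1) * (√((b : ℝ) ^ m))⁻¹ * (ω (m, i) - noiseAvg b m (i / b) ω)

lemma noiseAvg_mem_linComb (b m q : ℕ) : noiseAvg b m q ∈ linComb := by
  have : noiseAvg b m q =
      (b : ℝ)⁻¹ • ∑ r ∈ Finset.range b, fun ω : ℕ × ℕ → ℝ => ω (m, b * q + r) := by
    ext ω
    simp [noiseAvg]
  rw [this]
  exact linComb.smul_mem _ (linComb.sum_mem fun r _ => eval_mem_linComb _)

lemma innov_mem_linComb (b m i : ℕ) : innov b m i ∈ linComb :=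
  linComb.smul_mem ((b : ℝ) / ((b : ℝ) - 1) * (√((b : ℝ) ^ m))⁻¹)
    (linComb.sub_mem (eval_mem_linComb _) (noiseAvg_mem_linComb b m (i / b)))

lemma integrable_mul_of_mem_linComb {f g : (ℕ × ℕ → ℝ) → ℝ} (hf : f ∈ linComb)
    (hg : g ∈ linComb) : Integrable (fun ω => f ω * g ω) noise :=
  (memLp_of_mem_linComb hf).integrable_mul (memLp_of_mem_linComb hg)

lemma integral_eval_mul_noiseAvg {b : ℕ} (hb : 2 ≤ b) (m l i q : ℕ) :
    ∫ ω, ω (m, i) * noiseAvg b l q ω ∂noise = if m = l ∧ i / b = q then (b : ℝ)⁻¹ else 0 := by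
  have e (ω : ℕ × ℕ → ℝ) : ω (m, i) * noiseAvg b l q ω =
      ∑ r ∈ Finset.range b, (b : ℝ)⁻¹ * (ω (m, i) * ω (l, b * q + r)) := by
    rw [noiseAvg, ← Finset.mul_sum, ← Finset.mul_sum]; ring
  simp_rw [e]
  rw [integral_finsetSum _ fun r _ =>
    (integrable_mul_of_mem_linComb (eval_mem_linComb (m, i))
      (eval_mem_linComb (l, b * q + r))).const_mul _]
  simp_rw [integral_const_mul, integral_eval_mul_eval, Prod.mk.injEq]
  split_ifs with h
  · rw [Finset.sum_eq_single (i % b)]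
    · have := Nat.div_add_mod i b
      rw [if_pos ⟨h.1, by rw [← h.2, this]⟩, mul_one]
    · intro r hr hne
      rw [if_neg, mul_zero]
      rintro ⟨_, h'⟩
      apply hne
      rw [h', Nat.mul_add_mod, Nat.mod_eq_of_lt (Finset.mem_range.1 hr)]
    · intro h'
      exact absurd (Finset.mem_range.2 (Nat.mod_lt _ (by omega))) h'
  · refine Finset.sum_eq_zero fun r hr => ?_
    rw [if_neg, mul_zero]
    rintro ⟨h1, h2⟩
    refine h ⟨h1, ?_⟩
    rw [h2, Nat.mul_add_div (by omega), Nat.div_eq_of_lt (Finset.mem_range.1 hr), add_zero]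

lemma integral_noiseAvg_mul_noiseAvg {b : ℕ} (hb : 2 ≤ b) (m l p q : ℕ) :
    ∫ ω, noiseAvg b m p ω * noiseAvg b l q ω ∂noise =
      if m = l ∧ p = q then (b : ℝ)⁻¹ else 0 := by
  have e (ω : ℕ × ℕ → ℝ) : noiseAvg b m p ω * noiseAvg b l q ω =
      ∑ r ∈ Finset.range b, (b : ℝ)⁻¹ * (ω (m, b * p + r) * noiseAvg b l q ω) := by
    rw [noiseAvg, ← Finset.mul_sum, ← Finset.sum_mul]; ring
  simp_rw [e]
  rw [integral_finsetSum _ fun r _ => (integrable_mul_of_mem_linComb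
    (eval_mem_linComb _) (noiseAvg_mem_linComb b l q)).const_mul _]
  simp_rw [integral_const_mul, integral_eval_mul_noiseAvg hb]
  have hb0 : (b : ℝ) ≠ 0 := by positivity
  rw [Finset.sum_congr rfl (g := fun _ => (b : ℝ)⁻¹ * if m = l ∧ p = q then (b : ℝ)⁻¹ else 0)]
  · rw [Finset.sum_const, Finset.card_range, nsmul_eq_mul, mul_inv_cancel_left₀ hb0]
  · intro r hr
    rw [Nat.mul_add_div (by omega), Nat.div_eq_of_lt (Finset.mem_range.1 hr), add_zero]

/-- Subtracting the sibling average from independent standard normal variables leaves covariance `1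
- 1 / b` on the diagonal and `-1 / b` between different siblings, the same as for one multinomial
split up to scaling. -/
lemma integral_innov_mul_innov {b : ℕ} (hb : 2 ≤ b) (m l i j : ℕ) :
    ∫ ω, innov b m i ω * innov b l j ω ∂noise = if m = l then innovCov b m i j else 0 := by
  have e (ω : ℕ × ℕ → ℝ) : innov b m i ω * innov b l j ω =
      ((b : ℝ) / ((b : ℝ) - 1)) ^ 2 * ((√((b : ℝ) ^ m))⁻¹ * (√((b : ℝ) ^ l))⁻¹) *
      ((ω (m, i) * ω (l, j) - ω (m, i) * noiseAvg b l (j / b) ω) -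
        (ω (l, j) * noiseAvg b m (i / b) ω - noiseAvg b m (i / b) ω * noiseAvg b l (j / b) ω)) := by
    simp only [innov]; ring
  have i1 := integrable_mul_of_mem_linComb (eval_mem_linComb (m, i)) (eval_mem_linComb (l, j))
  have i2 := integrable_mul_of_mem_linComb (eval_mem_linComb (m, i))
    (noiseAvg_mem_linComb b l (j / b))
  have i3 := integrable_mul_of_mem_linComb (eval_mem_linComb (l, j))
    (noiseAvg_mem_linComb b m (i / b))
  have i4 := integrable_mul_of_mem_linComb (noiseAvg_mem_linComb b m (i / b))
    (noiseAvg_mem_linComb b l (j / b))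
  have i12 : Integrable (fun ω => ω (m, i) * ω (l, j) - ω (m, i) * noiseAvg b l (j / b) ω) noise :=
    i1.sub i2
  have i34 : Integrable (fun ω => ω (l, j) * noiseAvg b m (i / b) ω -
      noiseAvg b m (i / b) ω * noiseAvg b l (j / b) ω) noise := i3.sub i4
  simp_rw [e]
  rw [integral_const_mul, integral_sub i12 i34, integral_sub i1 i2,
    integral_sub i3 i4, integral_eval_mul_eval, integral_eval_mul_noiseAvg hb,
    integral_eval_mul_noiseAvg hb, integral_noiseAvg_mul_noiseAvg hb]
  by_cases hml : m = l
  · subst hml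
    have hs : (√((b : ℝ) ^ m))⁻¹ * (√((b : ℝ) ^ m))⁻¹ = ((b : ℝ) ^ m)⁻¹ := by
      rw [← mul_inv, Real.mul_self_sqrt (by positivity)]
    rw [hs, innovCov, if_pos rfl]
    congr 1
    by_cases hij : i / b = j / b
    · simp [hij]
    · have : i ≠ j := fun h => hij (by rw [h])
      simp [hij, Ne.symm hij, this]
  · simp [hml, Ne.symm hml]

end

section

/-! ### The covariance function of the limit -/

variable {b : ℕ}

/-- The covariance function of the limit. -/
def limCov (b : ℕ) (s t : I) : ℝ :=
  (b : ℝ) / ((b : ℝ) - 1) ^ 2 - ((b : ℝ) + 1) / ((b : ℝ) - 1) ^ 2 * negPow b (prefixLength b s t)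

lemma digit_succ (hb : 2 ≤ b) (t : I) (k : ℕ) : digit b t (k + 1) = cell b (k + 1) t % b := by
  unfold digit cell
  split_ifs with h
  · subst h
    have hp : 0 < b ^ k := by positivity
    have : ⌊((1 : I) : ℝ) * (b : ℝ) ^ (k + 1)⌋₊ = b ^ (k + 1) := by
      rw [Set.Icc.coe_one, one_mul, ← Nat.cast_pow, Nat.floor_natCast]
    rw [this, min_eq_right (Nat.sub_le _ _)]
    obtain ⟨a, ha⟩ : ∃ a, b ^ k = a + 1 := ⟨b ^ k - 1, by omega⟩
    have : b ^ (k + 1) - 1 = b * a + (b - 1) := by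
      rw [pow_succ', ha, Nat.mul_add]; omega
    rw [this, Nat.mul_add_mod, Nat.mod_eq_of_lt (by omega)]
  · have ht : (t : ℝ) < 1 := lt_of_le_of_ne t.2.2 fun e => h (Subtype.ext e)
    have hlt : ⌊(t : ℝ) * (b : ℝ) ^ (k + 1)⌋₊ < b ^ (k + 1) := by
      rw [Nat.floor_lt (mul_nonneg t.2.1 (by positivity))]
      push_cast
      have : (0 : ℝ) < (b : ℝ) ^ (k + 1) := by positivity
      nlinarith
    rw [min_eq_left (by omega)]

/-- The number of the cell of level `k` is the integer with digits `t_1, …, t_k`. The truncation in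
`cell` matches the convention that all digits of `1` are `b - 1`. -/
lemma forall_digit_eq_iff (hb : 2 ≤ b) (s t : I) (k : ℕ) :
    (∀ i, 1 ≤ i → i ≤ k → digit b s i = digit b t i) ↔ cell b k s = cell b k t := by
  induction k with
  | zero =>
    simp only [cell_zero, iff_true]
    intro i h1 h2
    omega
  | succ k ih =>
    have hs := Nat.div_add_mod (cell b (k + 1) s) b
    have ht := Nat.div_add_mod (cell b (k + 1) t) b
    rw [cell_succ_div hb, ← digit_succ hb] at hs ht
    constructor
    · intro h
      rw [← hs, ← ht, ih.1 fun i h1 h2 => h i h1 (by omega), h (k + 1) (by omega) le_rfl]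
    · intro h i h1 h2
      rcases h2.lt_or_eq with h2 | rfl
      · exact ih.2 (cell_eq_of_le hb (Nat.le_succ k) h) i h1 (by omega)
      · rw [digit_succ hb, digit_succ hb, h]

lemma pathCov_of_agree (hb : 2 ≤ b) {i j : ℕ → ℕ} {K : ℕ} (h : ∀ k ≤ K, i k = j k) :
    pathCov b K i j = (b : ℝ) / ((b : ℝ) - 1) ^ 2 * (1 - ((b : ℝ) ^ K)⁻¹) := by
  have hb0 : (b : ℝ) ≠ 0 := by positivity
  have hb1 : (b : ℝ) - 1 ≠ 0 := by
    have : (2 : ℝ) ≤ b := by exact_mod_cast hb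
    intro h; linarith
  unfold pathCov
  induction K with
  | zero => simp
  | succ K ih =>
    rw [Finset.sum_range_succ, ih fun k hk => h k (by omega), h (K + 1) le_rfl, innovCov,
      if_pos rfl, if_pos rfl, pow_succ]
    field_simp
    ring

lemma innovCov_of_div_ne {m i j : ℕ} (h : i / b ≠ j / b) : innovCov b m i j = 0 := by
  rw [innovCov, if_neg h, mul_zero]

/-- The `j` common levels contribute `b / (b - 1) ^ 2 * (1 - b ^ (-j))`. On level `j + 1` the cells
are different siblings and contribute `-b ^ (-j) / (b - 1) ^ 2`. On later levels the parents differ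
and the contribution vanishes. -/
lemma tendsto_pathCov (hb : 2 ≤ b) (s t : I) :
    Tendsto (fun K => pathCov b K (fun k => cell b k s) fun k => cell b k t) atTop
      (𝓝 (limCov b s t)) := by
  have hb0 : (b : ℝ) ≠ 0 := by positivity
  have hb2 : (2 : ℝ) ≤ b := by exact_mod_cast hb
  have hb1 : (b : ℝ) - 1 ≠ 0 := by intro h; linarith
  have hpl : prefixLength b s t = ⨆ (k : ℕ) (_ : cell b k s = cell b k t), (k : ℕ∞) := by
    unfold prefixLength
    simp_rw [forall_digit_eq_iff hb]
  by_cases hall : ∀ k, cell b k s = cell b k t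
  · have htop : prefixLength b s t = ⊤ := by
      rw [hpl, eq_top_iff]
      refine ENat.forall_natCast_le_iff_le.1 fun k _ => ?_
      exact le_iSup₂ (f := fun (k : ℕ) (_ : cell b k s = cell b k t) => (k : ℕ∞)) k (hall k)
    have h0 : Tendsto (fun K : ℕ => ((b : ℝ) ^ K)⁻¹) atTop (𝓝 0) :=
      (tendsto_pow_atTop_atTop_of_one_lt (by linarith)).inv_tendsto_atTop
    simp_rw [pathCov_of_agree hb fun k _ => hall k]
    have := (h0.const_sub 1).const_mul ((b : ℝ) / ((b : ℝ) - 1) ^ 2)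
    simpa [limCov, htop, negPow] using this
  · push Not at hall
    classical
    obtain ⟨hne, hlt⟩ := And.intro (Nat.find_spec hall) fun k => Nat.find_min hall (m := k)
    obtain ⟨j, hj⟩ : ∃ j, Nat.find hall = j + 1 := by
      refine Nat.exists_eq_succ_of_ne_zero fun h0 => ?_
      rw [h0] at hne
      simp at hne
    rw [hj] at hne
    have hag (k : ℕ) (hk : k ≤ j) : cell b k s = cell b k t := by
      simpa using hlt k (by omega)
    have hdis (k : ℕ) (hk : j + 1 ≤ k) : cell b k s ≠ cell b k t := fun h =>
      hne (cell_eq_of_le hb hk h)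
    have hlen : prefixLength b s t = j := by
      rw [hpl]
      refine le_antisymm (iSup₂_le fun k hk => ?_)
        (le_iSup₂ (f := fun (k : ℕ) (_ : cell b k s = cell b k t) => (k : ℕ∞)) j (hag j le_rfl))
      by_contra hlt
      rw [not_le, Nat.cast_lt] at hlt
      exact hdis k hlt hk
    refine tendsto_const_nhds.congr' ?_
    filter_upwards [eventually_ge_atTop (j + 1)] with K hK
    obtain ⟨d, rfl⟩ := Nat.exists_eq_add_of_le hK
    have htail : ∑ m ∈ Finset.range d, innovCov b (j + 1 + m + 1)
        (cell b (j + 1 + m + 1) s) (cell b (j + 1 + m + 1) t) = 0 :=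
      Finset.sum_eq_zero fun m _ => innovCov_of_div_ne <| by
        rw [cell_succ_div hb, cell_succ_div hb]
        exact hdis _ (by omega)
    have hfirst := pathCov_of_agree hb (i := fun k => cell b k s) (j := fun k => cell b k t) hag
    unfold pathCov at hfirst ⊢
    rw [Finset.sum_range_add, htail, Finset.sum_range_succ, hfirst, innovCov,
      if_pos (by rw [cell_succ_div hb, cell_succ_div hb, hag j le_rfl]), if_neg hne, limCov, hlen,
      negPow, if_neg (by simp), ENat.toNat_natCast, pow_succ]
    field_simp
    ring

/-! ### Uniform bounds for the innovations of one level -/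

/-- Linear in `y ^ 4`, so that a maximum can be bounded by a sum over all cells and expectations
taken termwise. -/
lemma abs_le_add_pow_four {θ : ℝ} (hθ : 0 < θ) (y : ℝ) : |y| ≤ θ + (θ ^ 3)⁻¹ * y ^ 4 := by
  have h4 : 0 ≤ (θ ^ 3)⁻¹ * y ^ 4 := by positivity
  rcases le_or_gt |y| θ with h | h
  · linarith
  · have h3 : θ ^ 3 ≤ |y| ^ 3 := by gcongr
    have : |y| ≤ (θ ^ 3)⁻¹ * y ^ 4 := by
      rw [inv_mul_eq_div, le_div_iff₀ (by positivity)]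
      calc |y| * θ ^ 3 ≤ |y| * |y| ^ 3 := by gcongr
        _ = |y| ^ 4 := by ring
        _ = y ^ 4 := by rw [pow_abs, abs_of_nonneg (by positivity)]
    linarith

/-- An upper bound for the absolute values of `z i`, `i < b ^ m`, of small expectation if the
fourth moments are small compared with `b ^ (-m)`. -/
def levelBound (b m : ℕ) (z : ℕ → ℝ) : ℝ :=
  (4 / 5 : ℝ) ^ m + (((4 / 5 : ℝ) ^ m) ^ 3)⁻¹ * ∑ i ∈ Finset.range (b ^ m), z i ^ 4

lemma levelBound_nonneg (b m : ℕ) (z : ℕ → ℝ) : 0 ≤ levelBound b m z := by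
  unfold levelBound
  have : 0 ≤ ∑ i ∈ Finset.range (b ^ m), z i ^ 4 := Finset.sum_nonneg fun i _ => by positivity
  positivity

lemma abs_le_levelBound {b m i : ℕ} (z : ℕ → ℝ) (hi : i < b ^ m) : |z i| ≤ levelBound b m z := by
  refine (abs_le_add_pow_four (show 0 < (4 / 5 : ℝ) ^ m by positivity) (z i)).trans ?_
  unfold levelBound
  gcongr
  exact Finset.single_le_sum (f := fun i => z i ^ 4) (fun i _ => by positivity)
    (Finset.mem_range.2 hi)

lemma integrable_levelBound {Ω : Type*} [MeasurableSpace Ω] {P : Measure Ω}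
    [IsProbabilityMeasure P] {m : ℕ} {z : ℕ → Ω → ℝ}
    (hz : ∀ i < b ^ m, Integrable (fun ω => z i ω ^ 4) P) :
    Integrable (fun ω => levelBound b m fun i => z i ω) P :=
  (integrable_const _).add ((integrable_finsetSum _ fun i hi =>
    hz i (Finset.mem_range.1 hi)).const_mul _)

/-- With threshold `θ = (4 / 5) ^ m`, the fourth moments of the `b ^ m` cells add up to at most `C *
b ^ (-m)`, and `θ⁻³ * b ^ (-m) ≤ (125 / 64 / 2) ^ m`. The base `4 / 5` is below `1` but above `2 ^
(-1 / 3)`, which makes both terms decay geometrically already for `b = 2`. -/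
lemma integral_levelBound_le (hb : 2 ≤ b) {Ω : Type*} [MeasurableSpace Ω] {P : Measure Ω}
    [IsProbabilityMeasure P] {m : ℕ} {z : ℕ → Ω → ℝ} {C : ℝ} (hC : 0 ≤ C)
    (hz : ∀ i < b ^ m, Integrable (fun ω => z i ω ^ 4) P)
    (hz4 : ∀ i < b ^ m, ∫ ω, z i ω ^ 4 ∂P ≤ C * (((b : ℝ) ^ m)⁻¹) ^ 2) :
    ∫ ω, levelBound b m (fun i => z i ω) ∂P ≤ (1 + C) * (125 / 128 : ℝ) ^ m := by
  have hsum : Integrable (fun ω => ∑ i ∈ Finset.range (b ^ m), z i ω ^ 4) P :=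
    integrable_finsetSum _ fun i hi => hz i (Finset.mem_range.1 hi)
  have hb2 : (2 : ℝ) ≤ b := by exact_mod_cast hb
  unfold levelBound
  rw [integral_add (integrable_const _) (hsum.const_mul _), integral_const_mul,
    integral_finsetSum _ fun i hi => hz i (Finset.mem_range.1 hi)]
  have h1 : ∑ i ∈ Finset.range (b ^ m), ∫ ω, z i ω ^ 4 ∂P ≤ C * ((b : ℝ) ^ m)⁻¹ := by
    calc ∑ i ∈ Finset.range (b ^ m), ∫ ω, z i ω ^ 4 ∂P
        ≤ ∑ i ∈ Finset.range (b ^ m), C * (((b : ℝ) ^ m)⁻¹) ^ 2 :=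
          Finset.sum_le_sum fun i hi => hz4 i (Finset.mem_range.1 hi)
      _ = C * ((b : ℝ) ^ m)⁻¹ := by
        rw [Finset.sum_const, Finset.card_range, nsmul_eq_mul]
        push_cast
        field_simp
  have h2 : (((4 / 5 : ℝ) ^ m) ^ 3)⁻¹ * ((b : ℝ) ^ m)⁻¹ ≤ (125 / 128 : ℝ) ^ m := by
    rw [← mul_inv, ← pow_mul, mul_comm m 3, pow_mul, ← mul_pow, ← inv_pow]
    refine pow_le_pow_left₀ (by positivity) ?_ m
    rw [inv_le_comm₀ (by positivity) (by positivity)]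
    linarith
  have h3 : (4 / 5 : ℝ) ^ m ≤ (125 / 128 : ℝ) ^ m :=
    pow_le_pow_left₀ (by norm_num) (by norm_num) m
  have h4 : (((4 / 5 : ℝ) ^ m) ^ 3)⁻¹ * ∑ i ∈ Finset.range (b ^ m), ∫ ω, z i ω ^ 4 ∂P ≤
      C * (125 / 128 : ℝ) ^ m := by
    calc _ ≤ (((4 / 5 : ℝ) ^ m) ^ 3)⁻¹ * (C * ((b : ℝ) ^ m)⁻¹) := by gcongr
      _ = C * ((((4 / 5 : ℝ) ^ m) ^ 3)⁻¹ * ((b : ℝ) ^ m)⁻¹) := by ring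
      _ ≤ _ := by gcongr
  simp only [integral_const, probReal_univ, smul_eq_mul, one_mul]
  linarith

/-- By scaling; the fourth moment of the standard normal law stays an unevaluated constant, as only
the power of the variance matters. -/
lemma integral_pow_four_gaussianReal (v : NNReal) :
    ∫ x, x ^ 4 ∂gaussianReal 0 v = (v : ℝ) ^ 2 * ∫ x, x ^ 4 ∂gaussianReal 0 1 := by
  have h : (gaussianReal 0 1).map (√v * ·) = gaussianReal 0 v := by
    rw [gaussianReal_map_const_mul, mul_zero]
    congr 1
    ext
    simp
  rw [← h, integral_map (by fun_prop) (by fun_prop)]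
  simp_rw [mul_pow]
  rw [integral_const_mul]
  congr 1
  rw [show (4 : ℕ) = 2 * 2 from rfl, pow_mul, Real.sq_sqrt v.coe_nonneg]

lemma innovCov_self_nonneg (hb : 2 ≤ b) (m i : ℕ) : 0 ≤ innovCov b m i i := by
  have hb2 : (2 : ℝ) ≤ b := by exact_mod_cast hb
  have : (b : ℝ)⁻¹ ≤ 1 := inv_le_one_of_one_le₀ (by linarith)
  rw [innovCov, if_pos rfl, if_pos rfl]
  exact mul_nonneg (by positivity) (by linarith)

lemma innovCov_self_le (hb : 2 ≤ b) (m i : ℕ) : innovCov b m i i ≤ 2 * ((b : ℝ) ^ m)⁻¹ := by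
  have hb2 : (2 : ℝ) ≤ b := by exact_mod_cast hb
  have hb1 : 0 < (b : ℝ) - 1 := by linarith
  rw [innovCov, if_pos rfl, if_pos rfl]
  have : ((b : ℝ) / ((b : ℝ) - 1)) ^ 2 * (1 - (b : ℝ)⁻¹) ≤ 2 := by
    have : ((b : ℝ) / ((b : ℝ) - 1)) ^ 2 * (1 - (b : ℝ)⁻¹) = b / (b - 1) := by
      field_simp
    rw [this, div_le_iff₀ hb1]
    linarith
  calc _ = ((b : ℝ) / ((b : ℝ) - 1)) ^ 2 * (1 - (b : ℝ)⁻¹) * ((b : ℝ) ^ m)⁻¹ := by ring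
    _ ≤ _ := by gcongr

lemma integrable_innov_pow_four (b m i : ℕ) : Integrable (fun ω => innov b m i ω ^ 4) noise := by
  have : MemLp (innov b m i) 4 noise :=
    (hasGaussianLaw_of_mem_linComb (innov_mem_linComb b m i)).memLp (by simp)
  have h := this.integrable_norm_pow (p := 4) (by norm_num)
  refine h.congr (.of_forall fun ω => ?_)
  simp only [Real.norm_eq_abs]
  rw [pow_abs, abs_of_nonneg (by positivity)]

lemma integral_innov_pow_four_le (hb : 2 ≤ b) (m i : ℕ) :
    ∫ ω, innov b m i ω ^ 4 ∂noise ≤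
      4 * (∫ x, x ^ 4 ∂gaussianReal 0 1) * (((b : ℝ) ^ m)⁻¹) ^ 2 := by
  have hmap := map_of_mem_linComb (innov_mem_linComb b m i)
  have hvar : ∫ ω, innov b m i ω ^ 2 ∂noise = innovCov b m i i := by
    simp_rw [sq]
    rw [integral_innov_mul_innov hb, if_pos rfl]
  have h := integral_map (μ := noise) (φ := innov b m i) (f := fun x : ℝ => x ^ 4)
    (measurable_of_mem_linComb (innov_mem_linComb b m i)).aemeasurable (by fun_prop)
  have hpos : 0 ≤ ∫ x, x ^ 4 ∂gaussianReal 0 1 := integral_nonneg fun x => by positivity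
  rw [← h, hmap, hvar, integral_pow_four_gaussianReal, Real.coe_toNNReal _ (innovCov_self_nonneg hb m i)]
  have h1 := innovCov_self_nonneg hb m i
  have h2 := innovCov_self_le hb m i
  have h3 : innovCov b m i i ^ 2 ≤ (2 * ((b : ℝ) ^ m)⁻¹) ^ 2 := by gcongr
  calc _ ≤ (2 * ((b : ℝ) ^ m)⁻¹) ^ 2 * ∫ x, x ^ 4 ∂gaussianReal 0 1 := by gcongr
    _ = _ := by ring

end

section

/-! ### The limiting process -/

variable {b : ℕ}

/-- A bound for the innovations of level `m + 1`. -/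
def innovBound (b m : ℕ) (ω : ℕ × ℕ → ℝ) : ℝ := levelBound b (m + 1) fun i => innov b (m + 1) i ω

lemma innovBound_nonneg (b m : ℕ) (ω : ℕ × ℕ → ℝ) : 0 ≤ innovBound b m ω := levelBound_nonneg _ _ _

lemma abs_innov_cell_le (hb : 2 ≤ b) (m : ℕ) (ω : ℕ × ℕ → ℝ) (u : ℝ) :
    |innov b (m + 1) (cell b (m + 1) u) ω| ≤ innovBound b m ω :=
  abs_le_levelBound (fun i => innov b (m + 1) i ω) (cell_lt hb _ _)

lemma measurable_innov (b m i : ℕ) : Measurable (innov b m i) :=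
  measurable_of_mem_linComb (innov_mem_linComb b m i)

lemma measurable_innovBound (b m : ℕ) : Measurable (innovBound b m) :=
  measurable_const.add ((Finset.measurable_fun_sum _ fun i _ =>
    (measurable_innov b (m + 1) i).pow_const 4).const_mul _)

/-- The remainder of the series of the bounds. -/
def innovTail (b K : ℕ) (ω : ℕ × ℕ → ℝ) : ENNReal := ∑' m, ENNReal.ofReal (innovBound b (m + K) ω)

lemma exists_lintegral_innovBound_le (hb : 2 ≤ b) : ∃ C : ℝ, 0 ≤ C ∧ ∀ m,
    ∫⁻ ω, ENNReal.ofReal (innovBound b m ω) ∂noise ≤ ENNReal.ofReal (C * (125 / 128 : ℝ) ^ (m + 1)) := by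
  have hpos : 0 ≤ ∫ x, x ^ 4 ∂gaussianReal 0 1 := integral_nonneg fun x => by positivity
  refine ⟨1 + 4 * ∫ x, x ^ 4 ∂gaussianReal 0 1, by positivity, fun m => ?_⟩
  have hint : Integrable (innovBound b m) noise :=
    integrable_levelBound fun i _ => integrable_innov_pow_four b (m + 1) i
  rw [← ofReal_integral_eq_lintegral_ofReal hint (.of_forall fun ω => innovBound_nonneg b m ω)]
  exact ENNReal.ofReal_le_ofReal (integral_levelBound_le hb (by positivity)
    (fun i _ => integrable_innov_pow_four b (m + 1) i)
    fun i _ => integral_innov_pow_four_le hb (m + 1) i)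

lemma lintegral_innovTail (b K : ℕ) : ∫⁻ ω, innovTail b K ω ∂noise =
    ∑' m, ∫⁻ ω, ENNReal.ofReal (innovBound b (m + K) ω) ∂noise :=
  lintegral_tsum fun m => (measurable_innovBound b (m + K)).ennreal_ofReal.aemeasurable

lemma lintegral_innovTail_zero_ne_top (hb : 2 ≤ b) : ∫⁻ ω, innovTail b 0 ω ∂noise ≠ ⊤ := by
  obtain ⟨C, hC0, hC⟩ := exists_lintegral_innovBound_le hb
  have hs : Summable fun m : ℕ => C * (125 / 128 : ℝ) ^ (m + 1) :=
    ((summable_nat_add_iff 1).2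
      (summable_geometric_of_lt_one (by norm_num) (by norm_num))).mul_left C
  rw [lintegral_innovTail]
  refine ne_top_of_le_ne_top ?_ (ENNReal.tsum_le_tsum fun m => hC (m + 0))
  simp only [add_zero]
  rw [← ENNReal.ofReal_tsum_of_nonneg (fun m => by positivity) hs]
  exact ENNReal.ofReal_ne_top

lemma tendsto_lintegral_innovTail (hb : 2 ≤ b) :
    Tendsto (fun K => ∫⁻ ω, innovTail b K ω ∂noise) atTop (𝓝 0) := by
  have h := lintegral_innovTail_zero_ne_top hb
  rw [lintegral_innovTail] at h
  simp_rw [lintegral_innovTail]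
  exact ENNReal.tendsto_sum_nat_add _ h

lemma summable_of_innovTail_ne_top {K : ℕ} {ω : ℕ × ℕ → ℝ} (h : innovTail b K ω ≠ ⊤) :
    Summable fun m => innovBound b m ω := by
  rw [← summable_nat_add_iff K]
  have := ENNReal.summable_toReal h
  refine this.congr fun m => ?_
  rw [ENNReal.toReal_ofReal (innovBound_nonneg _ _ _)]

lemma ae_summable_innovBound (hb : 2 ≤ b) : ∀ᵐ ω ∂noise, Summable fun m => innovBound b m ω := by
  have hm : Measurable (innovTail b 0) :=
    Measurable.tsum fun m => (measurable_innovBound b (m + 0)).ennreal_ofReal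
  filter_upwards [ae_lt_top hm (lintegral_innovTail_zero_ne_top hb)] with ω hω
  exact summable_of_innovTail_ne_top hω.ne

open scoped Classical in
/-- The path of the limiting process. -/
def limitPath (hb : 2 ≤ b) (ω : ℕ × ℕ → ℝ) : Cadlag :=
  if h : Summable fun m => innovBound b m ω then
    { toFun t := ∑' m, innov b (m + 1) (cell b (m + 1) t) ω
      right_cont t := by
        -- Each summand is locally constant to the right of `t`, and the summable bounds do not
        -- depend on the argument, so limits pass through the series.
        refine tendsto_tsum_of_dominated_convergence h (fun m => ?_)
          (.of_forall fun s m => abs_innov_cell_le hb m ω s)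
        refine tendsto_const_nhds.congr' ?_
        filter_upwards [cell_right b (m + 1) t] with s hs
        rw [hs]
      left_lim t := by
        choose i hi using fun m => cell_left b (m + 1) t
        refine ⟨∑' m, innov b (m + 1) (i m) ω, tendsto_tsum_of_dominated_convergence h (fun m => ?_)
          (.of_forall fun s m => abs_innov_cell_le hb m ω s)⟩
        refine tendsto_const_nhds.congr' ?_
        filter_upwards [hi m] with s hs
        rw [hs] }
  -- This case has probability zero; any càdlàg function would do.
  else stepFun hb 0 0

lemma limitPath_apply (hb : 2 ≤ b) {ω : ℕ × ℕ → ℝ} (h : Summable fun m => innovBound b m ω)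
    (t : I) : limitPath hb ω t = ∑' m, innov b (m + 1) (cell b (m + 1) t) ω := by
  rw [limitPath, dif_pos h]

/-- The approximation of the limiting process that takes only the first `K` levels into account. -/
def limitApprox (hb : 2 ≤ b) (K : ℕ) (ω : ℕ × ℕ → ℝ) : Cadlag :=
  stepFun hb K fun v => ∑ m ∈ Finset.range K, innov b (m + 1) (v / b ^ (K - (m + 1))) ω

/-- The quotient `v / b ^ (K - (m + 1))` is the ancestor of level `m + 1` of the cell `v` of level
`K`. -/
lemma stepFun_path_apply (hb : 2 ≤ b) (K : ℕ) (f : ℕ → ℕ → ℝ) (t : I) :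
    stepFun hb K (fun v => ∑ m ∈ Finset.range K, f (m + 1) (v / b ^ (K - (m + 1)))) t =
      ∑ m ∈ Finset.range K, f (m + 1) (cell b (m + 1) t) := by
  change ∑ m ∈ Finset.range K, f (m + 1) (cell b K t / b ^ (K - (m + 1))) = _
  refine Finset.sum_congr rfl fun m hm => ?_
  have hm' := Finset.mem_range.1 hm
  have := cell_div_pow hb (m + 1) (K - (m + 1)) t
  rw [Nat.add_sub_cancel' (by omega)] at this
  rw [← this]

lemma limitApprox_apply (hb : 2 ≤ b) (K : ℕ) (ω : ℕ × ℕ → ℝ) (t : I) :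
    limitApprox hb K ω t = ∑ m ∈ Finset.range K, innov b (m + 1) (cell b (m + 1) t) ω :=
  stepFun_path_apply hb K (fun m i => innov b m i ω) t

lemma abs_limitApprox_sub_limitPath_le (hb : 2 ≤ b) {ω : ℕ × ℕ → ℝ}
    (h : Summable fun m => innovBound b m ω) (K : ℕ) (t : I) :
    |limitApprox hb K ω t - limitPath hb ω t| ≤ ∑' m, innovBound b (m + K) ω := by
  have hs : Summable fun m => innov b (m + 1) (cell b (m + 1) t) ω :=
    .of_norm_bounded h fun m => abs_innov_cell_le hb m ω t
  rw [limitApprox_apply, limitPath_apply hb h, ← hs.sum_add_tsum_nat_add K, sub_add_cancel_left,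
    abs_neg]
  rw [← Real.norm_eq_abs]
  exact tsum_of_norm_bounded ((summable_nat_add_iff K).2 h).hasSum fun m =>
    abs_innov_cell_le hb (m + K) ω t

lemma dist_limitApprox_limitPath_le (hb : 2 ≤ b) {ω : ℕ × ℕ → ℝ}
    (h : Summable fun m => innovBound b m ω) (K : ℕ) :
    dist (limitApprox hb K ω) (limitPath hb ω) ≤ ∑' m, innovBound b (m + K) ω :=
  dist_le_of_forall_abs_sub_le fun t => abs_limitApprox_sub_limitPath_le hb h K t

lemma tendsto_limitApprox (hb : 2 ≤ b) {ω : ℕ × ℕ → ℝ}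
    (h : Summable fun m => innovBound b m ω) :
    Tendsto (fun K => limitApprox hb K ω) atTop (𝓝 (limitPath hb ω)) :=
  tendsto_iff_dist_tendsto_zero.2 <| squeeze_zero (fun _ => dist_nonneg)
    (fun K => dist_limitApprox_limitPath_le hb h K)
    (tendsto_sum_nat_add fun m => innovBound b m ω)

lemma tendsto_limitApprox_apply (hb : 2 ≤ b) {ω : ℕ × ℕ → ℝ}
    (h : Summable fun m => innovBound b m ω) (t : I) :
    Tendsto (fun K => limitApprox hb K ω t) atTop (𝓝 (limitPath hb ω t)) :=
  tendsto_iff_dist_tendsto_zero.2 <| squeeze_zero (fun _ => dist_nonneg)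
    (fun K => abs_limitApprox_sub_limitPath_le hb h K t)
    (tendsto_sum_nat_add fun m => innovBound b m ω)

lemma measurable_limitApprox (hb : 2 ≤ b) (K : ℕ) : Measurable (limitApprox hb K) :=
  (continuous_stepFun hb K).measurable.comp <| measurable_pi_lambda _ fun _ =>
    Finset.measurable_fun_sum _ fun _ _ => measurable_innov _ _ _

/-- Almost surely the path is a limit, in the Skorokhod metric, of random step functions, each a
continuous image of a measurable vector. -/
lemma aemeasurable_limitPath (hb : 2 ≤ b) : AEMeasurable (limitPath hb) noise :=
  aemeasurable_of_tendsto_metrizable_ae atTop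
    (fun K => (measurable_limitApprox hb K).aemeasurable)
    ((ae_summable_innovBound hb).mono fun _ h => tendsto_limitApprox hb h)

lemma limitApprox_apply_mem_linComb (hb : 2 ≤ b) (K : ℕ) (t : I) :
    (fun ω => limitApprox hb K ω t) ∈ linComb := by
  have : (fun ω => limitApprox hb K ω t) =
      ∑ m ∈ Finset.range K, innov b (m + 1) (cell b (m + 1) t) := by
    ext ω
    rw [limitApprox_apply, Finset.sum_apply]
  rw [this]
  exact linComb.sum_mem fun m _ => innov_mem_linComb _ _ _

lemma aemeasurable_limitPath_apply (hb : 2 ≤ b) (t : I) :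
    AEMeasurable (fun ω => limitPath hb ω t) noise :=
  aemeasurable_of_tendsto_metrizable_ae atTop
    (fun K => (measurable_of_mem_linComb (limitApprox_apply_mem_linComb hb K t)).aemeasurable)
    ((ae_summable_innovBound hb).mono fun _ h => tendsto_limitApprox_apply hb h t)

lemma exists_measure_dist_limitApprox_le (hb : 2 ≤ b) {ε : ℝ} (hε : 0 < ε) :
    ∀ᶠ K in atTop, ∃ s, noise s ≤ ENNReal.ofReal ε ∧
      ∀ ω ∉ s, dist (limitApprox hb K ω) (limitPath hb ω) ≤ ε := by
  have hpos : 0 < ENNReal.ofReal (ε * ε) := ENNReal.ofReal_pos.2 (by positivity)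
  filter_upwards [(tendsto_lintegral_innovTail hb).eventually_le_const hpos] with K hK
  have hm : Measurable (innovTail b K) :=
    Measurable.tsum fun m => (measurable_innovBound b (m + K)).ennreal_ofReal
  have hε' : ENNReal.ofReal ε ≠ 0 := (ENNReal.ofReal_pos.2 hε).ne'
  refine ⟨{ω | ENNReal.ofReal ε ≤ innovTail b K ω}, ?_, fun ω hω => ?_⟩
  · refine (meas_ge_le_lintegral_div hm.aemeasurable hε' ENNReal.ofReal_ne_top).trans ?_
    refine ENNReal.div_le_of_le_mul (hK.trans ?_)
    rw [ENNReal.ofReal_mul hε.le]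
  · have hlt : innovTail b K ω < ENNReal.ofReal ε := by simpa using hω
    have hs := summable_of_innovTail_ne_top hlt.ne_top
    refine (dist_limitApprox_limitPath_le hb hs K).trans ?_
    rw [innovTail, ← ENNReal.ofReal_tsum_of_nonneg (fun m => innovBound_nonneg _ _ _)
      ((summable_nat_add_iff K).2 hs)] at hlt
    exact (ENNReal.ofReal_lt_ofReal_iff hε).1 hlt |>.le

/-! ### Gaussian limits -/

/-- Characteristic functions converge by dominated convergence, and those of centered normal laws
depend continuously on the variance. -/
lemma map_eq_gaussianReal_of_tendsto {Ω : Type*} [MeasurableSpace Ω] {P : Measure Ω}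
    [IsProbabilityMeasure P] {f : ℕ → Ω → ℝ} {g : Ω → ℝ} {v : ℕ → ℝ} {w : ℝ}
    (hf : ∀ K, AEMeasurable (f K) P) (hfg : ∀ᵐ ω ∂P, Tendsto (fun K => f K ω) atTop (𝓝 (g ω)))
    (hmap : ∀ K, P.map (f K) = gaussianReal 0 (v K).toNNReal) (hv : Tendsto v atTop (𝓝 w)) :
    P.map g = gaussianReal 0 w.toNNReal := by
  have hg : AEMeasurable g P := aemeasurable_of_tendsto_metrizable_ae atTop hf hfg
  have : IsProbabilityMeasure (P.map g) := Measure.isProbabilityMeasure_map hg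
  refine Measure.ext_of_charFun (funext fun t => ?_)
  have hchar {h : Ω → ℝ} (hh : AEMeasurable h P) :
      charFun (P.map h) t = ∫ ω, Complex.exp (t * h ω * Complex.I) ∂P := by
    rw [charFun_apply_real, integral_map hh (by fun_prop)]
  have h1 : Tendsto (fun K => charFun (P.map (f K)) t) atTop (𝓝 (charFun (P.map g) t)) := by
    rw [hchar hg]
    simp_rw [fun K => hchar (hf K)]
    refine tendsto_integral_of_dominated_convergence (fun _ => 1) (fun K => ?_)
      (integrable_const _) (fun K => .of_forall fun ω => ?_) ?_
    · exact (Measurable.aemeasurable (by fun_prop : Measurable fun x : ℝ =>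
        Complex.exp (t * x * Complex.I))).comp_aemeasurable (hf K) |>.aestronglyMeasurable
    · rw [← Complex.ofReal_mul, Complex.norm_exp_ofReal_mul_I]
    · filter_upwards [hfg] with ω hω
      exact ((Continuous.tendsto (by fun_prop : Continuous fun x : ℝ =>
        Complex.exp (t * x * Complex.I)) (g ω)).comp hω)
  refine tendsto_nhds_unique h1 ?_
  simp_rw [hmap, charFun_gaussianReal]
  refine (Continuous.tendsto (by fun_prop : Continuous fun u : NNReal =>
    Complex.exp (t * ((0 : ℝ) : ℂ) * Complex.I - (u : ℝ) * t ^ 2 / 2)) _).comp ?_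
  exact (continuous_real_toNNReal.tendsto w).comp hv

lemma map_sum_limitApprox (hb : 2 ≤ b) {ι : Type*} (s : Finset ι) (c : ι → ℝ) (τ : ι → I)
    (K : ℕ) : noise.map (fun ω => ∑ v ∈ s, c v * limitApprox hb K ω (τ v)) =
      gaussianReal 0 (∑ v ∈ s, ∑ w ∈ s, c v * c w *
        pathCov b K (fun k => cell b k (τ v)) fun k => cell b k (τ w)).toNNReal := by
  have hmem : (fun ω => ∑ v ∈ s, c v * limitApprox hb K ω (τ v)) ∈ linComb := by
    have : (fun ω => ∑ v ∈ s, c v * limitApprox hb K ω (τ v)) =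
        ∑ v ∈ s, c v • fun ω => limitApprox hb K ω (τ v) := by
      ext ω
      simp
    rw [this]
    exact linComb.sum_mem fun v _ => linComb.smul_mem _ (limitApprox_apply_mem_linComb hb K _)
  rw [map_of_mem_linComb hmem]
  simp_rw [limitApprox_apply]
  rw [integral_sq_sum_path (b := b) (ξ := innov b) (i := fun v k => cell b k (τ v))
    (fun m i => memLp_of_mem_linComb (innov_mem_linComb b m i))
    (fun m l i j _ _ => by rw [integral_innov_mul_innov hb]; simp) K s c
    fun v m _ => cell_lt hb _ _]

lemma tendsto_sum_pathCov (hb : 2 ≤ b) {ι : Type*} (s : Finset ι) (c : ι → ℝ) (τ : ι → I) :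
    Tendsto (fun K => ∑ v ∈ s, ∑ w ∈ s, c v * c w *
        pathCov b K (fun k => cell b k (τ v)) fun k => cell b k (τ w)) atTop
      (𝓝 (∑ v ∈ s, ∑ w ∈ s, c v * c w * limCov b (τ v) (τ w))) :=
  tendsto_finsetSum _ fun v _ => tendsto_finsetSum _ fun w _ =>
    (tendsto_pathCov hb (τ v) (τ w)).const_mul _

lemma map_sum_limitPath (hb : 2 ≤ b) {ι : Type*} (s : Finset ι) (c : ι → ℝ) (τ : ι → I) :
    noise.map (fun ω => ∑ v ∈ s, c v * limitPath hb ω (τ v)) =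
      gaussianReal 0 (∑ v ∈ s, ∑ w ∈ s, c v * c w * limCov b (τ v) (τ w)).toNNReal := by
  refine map_eq_gaussianReal_of_tendsto (f := fun K ω => ∑ v ∈ s, c v * limitApprox hb K ω (τ v))
    (fun K => ?_) ?_ (fun K => map_sum_limitApprox hb s c τ K) (tendsto_sum_pathCov hb s c τ)
  · exact Finset.aemeasurable_fun_sum _ fun v _ => (measurable_of_mem_linComb
      (limitApprox_apply_mem_linComb hb K (τ v))).aemeasurable.const_mul _
  · filter_upwards [ae_summable_innovBound hb] with ω hω
    exact tendsto_finsetSum _ fun v _ => (tendsto_limitApprox_apply hb hω (τ v)).const_mul _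

lemma isGaussianProcess_limitPath (hb : 2 ≤ b) :
    IsGaussianProcess (fun (t : I) ω => limitPath hb ω t) noise where
  hasGaussianLaw s := by
    have hm : AEMeasurable (fun ω => s.restrict fun t => limitPath hb ω t) noise :=
      aemeasurable_pi_lambda _ fun t => aemeasurable_limitPath_apply hb t
    -- A linear functional of the finite-dimensional marginal is the combination with coefficients
    -- `L (Pi.single v 1)`, whose law is given by `map_sum_limitPath`.
    refine ⟨isGaussian_of_map_eq_gaussianReal fun L => ⟨0, (∑ v : s, ∑ w : s,
      L (Pi.single v 1) * L (Pi.single w 1) * limCov b (v : I) (w : I)).toNNReal, ?_⟩⟩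
    · rw [AEMeasurable.map_map_of_aemeasurable (by fun_prop) hm,
        ← map_sum_limitPath hb Finset.univ (fun v : s => L (Pi.single v 1)) fun v => v]
      congr 1
      ext ω
      simp only [Function.comp_apply]
      refine (L.toLinearMap.pi_apply_eq_sum_univ _).trans ?_
      refine Finset.sum_congr rfl fun v _ => ?_
      have hv : (fun j : s => if v = j then (1 : ℝ) else 0) = Pi.single v 1 := by
        ext w
        simp [Pi.single_apply, eq_comm]
      rw [smul_eq_mul, mul_comm, hv]
      rfl

lemma integral_limitPath (hb : 2 ≤ b) (t : I) : ∫ ω, limitPath hb ω t ∂noise = 0 := by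
  have h := map_sum_limitPath hb {()} (fun _ => 1) fun _ => t
  simp only [Finset.sum_singleton, one_mul] at h
  have := integral_map (aemeasurable_limitPath_apply hb t) (f := fun x : ℝ => x) (by fun_prop)
  rw [← this, h, integral_id_gaussianReal]

lemma memLp_limitPath (hb : 2 ≤ b) (t : I) : MemLp (fun ω => limitPath hb ω t) 2 noise :=
  ((isGaussianProcess_limitPath hb).hasGaussianLaw_eval t).memLp (by simp)

lemma integral_sq_gaussianReal (v : NNReal) : ∫ x, x ^ 2 ∂gaussianReal 0 v = v := by
  have h := variance_fun_id_gaussianReal (μ := 0) (v := v)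
  rw [variance_eq_integral measurable_id'.aemeasurable] at h
  simpa [integral_id_gaussianReal] using h

lemma integral_sq_sum_limitPath (hb : 2 ≤ b) {ι : Type*} (s : Finset ι) (c : ι → ℝ) (τ : ι → I) :
    ∫ ω, (∑ v ∈ s, c v * limitPath hb ω (τ v)) ^ 2 ∂noise =
      ∑ v ∈ s, ∑ w ∈ s, c v * c w * limCov b (τ v) (τ w) := by
  have hm : AEMeasurable (fun ω => ∑ v ∈ s, c v * limitPath hb ω (τ v)) noise :=
    Finset.aemeasurable_fun_sum _ fun v _ => (aemeasurable_limitPath_apply hb _).const_mul _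
  have := integral_map hm (f := fun x : ℝ => x ^ 2) (by fun_prop)
  rw [← this, map_sum_limitPath, integral_sq_gaussianReal, Real.coe_toNNReal]
  -- The variance parameter was truncated by `toNNReal`, so nonnegativity of the quadratic form is
  -- needed; it is a limit of second moments.
  refine ge_of_tendsto' (tendsto_sum_pathCov hb s c τ) fun K => ?_
  have h := integral_sq_sum_path (b := b) (ξ := innov b) (i := fun v k => cell b k (τ v))
    (fun m i => memLp_of_mem_linComb (innov_mem_linComb b m i))
    (fun m l i j _ _ => by rw [integral_innov_mul_innov hb]; simp) K s c
    fun v m _ => cell_lt hb _ _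
  rw [← h]
  exact integral_nonneg fun ω => by positivity

lemma limCov_comm (b : ℕ) (s t : I) : limCov b s t = limCov b t s := by
  simp only [limCov, prefixLength, eq_comm]

/-- Polarization of the second moments of `G s`, `G t` and `G s + G t`. -/
lemma integral_limitPath_mul_limitPath (hb : 2 ≤ b) (s t : I) :
    ∫ ω, limitPath hb ω s * limitPath hb ω t ∂noise = limCov b s t := by
  have h2 := integral_sq_sum_limitPath hb Finset.univ (fun _ : Bool => 1) fun i => if i then s else t
  have hs := integral_sq_sum_limitPath hb {()} (fun _ => 1) fun _ => s
  have ht := integral_sq_sum_limitPath hb {()} (fun _ => 1) fun _ => t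
  simp only [Fintype.sum_bool, Finset.sum_singleton, one_mul, if_true, Bool.false_eq_true,
    if_false] at h2 hs ht
  have is := (memLp_limitPath hb s).integrable_sq
  have it := (memLp_limitPath hb t).integrable_sq
  have ist : Integrable (fun ω => limitPath hb ω s * limitPath hb ω t) noise :=
    (memLp_limitPath hb s).integrable_mul (memLp_limitPath hb t)
  have e (ω : ℕ × ℕ → ℝ) : (limitPath hb ω s + limitPath hb ω t) ^ 2 =
      limitPath hb ω s ^ 2 + limitPath hb ω t ^ 2 +
        2 * (limitPath hb ω s * limitPath hb ω t) := by ring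
  have isum : Integrable (fun ω => limitPath hb ω s ^ 2 + limitPath hb ω t ^ 2) noise := is.add it
  simp_rw [e] at h2
  rw [integral_add isum (ist.const_mul 2), integral_add is it, integral_const_mul, hs, ht,
    limCov_comm b t s] at h2
  linarith

end

section

/-! ### Uniformly distributed data -/

variable {b : ℕ}

/-- The uniform distribution on `[0,1]`. -/
def unif : Measure ℝ := volume.restrict (Set.Icc 0 1)

instance : IsProbabilityMeasure unif := ⟨by simp [unif]⟩

lemma measurable_cell (b k : ℕ) : Measurable (cell b k) :=
  (Nat.measurable_floor.comp (measurable_id.mul_const _)).min measurable_const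

lemma unif_cell (hb : 2 ≤ b) {k i : ℕ} (hi : i < b ^ k) :
    unif.real {u | cell b k u = i} = ((b : ℝ) ^ k)⁻¹ := by
  have hp : (0 : ℝ) < (b : ℝ) ^ k := by positivity
  have hi' : (i : ℝ) + 1 ≤ (b : ℝ) ^ k := by exact_mod_cast hi
  set J := Set.Ico (i / (b : ℝ) ^ k) ((i + 1) / (b : ℝ) ^ k) with hJ
  have hae : {u | cell b k u = i} =ᵐ[unif] J := by
    have h1 : ∀ᵐ u ∂unif, u ∈ Set.Icc (0 : ℝ) 1 := ae_restrict_mem measurableSet_Icc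
    have h2 : ∀ᵐ u ∂unif, u ≠ 1 := by
      refine ae_restrict_of_ae ?_
      simp [ae_iff]
    filter_upwards [h1, h2] with u hu hu1
    have hu1 : u < 1 := lt_of_le_of_ne hu.2 hu1
    have hlt : ⌊u * (b : ℝ) ^ k⌋₊ < b ^ k := by
      rw [Nat.floor_lt (mul_nonneg hu.1 hp.le)]
      push_cast
      nlinarith
    have hcell : cell b k u = ⌊u * (b : ℝ) ^ k⌋₊ := min_eq_left (by omega)
    refine propext ?_
    change cell b k u = i ↔ u ∈ J
    rw [hcell, Nat.floor_eq_iff (mul_nonneg hu.1 hp.le), hJ, Set.mem_Ico, div_le_iff₀ hp,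
      lt_div_iff₀ hp]
  have hsub : J ∩ Set.Icc 0 1 = J := by
    refine Set.inter_eq_left.2 fun u hu => ⟨?_, ?_⟩
    · exact le_trans (by positivity) hu.1
    · exact hu.2.le.trans ((div_le_one hp).2 hi')
  rw [measureReal_def, measure_congr hae, unif, Measure.restrict_apply measurableSet_Ico, hsub,
    Real.volume_Ico, ENNReal.toReal_ofReal]
  · field_simp
    ring
  · rw [← sub_div]
    apply div_nonneg _ hp.le
    linarith

/-- The indicator function of cell `i` of level `k`. -/
def cellInd (b k i : ℕ) (u : ℝ) : ℝ := if cell b k u = i then 1 else 0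

lemma measurable_cellInd (b k i : ℕ) : Measurable (cellInd b k i) :=
  (measurable_from_top (f := fun a : ℕ => if a = i then (1 : ℝ) else 0)).comp (measurable_cell b k)

lemma cellInd_nonneg (b k i : ℕ) (u : ℝ) : 0 ≤ cellInd b k i u := by
  unfold cellInd; split_ifs <;> norm_num

lemma cellInd_le_one (b k i : ℕ) (u : ℝ) : cellInd b k i u ≤ 1 := by
  unfold cellInd; split_ifs <;> norm_num

lemma memLp_cellInd (b k i : ℕ) : MemLp (cellInd b k i) 2 unif :=
  MemLp.of_bound (measurable_cellInd b k i).aestronglyMeasurable 1 (.of_forall fun u => by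
    rw [Real.norm_eq_abs, abs_of_nonneg (cellInd_nonneg _ _ _ _)]
    exact cellInd_le_one _ _ _ _)

lemma integral_cellInd (hb : 2 ≤ b) {k i : ℕ} (hi : i < b ^ k) :
    ∫ u, cellInd b k i u ∂unif = ((b : ℝ) ^ k)⁻¹ := by
  have hs : MeasurableSet {u | cell b k u = i} := measurable_cell b k (measurableSet_singleton i)
  have : cellInd b k i = {u | cell b k u = i}.indicator fun _ => (1 : ℝ) := by
    ext u
    simp [cellInd, Set.indicator]
  rw [this, integral_indicator_const _ hs, unif_cell hb hi, smul_eq_mul, mul_one]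

/-- Cells of two levels are nested or disjoint, according to whether `p` is the ancestor of `q`. -/
lemma cellInd_mul_cellInd (hb : 2 ≤ b) {k l : ℕ} (hkl : k ≤ l) (p q : ℕ) (u : ℝ) :
    cellInd b k p u * cellInd b l q u =
      (if q / b ^ (l - k) = p then 1 else 0) * cellInd b l q u := by
  have h := cell_div_pow hb k (l - k) u
  rw [Nat.add_sub_cancel' hkl] at h
  unfold cellInd
  rw [← h]
  by_cases hq : cell b l u = q
  · simp [hq]
  · simp [hq]

lemma integral_cellInd_mul_cellInd (hb : 2 ≤ b) {k l : ℕ} (hkl : k ≤ l) (p : ℕ) {q : ℕ}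
    (hq : q < b ^ l) : ∫ u, cellInd b k p u * cellInd b l q u ∂unif =
      (if q / b ^ (l - k) = p then 1 else 0) * ((b : ℝ) ^ l)⁻¹ := by
  simp_rw [cellInd_mul_cellInd hb hkl]
  rw [integral_const_mul, integral_cellInd hb hq]

/-- The contribution of a datum to the innovation in cell `i` of level `m`. -/
def dataInnov (b m i : ℕ) (u : ℝ) : ℝ :=
  (b : ℝ) / ((b : ℝ) - 1) * (cellInd b m i u - (b : ℝ)⁻¹ * cellInd b (m - 1) (i / b) u)

lemma memLp_dataInnov (b m i : ℕ) : MemLp (dataInnov b m i) 2 unif :=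
  ((memLp_cellInd b m i).sub ((memLp_cellInd b (m - 1) (i / b)).const_mul _)).const_mul _

lemma measurable_dataInnov (b m i : ℕ) : Measurable (dataInnov b m i) :=
  ((measurable_cellInd b m i).sub ((measurable_cellInd b (m - 1) (i / b)).const_mul _)).const_mul _

/-- The martingale property: a cell of level at most `l` either contains the parent of `j`, of which
the child `j` has the share `1 / b`, or is disjoint from it. -/
lemma integral_cellInd_mul_dataInnov (hb : 2 ≤ b) {k l : ℕ} (hkl : k ≤ l) (p : ℕ) {j : ℕ}
    (hj : j < b ^ (l + 1)) : ∫ u, cellInd b k p u * dataInnov b (l + 1) j u ∂unif = 0 := by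
  have hj' : j / b < b ^ l := Nat.div_lt_of_lt_mul (by rwa [← pow_succ'])
  have e (u : ℝ) : cellInd b k p u * dataInnov b (l + 1) j u =
      (b : ℝ) / ((b : ℝ) - 1) * (cellInd b k p u * cellInd b (l + 1) j u -
        (b : ℝ)⁻¹ * (cellInd b k p u * cellInd b l (j / b) u)) := by
    rw [dataInnov, Nat.add_sub_cancel]; ring
  have i1 : Integrable (fun u => cellInd b k p u * cellInd b (l + 1) j u) unif :=
    (memLp_cellInd b k p).integrable_mul (memLp_cellInd b (l + 1) j)
  have i2 : Integrable (fun u => cellInd b k p u * cellInd b l (j / b) u) unif :=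
    (memLp_cellInd b k p).integrable_mul (memLp_cellInd b l (j / b))
  simp_rw [e]
  rw [integral_const_mul, integral_sub i1 (i2.const_mul _), integral_const_mul,
    integral_cellInd_mul_cellInd hb (by omega) p hj, integral_cellInd_mul_cellInd hb hkl p hj',
    Nat.div_div_eq_div_mul, ← pow_succ', show l + 1 - k = l - k + 1 by omega, pow_succ (b : ℝ) l,
    mul_inv]
  ring

lemma integral_dataInnov (hb : 2 ≤ b) (m : ℕ) {i : ℕ} (hi : i < b ^ (m + 1)) :
    ∫ u, dataInnov b (m + 1) i u ∂unif = 0 := by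
  have := integral_cellInd_mul_dataInnov hb (Nat.zero_le m) 0 hi
  simpa [cellInd] using this

lemma integral_dataInnov_mul_dataInnov_of_lt (hb : 2 ≤ b) {m l : ℕ} (hml : m < l) (i : ℕ) {j : ℕ}
    (hj : j < b ^ (l + 1)) : ∫ u, dataInnov b (m + 1) i u * dataInnov b (l + 1) j u ∂unif = 0 := by
  have e (u : ℝ) : dataInnov b (m + 1) i u * dataInnov b (l + 1) j u =
      (b : ℝ) / ((b : ℝ) - 1) * (cellInd b (m + 1) i u * dataInnov b (l + 1) j u -
        (b : ℝ)⁻¹ * (cellInd b m (i / b) u * dataInnov b (l + 1) j u)) := by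
    rw [dataInnov, Nat.add_sub_cancel]; ring
  have i1 : Integrable (fun u => cellInd b (m + 1) i u * dataInnov b (l + 1) j u) unif :=
    (memLp_cellInd b (m + 1) i).integrable_mul (memLp_dataInnov b (l + 1) j)
  have i2 : Integrable (fun u => cellInd b m (i / b) u * dataInnov b (l + 1) j u) unif :=
    (memLp_cellInd b m (i / b)).integrable_mul (memLp_dataInnov b (l + 1) j)
  simp_rw [e]
  rw [integral_const_mul, integral_sub i1 (i2.const_mul _), integral_const_mul,
    integral_cellInd_mul_dataInnov hb hml i hj, integral_cellInd_mul_dataInnov hb hml.le _ hj]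
  ring

lemma integral_dataInnov_mul_dataInnov (hb : 2 ≤ b) (m l i j : ℕ) (hi : i < b ^ (m + 1))
    (hj : j < b ^ (l + 1)) :
    ∫ u, dataInnov b (m + 1) i u * dataInnov b (l + 1) j u ∂unif =
      if m = l then innovCov b (m + 1) i j else 0 := by
  rcases lt_trichotomy m l with hml | rfl | hml
  · rw [integral_dataInnov_mul_dataInnov_of_lt hb hml i hj, if_neg hml.ne]
  · have hj' : j / b < b ^ m := Nat.div_lt_of_lt_mul (by rwa [← pow_succ'])
    -- Only the first factor's own cell indicator is multiplied out; the part with its parent's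
    -- indicator is orthogonal to the innovation in `j`.
    have e (u : ℝ) : dataInnov b (m + 1) i u * dataInnov b (m + 1) j u =
        ((b : ℝ) / ((b : ℝ) - 1)) ^ 2 * (cellInd b (m + 1) i u * cellInd b (m + 1) j u -
          (b : ℝ)⁻¹ * (cellInd b m (j / b) u * cellInd b (m + 1) i u)) -
        (b : ℝ) / ((b : ℝ) - 1) * (b : ℝ)⁻¹ *
          (cellInd b m (i / b) u * dataInnov b (m + 1) j u) := by
      simp only [dataInnov, Nat.add_sub_cancel]; ring
    have i1 : Integrable (fun u => cellInd b (m + 1) i u * cellInd b (m + 1) j u) unif :=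
      (memLp_cellInd b (m + 1) i).integrable_mul (memLp_cellInd b (m + 1) j)
    have i2 : Integrable (fun u => cellInd b m (j / b) u * cellInd b (m + 1) i u) unif :=
      (memLp_cellInd b m (j / b)).integrable_mul (memLp_cellInd b (m + 1) i)
    have i3 : Integrable (fun u => cellInd b m (i / b) u * dataInnov b (m + 1) j u) unif :=
      (memLp_cellInd b m (i / b)).integrable_mul (memLp_dataInnov b (m + 1) j)
    have i4 : Integrable (fun u => ((b : ℝ) / ((b : ℝ) - 1)) ^ 2 *
        (cellInd b (m + 1) i u * cellInd b (m + 1) j u -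
          (b : ℝ)⁻¹ * (cellInd b m (j / b) u * cellInd b (m + 1) i u))) unif :=
      (i1.sub (i2.const_mul _)).const_mul _
    simp_rw [e]
    rw [integral_sub i4 (i3.const_mul _), integral_const_mul, integral_const_mul,
      integral_sub i1 (i2.const_mul _), integral_const_mul,
      integral_cellInd_mul_cellInd hb le_rfl i hj, integral_cellInd_mul_cellInd hb (by omega) _ hi,
      integral_cellInd_mul_dataInnov hb le_rfl _ hj, if_pos trivial, innovCov, Nat.sub_self, pow_zero,
      Nat.div_one, Nat.add_sub_cancel_left, pow_one]
    by_cases h : i / b = j / b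
    · by_cases h' : i = j
      · subst h'
        simp only [if_true]
        ring
      · simp only [h, h', Ne.symm h', if_true, if_false]
        ring
    · have : j ≠ i := fun e => h (by rw [e])
      simp [h, this]
  · simp_rw [mul_comm (dataInnov b (m + 1) i _)]
    rw [integral_dataInnov_mul_dataInnov_of_lt hb hml j hi, if_neg (ne_of_gt hml)]

/-! ### The multivariate central limit theorem for the innovations -/

/-- The one-dimensional central limit theorem for standardized `h`, evaluated at `√v`. Variance zero
is treated separately, since it does occur: the innovations of all siblings add up to zero. -/
lemma tendsto_charFun_map_pow {Ω : Type*} [MeasurableSpace Ω] {P : Measure Ω}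
    [IsProbabilityMeasure P] {h : Ω → ℝ} (hh : MemLp h 2 P) (h0 : ∫ ω, h ω ∂P = 0) :
    Tendsto (fun n : ℕ => charFun (P.map h) (√n)⁻¹ ^ n) atTop
      (𝓝 (Complex.exp (-(∫ ω, h ω ^ 2 ∂P : ℝ) / 2))) := by
  have hm := hh.aestronglyMeasurable.aemeasurable
  set v := ∫ ω, h ω ^ 2 ∂P with hv
  have hv0 : 0 ≤ v := integral_nonneg fun ω => by positivity
  rcases hv0.eq_or_lt with hz | hpos
  · have hae : h =ᵐ[P] fun _ => 0 := by
      have := (integral_eq_zero_iff_of_nonneg (fun ω => by positivity) hh.integrable_sq).1 hz.symm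
      filter_upwards [this] with ω hω
      simpa using hω
    rw [Measure.map_congr hae, ← hz]
    simp
  · have hs : √v ≠ 0 := (Real.sqrt_pos.2 hpos).ne'
    have h1 : P[fun ω => (√v)⁻¹ * h ω] = 0 := by rw [integral_const_mul, h0, mul_zero]
    have h2 : P[(fun ω => (√v)⁻¹ * h ω) ^ 2] = 1 := by
      simp only [Pi.pow_apply, mul_pow]
      rw [integral_const_mul, ← hv, inv_pow, Real.sq_sqrt hv0, inv_mul_cancel₀ hpos.ne']
    have := tendsto_charFun_inv_sqrt_mul_pow (hm.const_mul _) h1 h2 √v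
    convert! this using 2 with n
    · rw [charFun_map_mul_comp hm]
      congr 2
      field_simp
    · rw [← Complex.ofReal_pow, Real.sq_sqrt hv0]

end

/-! ### Convergence in distribution for a fixed number of levels -/

section

variable {b : ℕ}

/-- The law of `n` independent data, uniformly distributed on `[0,1]`. -/
abbrev dataLaw (n : ℕ) : Measure (Fin n → ℝ) := Measure.pi fun _ => unif

/-- The normalized sum of the contributions of the data to the innovations of the first `K` levels,
along the path that leads to cell `v` of level `K`. -/
def dataVec (b K : ℕ) {n : ℕ} (x : Fin n → ℝ) (v : Fin (b ^ K)) : ℝ :=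
  ∑ m ∈ Finset.range K, (√n)⁻¹ * ∑ j, dataInnov b (m + 1) (v / b ^ (K - (m + 1))) (x j)

/-- The sum of the Gaussian innovations of the first `K` levels, along the path that leads to cell
`v` of level `K`. -/
def innovVec (b K : ℕ) (ω : ℕ × ℕ → ℝ) (v : Fin (b ^ K)) : ℝ :=
  ∑ m ∈ Finset.range K, innov b (m + 1) (v / b ^ (K - (m + 1))) ω

lemma measurable_dataVec (b K n : ℕ) : Measurable (dataVec b K : (Fin n → ℝ) → _) :=
  measurable_pi_lambda _ fun _ => Finset.measurable_fun_sum _ fun _ _ =>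
    (Finset.measurable_fun_sum _ fun j _ =>
      (measurable_dataInnov _ _ _).comp (measurable_pi_apply j)).const_mul _

lemma measurable_innovVec (b K : ℕ) : Measurable (innovVec b K) :=
  measurable_pi_lambda _ fun _ => Finset.measurable_fun_sum _ fun _ _ => measurable_innov _ _ _

lemma ancestor_lt {K : ℕ} (v : Fin (b ^ K)) {m : ℕ} (hm : m < K) :
    v / b ^ (K - (m + 1)) < b ^ (m + 1) := by
  refine Nat.div_lt_of_lt_mul ?_
  rw [← pow_add, Nat.sub_add_cancel hm]
  exact v.2

/-- Characteristic functions in `ℝ^ι` in terms of linear combinations of the coordinates. -/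
lemma charFun_map_toLp {Ω ι : Type*} [Fintype ι] [MeasurableSpace Ω] {P : Measure Ω}
    {f : Ω → ι → ℝ} (hf : Measurable f) (c : EuclideanSpace ℝ ι) :
    charFun (P.map fun ω => WithLp.toLp 2 (f ω)) c =
      ∫ ω, Complex.exp ((∑ v, c v * f ω v : ℝ) * Complex.I) ∂P := by
  have hm : Measurable fun ω => WithLp.toLp 2 (f ω) :=
    (PiLp.continuous_toLp 2 _).measurable.comp hf
  rw [charFun_apply, integral_map hm.aemeasurable (by fun_prop)]
  simp [PiLp.inner_apply]

lemma integral_exp_sum_dataLaw {h : ℝ → ℝ} (hh : Measurable h) (n : ℕ) :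
    ∫ x, Complex.exp (((√n)⁻¹ * ∑ j, h (x j) : ℝ) * Complex.I) ∂dataLaw n =
      charFun (unif.map h) (√n)⁻¹ ^ n := by
  have e (x : Fin n → ℝ) : Complex.exp (((√n)⁻¹ * ∑ j, h (x j) : ℝ) * Complex.I) =
      ∏ j, Complex.exp (((√n)⁻¹ : ℝ) * h (x j) * Complex.I) := by
    rw [← Complex.exp_sum, ← Finset.sum_mul, ← Finset.mul_sum]
    push_cast
    rfl
  simp_rw [e]
  rw [integral_fintype_prod_eq_pow (fun u => Complex.exp (((√n)⁻¹ : ℝ) * h u * Complex.I)),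
    Fintype.card_fin, charFun_apply_real, integral_map hh.aemeasurable (by fun_prop)]

/-- The linear combination of the contributions of a datum. -/
def dataForm (b K : ℕ) (c : Fin (b ^ K) → ℝ) (u : ℝ) : ℝ :=
  ∑ v, c v * ∑ m ∈ Finset.range K, dataInnov b (m + 1) (v / b ^ (K - (m + 1))) u

lemma memLp_dataForm (b K : ℕ) (c : Fin (b ^ K) → ℝ) : MemLp (dataForm b K c) 2 unif :=
  memLp_finsetSum _ fun _ _ => (memLp_finsetSum _ fun _ _ => memLp_dataInnov _ _ _).const_mul _

lemma measurable_dataForm (b K : ℕ) (c : Fin (b ^ K) → ℝ) : Measurable (dataForm b K c) :=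
  Finset.measurable_fun_sum _ fun _ _ => (Finset.measurable_fun_sum _ fun _ _ =>
    measurable_dataInnov _ _ _).const_mul _

lemma integral_dataForm (hb : 2 ≤ b) (K : ℕ) (c : Fin (b ^ K) → ℝ) :
    ∫ u, dataForm b K c u ∂unif = 0 := by
  have hint (m i : ℕ) : Integrable (dataInnov b m i) unif :=
    (memLp_dataInnov b m i).integrable (by norm_num)
  unfold dataForm
  rw [integral_finsetSum _ fun v _ => (integrable_finsetSum _ fun m _ => hint _ _).const_mul _]
  refine Finset.sum_eq_zero fun v _ => ?_
  rw [integral_const_mul, integral_finsetSum _ fun m _ => hint _ _, Finset.sum_eq_zero, mul_zero]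
  exact fun m hm => integral_dataInnov hb m (ancestor_lt v (Finset.mem_range.1 hm))

lemma sum_mul_dataVec (b K : ℕ) {n : ℕ} (x : Fin n → ℝ) (c : Fin (b ^ K) → ℝ) :
    ∑ v, c v * dataVec b K x v = (√n)⁻¹ * ∑ j, dataForm b K c (x j) := by
  unfold dataForm dataVec
  rw [Finset.sum_comm, Finset.mul_sum]
  refine Finset.sum_congr rfl fun v _ => ?_
  rw [← Finset.mul_sum, ← Finset.mul_sum, Finset.sum_comm]
  ring

/-- Both quadratic forms are computed by `integral_sq_sum_path` from the same covariances, so the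
Gaussian variance equals that of one datum's contribution. -/
lemma integral_exp_sum_innovVec (hb : 2 ≤ b) (K : ℕ) (c : Fin (b ^ K) → ℝ) :
    ∫ ω, Complex.exp ((∑ v, c v * innovVec b K ω v : ℝ) * Complex.I) ∂noise =
      Complex.exp (-(∫ u, dataForm b K c u ^ 2 ∂unif : ℝ) / 2) := by
  have hmem : (fun ω => ∑ v, c v * innovVec b K ω v) ∈ linComb := by
    have : (fun ω => ∑ v, c v * innovVec b K ω v) =
        ∑ v, c v • ∑ m ∈ Finset.range K, innov b (m + 1) (v / b ^ (K - (m + 1))) := by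
      ext ω
      simp [innovVec]
    rw [this]
    exact linComb.sum_mem fun v _ => linComb.smul_mem _
      (linComb.sum_mem fun m _ => innov_mem_linComb _ _ _)
  have h1 : ∫ ω, (∑ v, c v * innovVec b K ω v) ^ 2 ∂noise = ∫ u, dataForm b K c u ^ 2 ∂unif := by
    unfold innovVec dataForm
    rw [integral_sq_sum_path (b := b) (ξ := innov b)
        (i := fun (v : Fin (b ^ K)) k => v / b ^ (K - k))
        (fun m i => memLp_of_mem_linComb (innov_mem_linComb b m i))
        (fun m l i j _ _ => by rw [integral_innov_mul_innov hb]; simp) K _ c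
        fun v m hm => ancestor_lt v hm,
      integral_sq_sum_path (b := b) (ξ := dataInnov b)
        (i := fun (v : Fin (b ^ K)) k => v / b ^ (K - k)) (fun m i => memLp_dataInnov b m i)
        (integral_dataInnov_mul_dataInnov hb) K _ c fun v m hm => ancestor_lt v hm]
  have h2 : charFun (noise.map fun ω => ∑ v, c v * innovVec b K ω v) 1 =
      ∫ ω, Complex.exp ((∑ v, c v * innovVec b K ω v : ℝ) * Complex.I) ∂noise := by
    rw [charFun_apply_real, integral_map (measurable_of_mem_linComb hmem).aemeasurable
      (by fun_prop)]
    simp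
  have hpos : 0 ≤ ∫ u, dataForm b K c u ^ 2 ∂unif := integral_nonneg fun u => by positivity
  rw [← h2, map_of_mem_linComb hmem, h1, charFun_gaussianReal, Real.coe_toNNReal _ hpos]
  congr 1
  push_cast
  ring

/-- By Lévy's continuity theorem and reduction to linear combinations. The detour through
`EuclideanSpace` provides the inner product used by characteristic functions. -/
theorem tendstoInDistribution_dataVec (hb : 2 ≤ b) (K : ℕ) :
    TendstoInDistribution (fun n (x : Fin n → ℝ) => dataVec b K x) atTop (innovVec b K)
      dataLaw noise := by
  have hcont := PiLp.continuous_toLp 2 fun _ : Fin (b ^ K) => ℝ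
  have h : TendstoInDistribution
      (fun n (x : Fin n → ℝ) => (WithLp.toLp 2 (dataVec b K x) : EuclideanSpace ℝ (Fin (b ^ K))))
      atTop (fun ω => (WithLp.toLp 2 (innovVec b K ω) : EuclideanSpace ℝ (Fin (b ^ K))))
      dataLaw noise :=
    { forall_aemeasurable n := (hcont.measurable.comp (measurable_dataVec b K n)).aemeasurable
      aemeasurable_limit := (hcont.measurable.comp (measurable_innovVec b K)).aemeasurable
      tendsto := by
        refine ProbabilityMeasure.tendsto_iff_tendsto_charFun.2 fun c => ?_
        simp only [ProbabilityMeasure.coe_mk]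
        rw [charFun_map_toLp (measurable_innovVec b K), integral_exp_sum_innovVec hb]
        simp_rw [fun n => charFun_map_toLp (P := dataLaw n) (measurable_dataVec b K n),
          sum_mul_dataVec, fun n => integral_exp_sum_dataLaw (measurable_dataForm b K c) n]
        exact tendsto_charFun_map_pow (memLp_dataForm b K c) (integral_dataForm hb K c) }
  exact h.continuous_comp (PiLp.continuous_ofLp 2 _)

/-- The approximation of the normalized process that takes only the first `K` levels into
account. -/
def dataApprox (hb : 2 ≤ b) (K : ℕ) {n : ℕ} (x : Fin n → ℝ) : Cadlag := stepFun hb K (dataVec b K x)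

theorem tendstoInDistribution_dataApprox (hb : 2 ≤ b) (K : ℕ) :
    TendstoInDistribution (fun n (x : Fin n → ℝ) => dataApprox hb K x) atTop (limitApprox hb K)
      dataLaw noise :=
  (tendstoInDistribution_dataVec hb K).continuous_comp (continuous_stepFun hb K)

end

section

/-! ### Moments of the occupation numbers -/

section Moments

variable {Ω ι : Type*} [MeasurableSpace Ω] {P : Measure Ω} [IsProbabilityMeasure P]

/-- Induction on the number of summands: in the expansion of `(S + η) ^ 4` the terms with a first
power of `S` or `η` vanish, leaving `S ^ 4`, `6 * S ^ 2 * η ^ 2` and `η ^ 4`, and `η ^ 4 ≤ η ^ 2`.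
-/
lemma integral_pow_sum_of_indep {η : ι → Ω → ℝ} (hη : ∀ i, Measurable (η i))
    (hind : iIndepFun η P) (hbd : ∀ i ω, |η i ω| ≤ 1) (h0 : ∀ i, ∫ ω, η i ω ∂P = 0) {q : ℝ}
    (hq : ∀ i, ∫ ω, η i ω ^ 2 ∂P = q) (s : Finset ι) :
    ∫ ω, (∑ i ∈ s, η i ω) ^ 2 ∂P = s.card * q ∧
      ∫ ω, (∑ i ∈ s, η i ω) ^ 4 ∂P ≤ s.card * q + 3 * (s.card * q) ^ 2 := by
  classical
  induction s using Finset.induction_on with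
  | empty => simp
  | insert a s ha ih =>
    obtain ⟨ih2, ih4⟩ := ih
    set S : Ω → ℝ := fun ω => ∑ i ∈ s, η i ω with hS
    change ∫ ω, S ω ^ 2 ∂P = _ at ih2
    have hSm : Measurable S := Finset.measurable_fun_sum _ fun i _ => hη i
    have hSbd (ω : Ω) : |S ω| ≤ s.card := by
      refine (Finset.abs_sum_le_sum_abs _ _).trans ?_
      simpa using Finset.sum_le_sum fun i (_ : i ∈ s) => hbd i ω
    have hSη : IndepFun S (η a) P := by
      have := hind.indepFun_finsetSum_of_notMem hη ha
      have e : (∑ j ∈ s, η j) = S := by ext ω; simp [hS]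
      rwa [e] at this
    have hint (k l : ℕ) : Integrable (fun ω => S ω ^ k * η a ω ^ l) P := by
      refine Integrable.of_bound ((hSm.pow_const k).mul ((hη a).pow_const l)).aestronglyMeasurable
        ((s.card : ℝ) ^ k) (.of_forall fun ω => ?_)
      rw [Real.norm_eq_abs, abs_mul, abs_pow, abs_pow]
      calc |S ω| ^ k * |η a ω| ^ l ≤ (s.card : ℝ) ^ k * 1 := by
            gcongr
            · exact hSbd ω
            · exact pow_le_one₀ (abs_nonneg _) (hbd a ω)
        _ = _ := mul_one _
    have hmul (k l : ℕ) : ∫ ω, S ω ^ k * η a ω ^ l ∂P = (∫ ω, S ω ^ k ∂P) * ∫ ω, η a ω ^ l ∂P :=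
      (hSη.comp (measurable_id.pow_const k) (measurable_id.pow_const l)).integral_fun_mul_eq_mul_integral
        (hSm.pow_const k).aestronglyMeasurable ((hη a).pow_const l).aestronglyMeasurable
    have hη1 : ∫ ω, η a ω ^ 1 ∂P = 0 := by simpa using h0 a
    have hS1 : ∫ ω, S ω ^ 1 ∂P = 0 := by
      simp only [pow_one, hS]
      rw [integral_finsetSum _ fun i _ => Integrable.of_bound (hη i).aestronglyMeasurable 1
        (.of_forall fun ω => hbd i ω)]
      exact Finset.sum_eq_zero fun i _ => h0 i
    have hη4 : ∫ ω, η a ω ^ 4 ∂P ≤ q := by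
      rw [← hq a]
      have i2 := hint 0 2
      have i4 := hint 0 4
      simp only [pow_zero, one_mul] at i2 i4
      refine integral_mono i4 i2 fun ω => ?_
      have h1 : η a ω ^ 2 ≤ 1 := by
        rw [← sq_abs]; exact pow_le_one₀ (abs_nonneg _) (hbd a ω)
      have : η a ω ^ 4 = η a ω ^ 2 * η a ω ^ 2 := by ring
      simp only [this]
      nlinarith [sq_nonneg (η a ω)]
    have hq0 : 0 ≤ q := by rw [← hq a]; exact integral_nonneg fun ω => by positivity
    have esum (ω : Ω) : ∑ i ∈ insert a s, η i ω = S ω + η a ω := by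
      rw [Finset.sum_insert ha, add_comm]
    have hcard : ((insert a s).card : ℝ) = s.card + 1 := by
      rw [Finset.card_insert_of_notMem ha]; push_cast; rfl
    simp_rw [esum, hcard]
    constructor
    · have e (ω : Ω) : (S ω + η a ω) ^ 2 =
          S ω ^ 2 * η a ω ^ 0 + (2 * (S ω ^ 1 * η a ω ^ 1) + S ω ^ 0 * η a ω ^ 2) := by ring
      have i1 : Integrable (fun ω => 2 * (S ω ^ 1 * η a ω ^ 1) + S ω ^ 0 * η a ω ^ 2) P :=
        ((hint 1 1).const_mul 2).add (hint 0 2)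
      simp_rw [e]
      rw [integral_add (hint 2 0) i1,
        integral_add ((hint 1 1).const_mul 2) (hint 0 2), integral_const_mul, hmul 1 1, hS1]
      simp only [pow_zero, mul_one, one_mul, zero_mul, mul_zero, zero_add, ih2, hq a]
      ring
    · have e (ω : Ω) : (S ω + η a ω) ^ 4 =
          S ω ^ 4 * η a ω ^ 0 + (4 * (S ω ^ 3 * η a ω ^ 1) + (6 * (S ω ^ 2 * η a ω ^ 2) +
            (4 * (S ω ^ 1 * η a ω ^ 3) + S ω ^ 0 * η a ω ^ 4))) := by ring
      have i4 : Integrable (fun ω => 4 * (S ω ^ 1 * η a ω ^ 3) + S ω ^ 0 * η a ω ^ 4) P :=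
        ((hint 1 3).const_mul 4).add (hint 0 4)
      have i3 : Integrable (fun ω => 6 * (S ω ^ 2 * η a ω ^ 2) +
          (4 * (S ω ^ 1 * η a ω ^ 3) + S ω ^ 0 * η a ω ^ 4)) P :=
        ((hint 2 2).const_mul 6).add i4
      have i2 : Integrable (fun ω => 4 * (S ω ^ 3 * η a ω ^ 1) + (6 * (S ω ^ 2 * η a ω ^ 2) +
          (4 * (S ω ^ 1 * η a ω ^ 3) + S ω ^ 0 * η a ω ^ 4))) P :=
        ((hint 3 1).const_mul 4).add i3
      simp_rw [e]
      rw [integral_add (hint 4 0) i2, integral_add ((hint 3 1).const_mul 4) i3,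
        integral_add ((hint 2 2).const_mul 6) i4, integral_add ((hint 1 3).const_mul 4) (hint 0 4)]
      simp only [integral_const_mul]
      rw [hmul 3 1, hmul 1 3, hmul 2 2, hS1, hη1, ih2, hq a]
      simp only [pow_zero, mul_one, one_mul, zero_mul, mul_zero, zero_add]
      nlinarith [sq_nonneg q]

end Moments

variable {b n : ℕ}

/-- The normalized deviation of the occupation number of cell `i` of level `k` from its mean. -/
def dev (b k : ℕ) {n : ℕ} (x : Fin n → ℝ) (i : ℕ) : ℝ :=
  (count b x k i - n * ((b : ℝ) ^ k)⁻¹) / √n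

lemma count_eq_sum_cellInd (b : ℕ) (x : Fin n → ℝ) (k i : ℕ) :
    (count b x k i : ℝ) = ∑ j, cellInd b k i (x j) := by
  simp [count, cellInd, Finset.sum_boole]

lemma count_sub_eq_sum (b : ℕ) (x : Fin n → ℝ) (k i : ℕ) :
    (count b x k i : ℝ) - n * ((b : ℝ) ^ k)⁻¹ =
      ∑ j, (cellInd b k i (x j) - ((b : ℝ) ^ k)⁻¹) := by
  rw [Finset.sum_sub_distrib, count_eq_sum_cellInd]
  simp

lemma measurable_count (b n k i : ℕ) : Measurable fun x : Fin n → ℝ => (count b x k i : ℝ) := by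
  simp_rw [count_eq_sum_cellInd]
  exact Finset.measurable_fun_sum _ fun j _ => (measurable_cellInd b k i).comp (measurable_pi_apply j)

lemma count_le (b : ℕ) (x : Fin n → ℝ) (k i : ℕ) : count b x k i ≤ n := by
  refine (Finset.card_filter_le _ _).trans ?_
  simp

lemma integrable_count_pow (b n k i r : ℕ) :
    Integrable (fun x : Fin n → ℝ => (count b x k i : ℝ) ^ r) (dataLaw n) :=
  Integrable.of_bound ((measurable_count b n k i).pow_const r).aestronglyMeasurable ((n : ℝ) ^ r)
    (.of_forall fun x => by
      rw [Real.norm_eq_abs, abs_of_nonneg (by positivity)]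
      exact pow_le_pow_left₀ (by positivity) (by exact_mod_cast count_le b x k i) r)

lemma integrable_dev_pow_four (b n k i : ℕ) :
    Integrable (fun x : Fin n → ℝ => dev b k x i ^ 4) (dataLaw n) := by
  have e (x : Fin n → ℝ) : dev b k x i ^ 4 =
      (√n ^ 4)⁻¹ * ((count b x k i : ℝ) ^ 4 -
        4 * (n * ((b : ℝ) ^ k)⁻¹) * (count b x k i : ℝ) ^ 3 +
        6 * (n * ((b : ℝ) ^ k)⁻¹) ^ 2 * (count b x k i : ℝ) ^ 2 -
        4 * (n * ((b : ℝ) ^ k)⁻¹) ^ 3 * (count b x k i : ℝ) ^ 1 + (n * ((b : ℝ) ^ k)⁻¹) ^ 4) := by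
    rw [dev, div_pow]; ring
  simp_rw [e]
  have h (r : ℕ) := integrable_count_pow b n k i r
  exact (((((h 4).sub ((h 3).const_mul _)).add ((h 2).const_mul _)).sub
    ((h 1).const_mul _)).add (integrable_const _)).const_mul _

lemma integral_count_sub_pow (hb : 2 ≤ b) (n : ℕ) {k i : ℕ} (hi : i < b ^ k) :
    ∫ x, ((count b x k i : ℝ) - n * ((b : ℝ) ^ k)⁻¹) ^ 2 ∂dataLaw n =
        n * (((b : ℝ) ^ k)⁻¹ - ((b : ℝ) ^ k)⁻¹ ^ 2) ∧
      ∫ x, ((count b x k i : ℝ) - n * ((b : ℝ) ^ k)⁻¹) ^ 4 ∂dataLaw n ≤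
        n * ((b : ℝ) ^ k)⁻¹ + 3 * (n * ((b : ℝ) ^ k)⁻¹) ^ 2 := by
  set p := ((b : ℝ) ^ k)⁻¹ with hp
  have hb1 : (1 : ℝ) ≤ b := by exact_mod_cast (by omega : 1 ≤ b)
  have hp0 : 0 ≤ p := by positivity
  have hp1 : p ≤ 1 := inv_le_one_of_one_le₀ (one_le_pow₀ hb1)
  have hm : Measurable fun u => cellInd b k i u - p := (measurable_cellInd b k i).sub_const _
  have hI : ∫ u, cellInd b k i u ∂unif = p := integral_cellInd hb hi
  have hint : Integrable (cellInd b k i) unif := (memLp_cellInd b k i).integrable (by norm_num)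
  have h0 : ∫ u, (cellInd b k i u - p) ∂unif = 0 := by
    rw [integral_sub hint (integrable_const _), hI]
    simp
  have h2 : ∫ u, (cellInd b k i u - p) ^ 2 ∂unif = p - p ^ 2 := by
    have e (u : ℝ) : (cellInd b k i u - p) ^ 2 = (1 - 2 * p) * cellInd b k i u + p ^ 2 := by
      have : cellInd b k i u ^ 2 = cellInd b k i u := by unfold cellInd; split_ifs <;> norm_num
      linear_combination this
    simp_rw [e]
    rw [integral_add (hint.const_mul _) (integrable_const _), integral_const_mul, hI]
    simp
    ring
  have hev (j : Fin n) {f : ℝ → ℝ} (hf : Measurable f) :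
      ∫ x, f (x j) ∂dataLaw n = ∫ u, f u ∂unif := by
    have := (measurePreserving_eval (fun _ : Fin n => unif) j).map_eq
    rw [← this, integral_map (measurable_pi_apply j).aemeasurable hf.aestronglyMeasurable]
  have key := integral_pow_sum_of_indep (P := dataLaw n)
    (η := fun (j : Fin n) (x : Fin n → ℝ) => cellInd b k i (x j) - p)
    (fun j => hm.comp (measurable_pi_apply j))
    (iIndepFun_pi (X := fun _ u => cellInd b k i u - p) fun _ => hm.aemeasurable)
    (fun j x => by
      rw [abs_le]
      have h1 := cellInd_nonneg b k i (x j)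
      have h2 := cellInd_le_one b k i (x j)
      constructor <;> linarith)
    (fun j => by rw [hev j hm, h0]) (q := p - p ^ 2)
    (fun j => by rw [hev j (hm.pow_const 2), h2]) Finset.univ
  rw [Finset.card_univ, Fintype.card_fin] at key
  simp only [hp, count_sub_eq_sum] at key ⊢
  refine ⟨key.1, key.2.trans ?_⟩
  rw [← hp]
  have h1 : 0 ≤ p - p ^ 2 := by nlinarith
  have h2 : p - p ^ 2 ≤ p := by nlinarith
  gcongr

/-- With `p = b ^ (-k)` the bound is `p / n + 3 * p ^ 2`. The condition on `k` gives `1 / n ≤ b *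
p`, which makes the Poisson-type term `p / n` comparable to `p ^ 2`. -/
lemma integral_dev_pow_four_le (hb : 2 ≤ b) (hn : 0 < n) {k i : ℕ} (hi : i < b ^ k)
    (hk : b ^ k ≤ b * n) :
    ∫ x, dev b k x i ^ 4 ∂dataLaw n ≤ (b + 3) * (((b : ℝ) ^ k)⁻¹) ^ 2 := by
  have hn' : (0 : ℝ) < n := by exact_mod_cast hn
  have hk' : (b : ℝ) ^ k ≤ b * n := by exact_mod_cast hk
  have hpos : (0 : ℝ) < (b : ℝ) ^ k := by positivity
  have e (x : Fin n → ℝ) : dev b k x i ^ 4 =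
      ((n : ℝ) ^ 2)⁻¹ * ((count b x k i : ℝ) - n * ((b : ℝ) ^ k)⁻¹) ^ 4 := by
    have : √(n : ℝ) ^ 4 = (n : ℝ) ^ 2 := by
      rw [show (4 : ℕ) = 2 * 2 from rfl, pow_mul, Real.sq_sqrt hn'.le]
    rw [dev, div_pow, this]; ring
  simp_rw [e]
  rw [integral_const_mul]
  refine (mul_le_mul_of_nonneg_left (integral_count_sub_pow hb n hi).2 (by positivity)).trans ?_
  have h1 : (n : ℝ)⁻¹ ≤ b * ((b : ℝ) ^ k)⁻¹ := by
    rw [← div_eq_mul_inv, le_div_iff₀ hpos, inv_mul_le_iff₀ hn']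
    linarith
  calc ((n : ℝ) ^ 2)⁻¹ * (n * ((b : ℝ) ^ k)⁻¹ + 3 * (n * ((b : ℝ) ^ k)⁻¹) ^ 2)
      = (n : ℝ)⁻¹ * ((b : ℝ) ^ k)⁻¹ + 3 * (((b : ℝ) ^ k)⁻¹) ^ 2 := by field_simp
    _ ≤ (b * ((b : ℝ) ^ k)⁻¹) * ((b : ℝ) ^ k)⁻¹ + 3 * (((b : ℝ) ^ k)⁻¹) ^ 2 := by gcongr
    _ = _ := by ring

/-- A bound for the normalized deviations of level `k`. -/
def devBound (b k : ℕ) {n : ℕ} (x : Fin n → ℝ) : ℝ := levelBound b k (dev b k x)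

lemma devBound_nonneg (b k : ℕ) (x : Fin n → ℝ) : 0 ≤ devBound b k x := levelBound_nonneg _ _ _

lemma integrable_devBound (b k n : ℕ) :
    Integrable (fun x : Fin n → ℝ => devBound b k x) (dataLaw n) :=
  integrable_levelBound fun i _ => integrable_dev_pow_four b n k i

lemma integral_devBound_le (hb : 2 ≤ b) (hn : 0 < n) {k : ℕ} (hk : b ^ k ≤ b * n) :
    ∫ x, devBound b k x ∂dataLaw n ≤ (b + 4) * (125 / 128 : ℝ) ^ k := by
  have := integral_levelBound_le (P := dataLaw n) (z := fun i x => dev b k x i) (C := b + 3) hb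
    (by positivity) (fun i _ => integrable_dev_pow_four b n k i)
    fun i hi => integral_dev_pow_four_le hb hn hi hk
  refine this.trans (le_of_eq ?_)
  ring

lemma abs_count_sub_le (hn : 0 < n) (x : Fin n → ℝ) {k i : ℕ} (hi : i < b ^ k) :
    |(count b x k i : ℝ) - n * ((b : ℝ) ^ k)⁻¹| ≤ √n * devBound b k x := by
  have hs : 0 < √(n : ℝ) := Real.sqrt_pos.2 (by exact_mod_cast hn)
  have h := abs_le_levelBound (dev b k x) hi
  rw [dev, abs_div, abs_of_pos hs, div_le_iff₀ hs] at h
  rw [mul_comm (√(n : ℝ))]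
  exact h

/-- The number of ordered pairs of data that share a cell of level `m`. -/
def collisions (b m : ℕ) {n : ℕ} (x : Fin n → ℝ) : ℝ :=
  ∑ i ∈ Finset.range (b ^ m), ((count b x m i : ℝ) ^ 2 - (count b x m i : ℝ) ^ 1)

lemma count_sq_sub_nonneg (b m i : ℕ) (x : Fin n → ℝ) :
    0 ≤ (count b x m i : ℝ) ^ 2 - (count b x m i : ℝ) ^ 1 := by
  rw [sub_nonneg]
  have h : count b x m i ^ 1 ≤ count b x m i ^ 2 := by nlinarith [Nat.zero_le (count b x m i)]
  exact_mod_cast h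

lemma collisions_nonneg (b m : ℕ) (x : Fin n → ℝ) : 0 ≤ collisions b m x :=
  Finset.sum_nonneg fun i _ => count_sq_sub_nonneg b m i x

/-- A cell with at least two data contributes at least `2`; numbers from `b ^ m` on belong to no
datum. -/
lemma count_le_one_of_collisions_lt (hb : 2 ≤ b) {m : ℕ} {x : Fin n → ℝ}
    (h : collisions b m x < 1) (i : ℕ) : count b x m i ≤ 1 := by
  by_contra hc
  rw [not_le] at hc
  have hi : i < b ^ m := by
    obtain ⟨j, hj⟩ := Finset.card_pos.1 (show 0 < count b x m i by omega)
    simp only [Finset.mem_filter, Finset.mem_univ, true_and] at hj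
    exact hj ▸ cell_lt hb m (x j)
  have h1 := Finset.single_le_sum (fun i _ => count_sq_sub_nonneg b m i x) (Finset.mem_range.2 hi)
  have h2 : (2 : ℝ) ≤ count b x m i := by exact_mod_cast hc
  unfold collisions at h
  nlinarith

lemma integrable_collisions (b m n : ℕ) :
    Integrable (fun x : Fin n → ℝ => collisions b m x) (dataLaw n) :=
  integrable_finsetSum _ fun i _ =>
    (integrable_count_pow b n m i 2).sub (integrable_count_pow b n m i 1)

/-- Each cell contributes `n * (n - 1) * p ^ 2` with `p = b ^ (-m)`, and there are `1 / p` cells. -/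
lemma integral_collisions_le (hb : 2 ≤ b) (n m : ℕ) :
    ∫ x, collisions b m x ∂dataLaw n ≤ (n : ℝ) ^ 2 * ((b : ℝ) ^ m)⁻¹ := by
  set p := ((b : ℝ) ^ m)⁻¹ with hp
  have hp0 : 0 ≤ p := by positivity
  have hterm (i : ℕ) (hi : i < b ^ m) :
      ∫ x, ((count b x m i : ℝ) ^ 2 - (count b x m i : ℝ) ^ 1) ∂dataLaw n ≤ (n : ℝ) ^ 2 * p ^ 2 := by
    have h1 : ∫ x, (count b x m i : ℝ) ^ 1 ∂dataLaw n = n * p := by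
      simp_rw [pow_one, count_eq_sum_cellInd]
      have hev (j : Fin n) : MeasurePreserving (Function.eval j) (dataLaw n) unif :=
        measurePreserving_eval (fun _ : Fin n => unif) j
      have hint : Integrable (cellInd b m i) unif := (memLp_cellInd b m i).integrable (by norm_num)
      have hint' (j : Fin n) : Integrable (fun x : Fin n → ℝ => cellInd b m i (x j)) (dataLaw n) :=
        (hev j).integrable_comp_of_integrable hint
      rw [integral_finsetSum _ fun j _ => hint' j]
      have : ∀ j : Fin n, ∫ x, cellInd b m i (x j) ∂dataLaw n = p := fun j => by
        rw [hp, ← integral_cellInd hb hi, ← (hev j).map_eq,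
          integral_map (measurable_pi_apply j).aemeasurable
            (measurable_cellInd b m i).aestronglyMeasurable]
      simp [this]
    have h2 := (integral_count_sub_pow hb n hi).1
    have e (x : Fin n → ℝ) : (count b x m i : ℝ) ^ 2 - (count b x m i : ℝ) ^ 1 =
        ((count b x m i : ℝ) - n * p) ^ 2 + ((2 * n * p - 1) * (count b x m i : ℝ) ^ 1 -
          (n * p) ^ 2) := by ring
    have i1 := integrable_count_pow b n m i 1
    have i2 : Integrable (fun x : Fin n → ℝ => ((count b x m i : ℝ) - n * p) ^ 2) (dataLaw n) := by
      have e' (x : Fin n → ℝ) : ((count b x m i : ℝ) - n * p) ^ 2 =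
          (count b x m i : ℝ) ^ 2 - 2 * n * p * (count b x m i : ℝ) ^ 1 + (n * p) ^ 2 := by ring
      simp_rw [e']
      exact ((integrable_count_pow b n m i 2).sub (i1.const_mul _)).add (integrable_const _)
    have i3 : Integrable (fun x : Fin n → ℝ => (2 * n * p - 1) * (count b x m i : ℝ) ^ 1 -
        (n * p) ^ 2) (dataLaw n) := (i1.const_mul _).sub (integrable_const _)
    simp_rw [e]
    rw [integral_add i2 i3, integral_sub (i1.const_mul _) (integrable_const _), integral_const_mul,
      h1, h2]
    simp only [integral_const, probReal_univ, smul_eq_mul, one_mul]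
    have : 0 ≤ (n : ℝ) * p ^ 2 := by positivity
    nlinarith
  have hint (i : ℕ) : Integrable (fun x : Fin n → ℝ =>
      (count b x m i : ℝ) ^ 2 - (count b x m i : ℝ) ^ 1) (dataLaw n) :=
    (integrable_count_pow b n m i 2).sub (integrable_count_pow b n m i 1)
  unfold collisions
  rw [integral_finsetSum _ fun i _ => hint i]
  calc _ ≤ ∑ i ∈ Finset.range (b ^ m), (n : ℝ) ^ 2 * p ^ 2 :=
        Finset.sum_le_sum fun i hi => hterm i (Finset.mem_range.1 hi)
    _ = _ := by
      rw [Finset.sum_const, Finset.card_range, nsmul_eq_mul, hp]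
      push_cast
      field_simp

end

section

/-! ### The time change -/

/-- The projection of the real line onto `[0,1]`. -/
def clamp (u : ℝ) : ℝ := max 0 (min 1 u)

lemma clamp_nonneg (u : ℝ) : 0 ≤ clamp u := le_max_left _ _

lemma clamp_le_one (u : ℝ) : clamp u ≤ 1 := max_le zero_le_one (min_le_left _ _)

lemma clamp_mono : Monotone clamp := fun u v h => by unfold clamp; gcongr

lemma continuous_clamp : Continuous clamp := by unfold clamp; fun_prop

lemma clamp_of_nonpos {u : ℝ} (h : u ≤ 0) : clamp u = 0 := by
  unfold clamp; rw [min_eq_right (by linarith), max_eq_left h]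

lemma clamp_of_one_le {u : ℝ} (h : 1 ≤ u) : clamp u = 1 := by
  unfold clamp; rw [min_eq_left h, max_eq_right zero_le_one]

lemma clamp_of_mem {u : ℝ} (h0 : 0 ≤ u) (h1 : u ≤ 1) : clamp u = u := by
  unfold clamp; rw [min_eq_right h1, max_eq_right h0]

lemma sum_clamp (N : ℕ) {u : ℝ} (hu : 0 ≤ u) :
    ∑ i ∈ Finset.range N, clamp (u - i) = min (N : ℝ) u := by
  induction N with
  | zero => simp [hu]
  | succ N ih =>
    rw [Finset.sum_range_succ, ih]
    push_cast
    rcases le_or_gt u N with h | h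
    · rw [min_eq_right h, clamp_of_nonpos (by linarith), min_eq_right (by linarith), add_zero]
    · rw [min_eq_left h.le]
      rcases le_or_gt u (N + 1) with h' | h'
      · rw [clamp_of_mem (by linarith) (by linarith), min_eq_right h']; ring
      · rw [clamp_of_one_le (by linarith), min_eq_left h'.le]

lemma sum_mul_clamp {N : ℕ} (p : ℕ → ℝ) {u : ℝ} (hu : 0 ≤ u) (hN : ⌊u⌋₊ < N) :
    ∑ i ∈ Finset.range N, p i * clamp (u - i) =
      ∑ i ∈ Finset.range ⌊u⌋₊, p i + p ⌊u⌋₊ * (u - ⌊u⌋₊) := by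
  have hfl := Nat.floor_le hu
  have hlt := Nat.lt_floor_add_one u
  rw [← Finset.sum_subset (Finset.range_mono (show ⌊u⌋₊ + 1 ≤ N from hN)) fun i _ hi => ?_,
    Finset.sum_range_succ, clamp_of_mem (by linarith) (by linarith)]
  · congr 1
    refine Finset.sum_congr rfl fun i hi => ?_
    have : ((i + 1 : ℕ) : ℝ) ≤ ⌊u⌋₊ := by exact_mod_cast Finset.mem_range.1 hi
    push_cast at this
    rw [clamp_of_one_le (by linarith), mul_one]
  · have : ((⌊u⌋₊ + 1 : ℕ) : ℝ) ≤ i := by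
      exact_mod_cast not_lt.1 fun h => hi (Finset.mem_range.2 h)
    push_cast at this
    rw [clamp_of_nonpos (by linarith), mul_zero]

/-- The piecewise linear time change that maps intervals of equal lengths to intervals of
prescribed lengths. -/
lemma exists_timeChange {N : ℕ} (hN : 0 < N) {p : ℕ → ℝ} (hp : ∀ i < N, 0 < p i)
    (hsum : ∑ i ∈ Finset.range N, p i = 1) :
    ∃ φ : I ≃o I, (∀ t, |(φ t : ℝ) - t| ≤ ∑ i ∈ Finset.range N, |p i - (N : ℝ)⁻¹|) ∧
      ∀ t : I, t ≠ 1 → ∑ i ∈ Finset.range ⌊(t : ℝ) * N⌋₊, p i ≤ φ t ∧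
        φ t < ∑ i ∈ Finset.range (⌊(t : ℝ) * N⌋₊ + 1), p i := by
  have hN' : (0 : ℝ) < N := by exact_mod_cast hN
  -- The factor `clamp (t * N - i)` is the fraction of the `i`-th interval of length `1 / N` that is
  -- covered up to `t`. With all weights equal to `1 / N` the sum is `t` itself, which gives the
  -- displacement bound.
  set f : ℝ → ℝ := fun t => ∑ i ∈ Finset.range N, p i * clamp (t * N - i) with hf
  have hfloor (t : ℝ) (h0 : 0 ≤ t) (h1 : t < 1) : ⌊t * N⌋₊ < N := by
    rw [Nat.floor_lt (by positivity)]; nlinarith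
  have hmem (t : I) : f t ∈ Set.Icc (0 : ℝ) 1 := by
    constructor
    · exact Finset.sum_nonneg fun i hi =>
        mul_nonneg (hp i (Finset.mem_range.1 hi)).le (clamp_nonneg _)
    · rw [← hsum]
      exact Finset.sum_le_sum fun i hi =>
        mul_le_of_le_one_right (hp i (Finset.mem_range.1 hi)).le (clamp_le_one _)
  set F : I → I := fun t => ⟨f t, hmem t⟩ with hF
  have hmono : StrictMono F := by
    intro s t hst
    have hst' : (s : ℝ) < t := hst
    have h0 : 0 ≤ (s : ℝ) * N := mul_nonneg s.2.1 hN'.le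
    have hlt := hfloor s s.2.1 (hst'.trans_le t.2.2)
    change f s < f t
    refine Finset.sum_lt_sum (fun i hi => mul_le_mul_of_nonneg_left (clamp_mono ?_)
      (hp i (Finset.mem_range.1 hi)).le) ⟨⌊(s : ℝ) * N⌋₊, Finset.mem_range.2 hlt,
        mul_lt_mul_of_pos_left ?_ (hp _ hlt)⟩
    · have : (s : ℝ) * N ≤ t * N := by gcongr
      linarith
    · have h1 := Nat.floor_le h0
      have h2 := Nat.lt_floor_add_one ((s : ℝ) * N)
      have h3 : (s : ℝ) * N < t * N := by gcongr
      rw [clamp_of_mem (by linarith) (by linarith)]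
      exact lt_max_of_lt_right (lt_min (by linarith) (by linarith))
  have hcont : Continuous F := by
    refine Continuous.subtype_mk ?_ _
    refine continuous_finsetSum _ fun i _ => continuous_const.mul (continuous_clamp.comp ?_)
    fun_prop
  have hF0 : F 0 = 0 := by
    refine Subtype.ext ?_
    change f ((0 : I) : ℝ) = 0
    refine Finset.sum_eq_zero fun i _ => ?_
    rw [clamp_of_nonpos (by simp), mul_zero]
  have hF1 : F 1 = 1 := by
    refine Subtype.ext ?_
    change f ((1 : I) : ℝ) = 1
    rw [← hsum]
    refine Finset.sum_congr rfl fun i hi => ?_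
    have : ((i + 1 : ℕ) : ℝ) ≤ N := by exact_mod_cast Finset.mem_range.1 hi
    push_cast at this
    rw [clamp_of_one_le (by rw [Set.Icc.coe_one]; linarith), mul_one]
  have hsurj : Function.Surjective F := fun y =>
    mem_range_of_exists_le_of_exists_ge hcont ⟨0, by rw [hF0]; exact y.2.1⟩
      ⟨1, by rw [hF1]; exact y.2.2⟩
  refine ⟨hmono.orderIsoOfSurjective F hsurj, fun t => ?_, fun t ht => ?_⟩
  · change |f t - t| ≤ _
    have h0 : 0 ≤ (t : ℝ) * N := mul_nonneg t.2.1 hN'.le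
    have h1 : (t : ℝ) * N ≤ N := mul_le_of_le_one_left hN'.le t.2.2
    have e : (t : ℝ) = ∑ i ∈ Finset.range N, (N : ℝ)⁻¹ * clamp (t * N - i) := by
      rw [← Finset.mul_sum, sum_clamp N h0, min_eq_right h1]
      field_simp
    have e' : f t - t = ∑ i ∈ Finset.range N, (p i - (N : ℝ)⁻¹) * clamp (t * N - i) := by
      simp_rw [sub_mul]
      rw [Finset.sum_sub_distrib, ← e]
    rw [e']
    refine (Finset.abs_sum_le_sum_abs _ _).trans (Finset.sum_le_sum fun i _ => ?_)
    rw [abs_mul, abs_of_nonneg (clamp_nonneg _)]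
    exact mul_le_of_le_one_right (abs_nonneg _) (clamp_le_one _)
  · have ht1 : (t : ℝ) < 1 := lt_of_le_of_ne t.2.2 fun e => ht (Subtype.ext e)
    have h0 : 0 ≤ (t : ℝ) * N := mul_nonneg t.2.1 hN'.le
    have hlt := hfloor t t.2.1 ht1
    have h1 := Nat.floor_le h0
    have h2 := Nat.lt_floor_add_one ((t : ℝ) * N)
    have hpk := hp _ hlt
    change _ ≤ f t ∧ f t < _
    rw [hf]
    simp only
    rw [sum_mul_clamp p h0 hlt, Finset.sum_range_succ]
    constructor
    · nlinarith
    · nlinarith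

/-! ### Comparison with the approximations -/

variable {b n : ℕ}

/-- A time change under which the datum selected at time `φ t` lies in the cell that contains
`t`. -/
lemma exists_timeChange_rank (hb : 2 ≤ b) (hn : 0 < n) (K : ℕ) {x : Fin n → ℝ}
    (hpos : ∀ i < b ^ K, 0 < count b x K i) :
    ∃ φ : I ≃o I,
      (∀ t, |(φ t : ℝ) - t| ≤
        ∑ i ∈ Finset.range (b ^ K), |(count b x K i : ℝ) / n - ((b : ℝ) ^ K)⁻¹|) ∧
      ∀ t : I, below b x K (cell b K t) < min (⌊(φ t : ℝ) * n⌋₊ + 1) n ∧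
        min (⌊(φ t : ℝ) * n⌋₊ + 1) n ≤ below b x K (cell b K t + 1) := by
  have hn' : (0 : ℝ) < n := by exact_mod_cast hn
  have hN : 0 < b ^ K := by positivity
  have hbelow (k : ℕ) : ∑ i ∈ Finset.range k, (count b x K i : ℝ) / n = below b x K k / n := by
    rw [below_eq_sum, ← Finset.sum_div]
    push_cast
    rfl
  have hle (k : ℕ) : below b x K k ≤ n := by
    refine (Finset.card_filter_le _ _).trans ?_
    simp
  obtain ⟨φ, h1, h2⟩ := exists_timeChange hN (p := fun i => (count b x K i : ℝ) / n)
    (fun i hi => div_pos (by exact_mod_cast hpos i hi) hn')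
    (by rw [hbelow, below_pow hb, div_self hn'.ne'])
  push_cast at h1 h2
  refine ⟨φ, h1, fun t => ?_⟩
  -- At the endpoint the rank is truncated to `n`, and it belongs to the last cell because that cell
  -- is not empty.
  by_cases ht : t = 1
  · subst ht
    have hφ : φ 1 = 1 := φ.map_top
    have hcell : cell b K ((1 : I) : ℝ) = b ^ K - 1 := by
      unfold cell
      rw [Set.Icc.coe_one, one_mul, ← Nat.cast_pow, Nat.floor_natCast]
      omega
    have hbk := below_succ (b := b) x K (b ^ K - 1)
    have hc := hpos (b ^ K - 1) (by omega)
    rw [Nat.sub_add_cancel hN, below_pow hb] at hbk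
    rw [hφ, hcell, Set.Icc.coe_one, one_mul, Nat.floor_natCast, min_eq_right (by omega),
      Nat.sub_add_cancel hN, below_pow hb]
    omega
  · obtain ⟨hA, hB⟩ := h2 t ht
    have ht1 : (t : ℝ) < 1 := lt_of_le_of_ne t.2.2 fun e => ht (Subtype.ext e)
    have hp : (0 : ℝ) < (b : ℝ) ^ K := by positivity
    have hlt : ⌊(t : ℝ) * (b : ℝ) ^ K⌋₊ < b ^ K := by
      rw [Nat.floor_lt (mul_nonneg t.2.1 hp.le)]
      push_cast
      nlinarith
    have hcell : cell b K t = ⌊(t : ℝ) * (b : ℝ) ^ K⌋₊ := min_eq_left (by omega)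
    rw [hbelow, ← hcell, div_le_iff₀ hn'] at hA
    rw [hbelow, ← hcell, lt_div_iff₀ hn'] at hB
    have hA' : below b x K (cell b K t) ≤ ⌊(φ t : ℝ) * n⌋₊ := Nat.le_floor hA
    have hB' : ⌊(φ t : ℝ) * n⌋₊ < below b x K (cell b K t + 1) :=
      (Nat.floor_lt (mul_nonneg (φ t).2.1 hn'.le)).2 hB
    have := hle (cell b K t + 1)
    omega

lemma splitCost_le (N : ℕ) : splitCost N ≤ N := by unfold splitCost; split_ifs <;> omega

lemma le_splitCost_add_one (N : ℕ) : N ≤ splitCost N + 1 := by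
  unfold splitCost; split_ifs <;> omega

lemma abs_splitCost_sub_le (N : ℕ) : |(splitCost N : ℝ) - N| ≤ 1 := by
  have h1 : (splitCost N : ℝ) ≤ N := by exact_mod_cast splitCost_le N
  have h2 : (N : ℝ) ≤ splitCost N + 1 := by exact_mod_cast le_splitCost_add_one N
  rw [abs_le]
  constructor <;> linarith

/-- The sum of the innovations along a path, in terms of the occupation numbers. -/
lemma sum_innov_eq (hb : 2 ≤ b) (c : ℕ → ℝ) (K : ℕ) :
    ∑ m ∈ Finset.range K, (b : ℝ) / ((b : ℝ) - 1) * (c (m + 1) - (b : ℝ)⁻¹ * c m) =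
      ∑ l ∈ Finset.range (K + 1), c l + c K / ((b : ℝ) - 1) - b / (b - 1) * c 0 := by
  have hb2 : (2 : ℝ) ≤ b := by exact_mod_cast hb
  have hb0 : (b : ℝ) ≠ 0 := by positivity
  have hb1 : (b : ℝ) - 1 ≠ 0 := by intro h; linarith
  induction K with
  | zero =>
    simp
    field_simp
    ring
  | succ K ih =>
    rw [Finset.sum_range_succ, ih, Finset.sum_range_succ _ (K + 1)]
    field_simp
    ring

/-- After telescoping, the approximation is the occupation along the path up to level `K` plus the
predicted remaining cost, centered and normalized. -/
lemma dataApprox_apply (hb : 2 ≤ b) (K : ℕ) (x : Fin n → ℝ) (t : I) :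
    dataApprox hb K x t = (√n)⁻¹ *
      (∑ l ∈ Finset.range (K + 1), (count b x l (cell b l t) : ℝ) +
        (count b x K (cell b K t) : ℝ) / ((b : ℝ) - 1) - b / (b - 1) * n) := by
  have h := stepFun_path_apply hb K (fun m i => (√n)⁻¹ * ∑ j, dataInnov b m i (x j)) t
  have h0 : (count b x 0 (cell b 0 t) : ℝ) = n := by simp [count]
  have hs := sum_innov_eq hb (fun l => (count b x l (cell b l t) : ℝ)) K
  simp only [h0] at hs
  refine h.trans ?_
  rw [← hs, Finset.mul_sum]
  refine Finset.sum_congr rfl fun m _ => ?_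
  congr 1
  simp only [dataInnov, count_eq_sum_cellInd, Nat.add_sub_cancel, cell_succ_div hb]
  rw [← Finset.mul_sum, Finset.sum_sub_distrib, Finset.mul_sum]

lemma sum_Ico_inv_pow (hb : 2 ≤ b) {K L : ℕ} (h : K < L) :
    ∑ l ∈ Finset.Ico (K + 1) L, ((b : ℝ) ^ l)⁻¹ =
      (((b : ℝ) ^ K)⁻¹ - b * ((b : ℝ) ^ L)⁻¹) / ((b : ℝ) - 1) := by
  have hb2 : (2 : ℝ) ≤ b := by exact_mod_cast hb
  have hb0 : (b : ℝ) ≠ 0 := by positivity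
  have hb1 : (b : ℝ) - 1 ≠ 0 := by intro h; linarith
  induction L, h using Nat.le_induction with
  | base =>
    rw [Finset.Ico_self, Finset.sum_empty, pow_succ]
    field_simp
    ring
  | succ L hL ih =>
    rw [Finset.sum_Ico_succ_top hL, ih, pow_succ]
    field_simp
    ring

/-- The cost along a path of cells, compared with its prediction after `K` levels. -/
lemma abs_sum_splitCost_sub_le (hb : 2 ≤ b) {c : ℕ → ℕ} (hc : Antitone c) {D : ℕ → ℝ} {r : ℝ}
    {K L m : ℕ} (hKL : K < L) (hLm : L ≤ m) (hnL : (n : ℝ) ≤ (b : ℝ) ^ L)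
    (hD : ∀ l ≤ L, |(c l : ℝ) - n * ((b : ℝ) ^ l)⁻¹| ≤ r * D l) :
    |∑ l ∈ Finset.range m, (splitCost (c l) : ℝ) -
        (∑ l ∈ Finset.range (K + 1), (c l : ℝ) + (c K : ℝ) / ((b : ℝ) - 1))| ≤
      r * (∑ l ∈ Finset.Ico K L, D l + (m - L) * D L) + (m + 2) := by
  have hb2 : (2 : ℝ) ≤ b := by exact_mod_cast hb
  have hb1 : (0 : ℝ) < (b : ℝ) - 1 := by linarith
  have hpL : (0 : ℝ) < (b : ℝ) ^ L := by positivity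
  have hsplit : ∑ l ∈ Finset.range m, (splitCost (c l) : ℝ) =
      ∑ l ∈ Finset.range (K + 1), (splitCost (c l) : ℝ) +
        ∑ l ∈ Finset.Ico (K + 1) L, (splitCost (c l) : ℝ) +
          ∑ l ∈ Finset.Ico L m, (splitCost (c l) : ℝ) := by
    rw [Finset.range_eq_Ico, Finset.range_eq_Ico,
      Finset.sum_Ico_consecutive _ (Nat.zero_le _) hKL, Finset.sum_Ico_consecutive _ (Nat.zero_le _) hLm]
  have h1 : |∑ l ∈ Finset.range (K + 1), (splitCost (c l) : ℝ) -
      ∑ l ∈ Finset.range (K + 1), (c l : ℝ)| ≤ K + 1 := by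
    rw [← Finset.sum_sub_distrib]
    refine (Finset.abs_sum_le_sum_abs _ _).trans ?_
    refine (Finset.sum_le_sum fun l _ => abs_splitCost_sub_le (c l)).trans ?_
    simp
  have h2 : |∑ l ∈ Finset.Ico (K + 1) L, (splitCost (c l) : ℝ) -
      ∑ l ∈ Finset.Ico (K + 1) L, n * ((b : ℝ) ^ l)⁻¹| ≤
        r * ∑ l ∈ Finset.Ico (K + 1) L, D l + (L - (K + 1)) := by
    rw [← Finset.sum_sub_distrib]
    refine (Finset.abs_sum_le_sum_abs _ _).trans ?_
    have : ∑ l ∈ Finset.Ico (K + 1) L, |(splitCost (c l) : ℝ) - n * ((b : ℝ) ^ l)⁻¹| ≤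
        ∑ l ∈ Finset.Ico (K + 1) L, (r * D l + 1) := Finset.sum_le_sum fun l hl => by
      have ha := abs_splitCost_sub_le (c l)
      have hd := hD l (Finset.mem_Ico.1 hl).2.le
      have := abs_sub_le (splitCost (c l) : ℝ) (c l) (n * ((b : ℝ) ^ l)⁻¹)
      linarith
    refine this.trans (le_of_eq ?_)
    rw [Finset.sum_add_distrib, ← Finset.mul_sum, Finset.sum_const, Nat.card_Ico, nsmul_eq_mul,
      Nat.cast_sub hKL]
    push_cast
    ring
  have hL1 : (n : ℝ) * ((b : ℝ) ^ L)⁻¹ ≤ 1 := by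
    rw [← div_eq_mul_inv, div_le_one hpL]; exact hnL
  -- From level `L` on the mean occupation is at most one; by monotonicity each level costs at most
  -- `c L`.
  have h3 : ∑ l ∈ Finset.Ico L m, (splitCost (c l) : ℝ) ≤ (m - L) * (r * D L + 1) := by
    have hcL : (c L : ℝ) ≤ r * D L + 1 := by
      have := (abs_le.1 (hD L le_rfl)).2
      linarith
    have : ∑ l ∈ Finset.Ico L m, (splitCost (c l) : ℝ) ≤ ∑ l ∈ Finset.Ico L m, (r * D L + 1) :=
      Finset.sum_le_sum fun l hl => by
        have h' : (splitCost (c l) : ℝ) ≤ c L := by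
          exact_mod_cast (splitCost_le _).trans (hc (Finset.mem_Ico.1 hl).1)
        linarith
    refine this.trans (le_of_eq ?_)
    rw [Finset.sum_const, Nat.card_Ico, nsmul_eq_mul, Nat.cast_sub hLm]
  have h3' : 0 ≤ ∑ l ∈ Finset.Ico L m, (splitCost (c l) : ℝ) :=
    Finset.sum_nonneg fun l _ => by positivity
  -- The truncated geometric series misses `b / (b - 1) * n * b ^ (-L)`, which is at most `2`.
  have h4 : |∑ l ∈ Finset.Ico (K + 1) L, n * ((b : ℝ) ^ l)⁻¹ - (c K : ℝ) / ((b : ℝ) - 1)| ≤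
      r * D K + 2 := by
    have hK := abs_le.1 (hD K hKL.le)
    have hK0 : 0 ≤ r * D K := (abs_nonneg _).trans (hD K hKL.le)
    have hL0 : 0 ≤ (n : ℝ) * ((b : ℝ) ^ L)⁻¹ := by positivity
    have e : ∑ l ∈ Finset.Ico (K + 1) L, n * ((b : ℝ) ^ l)⁻¹ - (c K : ℝ) / ((b : ℝ) - 1) =
        (n * ((b : ℝ) ^ K)⁻¹ - c K - b * (n * ((b : ℝ) ^ L)⁻¹)) / ((b : ℝ) - 1) := by
      rw [← Finset.mul_sum, sum_Ico_inv_pow hb hKL]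
      ring
    rw [e, abs_div, abs_of_pos hb1, div_le_iff₀ hb1, abs_le]
    constructor <;> nlinarith
  have hIco : ∑ l ∈ Finset.Ico K L, D l = D K + ∑ l ∈ Finset.Ico (K + 1) L, D l :=
    Finset.sum_eq_sum_Ico_succ_bot hKL D
  -- The rounding errors `K + 1`, `L - (K + 1)`, `m - L` and `2` add up to `m + 2`. The deviation of
  -- `c K` in the prediction is why the sum of the `D l` starts at `K`.
  rw [hsplit, hIco]
  rw [abs_le] at h1 h2 h4 ⊢
  constructor <;> nlinarith

/-- A bound for the error of the approximation by the first `K` levels; the levels below `L` are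
compared with their mean, the other ones are estimated by the level `L`. -/
def errorBound (b K L : ℕ) {n : ℕ} (x : Fin n → ℝ) : ℝ :=
  ∑ l ∈ Finset.Ico K L, devBound b l x + 2 * L * devBound b L x + (3 * L + 2) / √n +
    (b : ℝ) ^ K * devBound b K x / √n

/-- After the time change, the selected datum shares its cells up to level `K` with `t`, so the
explicit parts of cost and prediction agree up to rounding; the bounds on deeper levels are uniform
over all paths. The last term of `errorBound` controls the displacement of time. -/
lemma dist_X_dataApprox_le (hb : 2 ≤ b) (hn : 0 < n) {K L : ℕ} (hKL : K < L)
    (hnL : n ≤ b ^ L) {x : Fin n → ℝ} (hcoll : collisions b (3 * L) x < 1)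
    (herr : errorBound b K L x < 1) : dist (X b x) (dataApprox hb K x) ≤ errorBound b K L x := by
  have hn' : (0 : ℝ) < n := by exact_mod_cast hn
  have hs : 0 < √(n : ℝ) := Real.sqrt_pos.2 hn'
  have hss : √(n : ℝ) * √n = n := Real.mul_self_sqrt hn'.le
  have hpK : (0 : ℝ) < (b : ℝ) ^ K := by positivity
  have hcount := count_le_one_of_collisions_lt hb hcoll
  have hinj := injective_of_count_le_one hcount
  have hA0 : 0 ≤ ∑ l ∈ Finset.Ico K L, devBound b l x :=
    Finset.sum_nonneg fun l _ => devBound_nonneg b l x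
  have hB0 : 0 ≤ 2 * L * devBound b L x := mul_nonneg (by positivity) (devBound_nonneg b L x)
  have hC0 : (0 : ℝ) ≤ (3 * L + 2) / √n := by positivity
  have hE0 : 0 ≤ (b : ℝ) ^ K * devBound b K x / √n :=
    div_nonneg (mul_nonneg hpK.le (devBound_nonneg b K x)) hs.le
  -- An empty cell deviates from its mean by the whole mean, which would make the last term of
  -- `errorBound` at least `1`. Nonempty cells are needed for the time change to be strictly
  -- increasing.
  have hpos (i : ℕ) (hi : i < b ^ K) : 0 < count b x K i := by
    by_contra h0
    have h0 : count b x K i = 0 := by omega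
    have h := abs_count_sub_le hn x hi
    rw [h0, Nat.cast_zero, zero_sub, abs_neg, abs_of_nonneg (by positivity)] at h
    have : 1 ≤ (b : ℝ) ^ K * devBound b K x / √n := by
      rw [le_div_iff₀ hs, one_mul]
      have h2 : √n * (√n * ((b : ℝ) ^ K)⁻¹) ≤ √n * devBound b K x := by
        rw [← mul_assoc, hss]
        exact h
      have h3 := le_of_mul_le_mul_left h2 hs
      rw [← div_eq_mul_inv, div_le_iff₀ hpK] at h3
      linarith
    unfold errorBound at herr
    linarith
  obtain ⟨φ, hφ, hrank⟩ := exists_timeChange_rank hb hn K hpos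
  -- `SkorokhodClose` moves the time of its second argument, which has to be the process indexed by
  -- ranks.
  rw [dist_comm]
  refine SkorokhodClose.dist_le ⟨φ, fun t => ⟨(hφ t).trans ?_, ?_⟩⟩
  · have hterm (i : ℕ) (hi : i ∈ Finset.range (b ^ K)) :
        |(count b x K i : ℝ) / n - ((b : ℝ) ^ K)⁻¹| ≤ devBound b K x / √n := by
      have h := abs_count_sub_le hn x (Finset.mem_range.1 hi)
      have e : (count b x K i : ℝ) / n - ((b : ℝ) ^ K)⁻¹ =
          ((count b x K i : ℝ) - n * ((b : ℝ) ^ K)⁻¹) / n := by field_simp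
      rw [e, abs_div, abs_of_pos hn', div_le_div_iff₀ hn' hs]
      calc _ ≤ √n * devBound b K x * √n := by gcongr
        _ = devBound b K x * (√n * √n) := by ring
        _ = _ := by rw [hss]
    refine (Finset.sum_le_sum hterm).trans ?_
    rw [Finset.sum_const, Finset.card_range, nsmul_eq_mul]
    push_cast
    rw [← mul_div_assoc]
    unfold errorBound
    linarith
  · obtain ⟨hr1, hr2⟩ := hrank t
    obtain ⟨j, hj⟩ := exists_rank_eq hinj (show 1 ≤ min (⌊(φ t : ℝ) * n⌋₊ + 1) n by omega)
      (min_le_right _ _)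
    rw [← hj] at hr1 hr2
    have hcell := cell_eq_of_rank hr1 hr2
    have hcell' (l : ℕ) (hl : l ≤ K) : cell b l (x j) = cell b l t := cell_eq_of_le hb hl hcell
    have hX : X b x (φ t) = (√n)⁻¹ *
        (∑ l ∈ Finset.range (3 * L), (splitCost (count b x l (cell b l (x j))) : ℝ) -
          b / (b - 1) * n) := by
      change normalized b x (φ t) = _
      rw [normalized, ← hj, Y_rank hb x j hcount]
      push_cast
      rw [div_eq_inv_mul]
    have hT : dataApprox hb K x t = (√n)⁻¹ *
        (∑ l ∈ Finset.range (K + 1), (count b x l (cell b l (x j)) : ℝ) +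
          (count b x K (cell b K (x j)) : ℝ) / ((b : ℝ) - 1) - b / (b - 1) * n) := by
      rw [dataApprox_apply, hcell]
      congr 3
      refine Finset.sum_congr rfl fun l hl => ?_
      rw [hcell' l (by have := Finset.mem_range.1 hl; omega)]
    have key := abs_sum_splitCost_sub_le (n := n) hb (c := fun l => count b x l (cell b l (x j)))
      (fun k l h => count_cell_anti hb x h (x j)) (D := fun l => devBound b l x) (r := √n) hKL
      (show L ≤ 3 * L by omega) (by exact_mod_cast hnL)
      fun l _ => abs_count_sub_le hn x (cell_lt hb l (x j))
    rw [hX, hT, ← mul_sub, abs_mul, abs_of_pos (inv_pos.2 hs), sub_sub_sub_cancel_right,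
      abs_sub_comm, inv_mul_le_iff₀ hs]
    refine key.trans ?_
    have e : √(n : ℝ) * ((3 * L + 2) / √n) = 3 * L + 2 := by field_simp
    have hE : 0 ≤ √(n : ℝ) * ((b : ℝ) ^ K * devBound b K x / √n) := mul_nonneg hs.le hE0
    unfold errorBound
    rw [mul_add √(n : ℝ) (_ + _) ((b : ℝ) ^ K * devBound b K x / √n),
      mul_add √(n : ℝ) (_ + _) ((3 * L + 2) / √n), e]
    push_cast
    have e2 : (3 * (L : ℝ) - L) = 2 * L := by ring
    rw [e2]
    linarith

end

section

/-! ### Convergence of the processes -/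

variable {n b : ℕ}

lemma tendsto_clog (hb : 2 ≤ b) : Tendsto (fun n => Nat.clog b n) atTop atTop := by
  refine tendsto_atTop.2 fun M => ?_
  filter_upwards [eventually_gt_atTop (b ^ M)] with n hn
  by_contra h
  have := (Nat.le_pow_clog (by omega : 1 < b) n).trans
    (Nat.pow_le_pow_right (by omega) (not_le.1 h).le)
  omega

/-- Together with `n ≤ b ^ L` this places `b ^ L` within a factor `b` of `n`: the mean occupation at
level `L` is at most one, while the fourth moment bound is still valid there. -/
lemma pow_clog_le (hb : 2 ≤ b) (hn : 0 < n) : b ^ Nat.clog b n ≤ b * n := by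
  rcases Nat.lt_or_ge 1 n with h | h
  · have h1 := Nat.pow_pred_clog_lt_self (by omega : 1 < b) h
    have h2 : 0 < Nat.clog b n := Nat.clog_pos (by omega) (by omega)
    have h3 : Nat.clog b n = (Nat.clog b n).pred + 1 := by
      rw [Nat.pred_eq_sub_one]
      omega
    rw [h3, pow_succ, mul_comm]
    exact Nat.mul_le_mul_left _ h1.le
  · have : n = 1 := by omega
    subst this
    rw [Nat.clog_one_right, pow_zero]
    omega

/-- Rewrites the rate in terms of `L = Nat.clog b n`, so that the vanishing part of the error
becomes a function of `L` alone. -/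
lemma inv_sqrt_le (hb : 2 ≤ b) (hn : 0 < n) :
    (√(n : ℝ))⁻¹ ≤ √(b : ℝ) * (√(b : ℝ))⁻¹ ^ Nat.clog b n := by
  have hb' : 0 < √(b : ℝ) := Real.sqrt_pos.2 (by positivity)
  have hs : 0 < √(n : ℝ) := Real.sqrt_pos.2 (by positivity)
  have h : √(b : ℝ) ^ Nat.clog b n ≤ √(b : ℝ) * √n := by
    rw [← Real.sqrt_mul (by positivity), Real.le_sqrt (by positivity), ← pow_mul, mul_comm _ 2,
      pow_mul, Real.sq_sqrt (by positivity)]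
    · exact_mod_cast pow_clog_le hb hn
    · positivity
  rw [inv_pow, ← div_eq_mul_inv, le_div_iff₀ (by positivity), inv_mul_le_iff₀ hs]
  linarith

lemma errorBound_nonneg (b K L : ℕ) (x : Fin n → ℝ) : 0 ≤ errorBound b K L x := by
  have h1 := Finset.sum_nonneg fun l (_ : l ∈ Finset.Ico K L) => devBound_nonneg b l x
  have h2 := devBound_nonneg b L x
  have h3 := devBound_nonneg b K x
  unfold errorBound
  positivity

lemma integrable_errorBound (b K L n : ℕ) :
    Integrable (fun x : Fin n → ℝ => errorBound b K L x) (dataLaw n) :=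
  (((integrable_finsetSum _ fun l _ => integrable_devBound b l n).add
    ((integrable_devBound b L n).const_mul _)).add (integrable_const _)).add
    (((integrable_devBound b K n).const_mul _).div_const _)

/-- The part of the expected error that vanishes for `L → ∞`. -/
def remainder (b K L : ℕ) : ℝ :=
  (b + 4) * (2 * (L * (125 / 128 : ℝ) ^ L)) +
    (3 * L + 2 + (b : ℝ) ^ K * (b + 4)) * (√(b : ℝ) * (√(b : ℝ))⁻¹ ^ L)

lemma tendsto_remainder (hb : 2 ≤ b) (K : ℕ) : Tendsto (remainder b K) atTop (𝓝 0) := by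
  have hq : (√(b : ℝ))⁻¹ < 1 :=
    inv_lt_one_of_one_lt₀ (Real.lt_sqrt_of_sq_lt (by
      have : (2 : ℝ) ≤ b := by exact_mod_cast hb
      linarith))
  have hq0 : 0 ≤ (√(b : ℝ))⁻¹ := by positivity
  have h1 := tendsto_self_mul_const_pow_of_lt_one (r := (125 / 128 : ℝ)) (by norm_num)
    (by norm_num)
  have h2 := tendsto_self_mul_const_pow_of_lt_one hq0 hq
  have h3 := tendsto_pow_atTop_nhds_zero_of_lt_one hq0 hq
  have h := ((h1.const_mul 2).const_mul ((b : ℝ) + 4)).add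
    ((h2.const_mul (3 * √(b : ℝ))).add (h3.const_mul ((2 + (b : ℝ) ^ K * (b + 4)) * √(b : ℝ))))
  simp only [mul_zero, add_zero] at h
  refine h.congr fun L => ?_
  unfold remainder
  ring

/-- The factor `128 / 3` is the geometric sum `1 / (1 - 125 / 128)`. Only this first part survives
as `n → ∞`, and it is small for large `K`. -/
lemma integral_errorBound_le (hb : 2 ≤ b) (hn : 0 < n) {K : ℕ} (hK : K < Nat.clog b n) :
    ∫ x, errorBound b K (Nat.clog b n) x ∂dataLaw n ≤
      (b + 4) * 128 / 3 * (125 / 128 : ℝ) ^ K + remainder b K (Nat.clog b n) := by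
  set L := Nat.clog b n with hL
  have hdev (l : ℕ) (hl : l ≤ L) :
      ∫ x, devBound b l x ∂dataLaw n ≤ (b + 4) * (125 / 128 : ℝ) ^ l :=
    integral_devBound_le hb hn ((Nat.pow_le_pow_right (by omega) hl).trans (pow_clog_le hb hn))
  have i1 : Integrable (fun x : Fin n → ℝ => ∑ l ∈ Finset.Ico K L, devBound b l x) (dataLaw n) :=
    integrable_finsetSum _ fun l _ => integrable_devBound b l n
  have i2 : Integrable (fun x : Fin n → ℝ => 2 * L * devBound b L x) (dataLaw n) :=
    (integrable_devBound b L n).const_mul _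
  have i12 : Integrable (fun x : Fin n → ℝ => ∑ l ∈ Finset.Ico K L, devBound b l x +
      2 * L * devBound b L x) (dataLaw n) := i1.add i2
  have i3 : Integrable (fun x : Fin n → ℝ => ∑ l ∈ Finset.Ico K L, devBound b l x +
      2 * L * devBound b L x + (3 * L + 2) / √n) (dataLaw n) := i12.add (integrable_const _)
  have e : ∫ x, errorBound b K L x ∂dataLaw n =
      ∑ l ∈ Finset.Ico K L, ∫ x, devBound b l x ∂dataLaw n +
        2 * L * ∫ x, devBound b L x ∂dataLaw n + (3 * L + 2) / √n +
        (b : ℝ) ^ K * (∫ x, devBound b K x ∂dataLaw n) / √n := by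
    unfold errorBound
    rw [integral_add i3 (((integrable_devBound b K n).const_mul _).div_const _),
      integral_add i12 (integrable_const _), integral_add i1 i2,
      integral_finsetSum _ fun l _ => integrable_devBound b l n, integral_const_mul,
      integral_div, integral_div, integral_const_mul]
    simp
  have h1 : ∑ l ∈ Finset.Ico K L, ∫ x, devBound b l x ∂dataLaw n ≤
      (b + 4) * 128 / 3 * (125 / 128 : ℝ) ^ K := by
    calc _ ≤ ∑ l ∈ Finset.Ico K L, ((b : ℝ) + 4) * (125 / 128 : ℝ) ^ l :=
          Finset.sum_le_sum fun l hl => hdev l (Finset.mem_Ico.1 hl).2.le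
      _ = ((b : ℝ) + 4) * ∑ l ∈ Finset.Ico K L, (125 / 128 : ℝ) ^ l := by rw [Finset.mul_sum]
      _ ≤ ((b : ℝ) + 4) * ((125 / 128 : ℝ) ^ K / (1 - 125 / 128)) := by
          gcongr
          exact geom_sum_Ico_le_of_lt_one (by norm_num) (by norm_num)
      _ = _ := by ring
  have h2 : 2 * L * ∫ x, devBound b L x ∂dataLaw n ≤
      2 * L * ((b + 4) * (125 / 128 : ℝ) ^ L) := by
    gcongr
    exact hdev L le_rfl
  have h3 : ∫ x, devBound b K x ∂dataLaw n ≤ b + 4 :=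
    (hdev K hK.le).trans (mul_le_of_le_one_right (by positivity)
      (pow_le_one₀ (by norm_num) (by norm_num)))
  have h4 : (3 * L + 2) / √n + (b : ℝ) ^ K * (∫ x, devBound b K x ∂dataLaw n) / √n ≤
      (3 * L + 2 + (b : ℝ) ^ K * (b + 4)) * (√(b : ℝ) * (√(b : ℝ))⁻¹ ^ L) := by
    rw [← add_div, div_eq_mul_inv]
    gcongr
    exact inv_sqrt_le hb hn
  rw [e]
  unfold remainder
  linarith

/-- Markov's inequality; three times `Nat.clog b n` levels make the expected number of colliding
pairs at most `n ^ 2 / n ^ 3`. -/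
lemma measure_collisions_le (hb : 2 ≤ b) (hn : 0 < n) :
    (dataLaw n).real {x | 1 ≤ collisions b (3 * Nat.clog b n) x} ≤ (n : ℝ)⁻¹ := by
  have h := mul_meas_ge_le_integral_of_nonneg
    (Eventually.of_forall fun x => collisions_nonneg b (3 * Nat.clog b n) x)
    (integrable_collisions b (3 * Nat.clog b n) n) 1
  rw [one_mul] at h
  refine (h.trans (integral_collisions_le hb n _)).trans ?_
  have hn' : (0 : ℝ) < n := by positivity
  have hL : (n : ℝ) ≤ (b : ℝ) ^ Nat.clog b n := by
    exact_mod_cast Nat.le_pow_clog (by omega : 1 < b) n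
  calc (n : ℝ) ^ 2 * ((b : ℝ) ^ (3 * Nat.clog b n))⁻¹ ≤ (n : ℝ) ^ 2 * ((n : ℝ) ^ 3)⁻¹ := by
        rw [mul_comm 3, pow_mul]
        gcongr
    _ = (n : ℝ)⁻¹ := by field_simp

lemma exists_measure_dist_dataApprox_le (hb : 2 ≤ b) {ε : ℝ} (hε : 0 < ε) :
    ∀ᶠ K in atTop, ∀ᶠ n in atTop, ∃ s, dataLaw n s ≤ ENNReal.ofReal ε ∧
      ∀ x ∉ s, dist (X b x) (dataApprox hb K x) ≤ ε := by
  -- The comparison requires `errorBound < 1`, hence a threshold below `1`. Markov's inequality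
  -- turns the expected error `δ * ε / 2` into probability `ε / 2`, and collisions use up the other
  -- half.
  set δ := min ε (1 / 2) with hδ
  have hδ0 : 0 < δ := by positivity
  have hδε : δ ≤ ε := min_le_left _ _
  have hδ1 : δ < 1 := (min_le_right _ _).trans_lt (by norm_num)
  have hK : Tendsto (fun K : ℕ => ((b : ℝ) + 4) * 128 / 3 * (125 / 128 : ℝ) ^ K) atTop (𝓝 0) := by
    simpa using (tendsto_pow_atTop_nhds_zero_of_lt_one (r := (125 / 128 : ℝ)) (by norm_num)
      (by norm_num)).const_mul (((b : ℝ) + 4) * 128 / 3)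
  filter_upwards [hK.eventually_lt_const (show 0 < δ * ε / 4 by positivity)] with K hK
  filter_upwards [eventually_gt_atTop 0, (tendsto_clog hb).eventually_gt_atTop K,
    ((tendsto_remainder hb K).comp (tendsto_clog hb)).eventually_lt_const
      (show 0 < δ * ε / 4 by positivity),
    tendsto_inv_atTop_nhds_zero_nat (𝕜 := ℝ) |>.eventually_lt_const
      (show 0 < ε / 2 by positivity)] with n hn hKL hrem hinv
  refine ⟨{x | δ ≤ errorBound b K (Nat.clog b n) x} ∪
    {x | 1 ≤ collisions b (3 * Nat.clog b n) x}, ?_, fun x hx => ?_⟩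
  · have h1 := mul_meas_ge_le_integral_of_nonneg (μ := dataLaw n)
      (Eventually.of_forall fun x => errorBound_nonneg b K (Nat.clog b n) x)
      (integrable_errorBound b K (Nat.clog b n) n) δ
    have h2 := integral_errorBound_le hb hn hKL
    have h3 := measure_collisions_le hb hn
    have h4 : (dataLaw n).real {x | δ ≤ errorBound b K (Nat.clog b n) x} ≤ ε / 2 := by
      refine le_of_mul_le_mul_left ?_ hδ0
      simp only [Function.comp_apply] at hrem
      linarith
    rw [← ENNReal.ofReal_toReal (measure_ne_top (dataLaw n) _)]
    refine ENNReal.ofReal_le_ofReal ?_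
    refine (measureReal_union_le (μ := dataLaw n) _ _).trans ?_
    linarith
  · rw [Set.mem_union, not_or] at hx
    have h1 : errorBound b K (Nat.clog b n) x < δ := not_le.1 hx.1
    have h2 : collisions b (3 * Nat.clog b n) x < 1 := not_le.1 hx.2
    exact (dist_X_dataApprox_le hb hn hKL (Nat.le_pow_clog (by omega) n) h2
      (h1.trans hδ1)).trans (h1.le.trans hδε)

theorem tendstoInDistribution_X_dataLaw (hb : 2 ≤ b) :
    TendstoInDistribution (fun n (x : Fin n → ℝ) => X b x) atTop (limitPath hb) dataLaw noise := by
  refine tendstoInDistribution_of_approx (fun n => (measurable_X b).aemeasurable)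
    (aemeasurable_limitPath hb) (tendstoInDistribution_dataApprox hb) fun ε hε => ?_
  obtain ⟨K, h1, h2⟩ := ((exists_measure_dist_dataApprox_le hb hε).and
    (exists_measure_dist_limitApprox_le hb hε)).exists
  exact ⟨K, h1, h2⟩

lemma cond_Icc_eq_unif : cond volume (Set.Icc (0 : ℝ) 1) = unif := by
  simp [ProbabilityTheory.cond, unif]

lemma map_eq_dataLaw {Ω : Type*} [MeasurableSpace Ω] {P : Measure Ω} [IsProbabilityMeasure P]
    {U : Fin n → Ω → ℝ} (hind : iIndepFun U P)
    (hU : ∀ i, pdf.IsUniform (U i) (Set.Icc 0 1) P volume) :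
    AEMeasurable (fun ω i => U i ω) P ∧ P.map (fun ω i => U i ω) = dataLaw n := by
  have hm (i : Fin n) : AEMeasurable (U i) P := (hU i).aemeasurable (by simp) (by simp)
  refine ⟨aemeasurable_pi_iff.2 hm, ?_⟩
  rw [(iIndepFun_iff_map_fun_eq_pi_map hm).1 hind]
  congr 1
  funext i
  exact (hU i).trans cond_Icc_eq_unif

/-- The law of the path depends only on the joint law of the data, so the product space suffices. -/
theorem tendstoInDistribution_X (hb : 2 ≤ b) {Ω : ℕ → Type*} [∀ n, MeasurableSpace (Ω n)]
    {P : ∀ n, Measure (Ω n)} [∀ n, IsProbabilityMeasure (P n)] {U : ∀ n, Fin n → Ω n → ℝ}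
    (hind : ∀ n, iIndepFun (U n) (P n))
    (hU : ∀ n i, pdf.IsUniform (U n i) (Set.Icc 0 1) (P n) volume) :
    TendstoInDistribution (fun n ω => X b (fun i => U n i ω)) atTop (limitPath hb) P noise := by
  have hlaw (n : ℕ) := map_eq_dataLaw (hind n) (hU n)
  refine ⟨fun n => (measurable_X b).comp_aemeasurable (hlaw n).1, aemeasurable_limitPath hb, ?_⟩
  refine (tendstoInDistribution_X_dataLaw hb).tendsto.congr fun n => Subtype.ext ?_
  change (dataLaw n).map (X b) = (P n).map (X b ∘ fun ω i => U n i ω)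
  rw [← (hlaw n).2, AEMeasurable.map_map_of_aemeasurable (measurable_X b).aemeasurable (hlaw n).1]

end

end RadixSelection

end
theorem theorem2p1 (b : ℕ) (hb : 2 ≤ b) :
    ∃ (Ω' : Type) (_ : MeasurableSpace Ω') (P' : Measure Ω') (_ : IsProbabilityMeasure P')
      (G : Ω' → RadixSelection.Cadlag),
      IsGaussianProcess (fun (t : I) (ω : Ω') => G ω t) P' ∧
      (∀ t : I, ∫ ω, G ω t ∂P' = 0) ∧
      (∀ s t : I, ∫ ω, G ω s * G ω t ∂P' =
        (b : ℝ) / ((b : ℝ) - 1) ^ 2 -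
          ((b : ℝ) + 1) / ((b : ℝ) - 1) ^ 2 *
            RadixSelection.negPow b (RadixSelection.prefixLength b s t)) ∧
      ∀ (Ω : ℕ → Type*) (_ : ∀ n, MeasurableSpace (Ω n)) (P : ∀ n, Measure (Ω n))
        (_ : ∀ n, IsProbabilityMeasure (P n)) (U : ∀ n, Fin n → Ω n → ℝ),
        (∀ n, iIndepFun (U n) (P n)) →
        (∀ n i, pdf.IsUniform (U n i) (Set.Icc 0 1) (P n) volume) →
        TendstoInDistribution
          (fun n ω => RadixSelection.X b (fun i => U n i ω)) atTop G P P' := by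
  exact ⟨ℕ × ℕ → ℝ, inferInstance, RadixSelection.noise, inferInstance,
    RadixSelection.limitPath hb, RadixSelection.isGaussianProcess_limitPath hb,
    RadixSelection.integral_limitPath hb,
    RadixSelection.integral_limitPath_mul_limitPath hb,
    fun _ _ _ _ _ hind hU => RadixSelection.tendstoInDistribution_X hb hind hU⟩
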